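/- Let $d\ge 2$ and $1<p<\infty$, and let $G(u)=\frac14(1-u^2)^2$ and $c_0=\int_{-1}^1\sqrt{2G(s)}\,ds$. For $\phi,L>0$ let $\Omega_{\phi,L}=[-\phi L/2,\phi L/2]^d$, and for $u\in -1+L^p(\mathbb{R}^d)$ define $$\mathcal{E}_{\phi L}(u)=\int_{\Omega_{\phi,L}}\frac{\phi}{2}|\nabla u|^2+\frac1\phi\bigl(G(u)-G(-1+\phi)\bigr)\,dx$$ if $u\in H^1\cap L^4(\Omega_{\phi,L})$, $u=-1$ a.e. in $\mathbb{R}^d\setminus\Omega_{\phi,L}$, and the mean of $u$ over $\Omega_{\phi,L}$ is $-1+\phi$; and $\mathcal{E}_{\phi L}(u)=+\infty$ otherwise. For $0<\xi<\infty$ and $u\in -1+L^p(\mathbb{R}^d)$ define, with $C=\{x:u(x)=1\}$, $$\mathcal{E}^\xi_0(u)=c_0\,\mathrm{Per}(C)-4|C|+4\xi^{-(d+1)}|C|^2$$ if $u=\pm1$ a.e. in $\mathbb{R}^d$ and the perimeter $\mathrm{Per}(C)$ of $C$ in $\mathbb{R}^d$ is finite; and $\mathcal{E}^\xi_0(u)=+\infty$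 otherwise. If $\phi,L>0$ with $\phi\to0$, $L\to\infty$ and $\phi L^{d/(d+1)}\to\xi\in(0,\infty)$, then $\mathcal{E}_{\phi L}$ $\Gamma$-converges to $\mathcal{E}^\xi_0$ in $-1+L^p(\mathbb{R}^d)$ with the $L^p$-distance. That is, for all sequences $\phi_n,L_n>0$ with $\phi_n\to 0$, $L_n\to\infty$ and $\phi_nL_n^{d/(d+1)}\to\xi$, and every $u\in-1+L^p(\mathbb{R}^d)$: every sequence $u_n\to u$ satisfies $\mathcal{E}^\xi_0(u)\le\liminf_{n}\mathcal{E}_{\phi_nL_n}(u_n)$, and there is a sequence $u_n\to u$ with $\limsup_{n}\mathcal{E}_{\phi_nL_n}(u_n)\le\mathcal{E}^\xi_0(u)$. -/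

import Mathlib

open MeasureTheory Set Filter Topology
open scoped ENNReal ContDiff

namespace CahnHilliard

/-- Sequential `Γ`-convergence of extended-real functionals `F n` to `F₀` on a metric space:
the liminf inequality along every convergent sequence, and the existence of recovery sequences. -/
def GammaTendsto {X : Type*} [PseudoMetricSpace X] (F : ℕ → X → EReal) (F₀ : X → EReal) : Prop :=
  (∀ (x : X) (y : ℕ → X), Tendsto y atTop (𝓝 x) →
      F₀ x ≤ liminf (fun n => F n (y n)) atTop) ∧
  (∀ x : X, ∃ y : ℕ → X, Tendsto y atTop (𝓝 x) ∧
      limsup (fun n => F n (y n)) atTop ≤ F₀ x)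

/-- The double-well potential `G(u) = (1 - u²)² / 4`. -/
noncomputable def G (s : ℝ) : ℝ := (1 - s ^ 2) ^ 2 / 4

/-- The constant `c₀ = ∫_{-1}^{1} √(2 G(s)) ds`. -/
noncomputable def c₀ : ℝ := ∫ s in (-1 : ℝ)..1, Real.sqrt (2 * G s)

variable {d : ℕ}

/-- The locally integrable vector field `g` is a weak gradient of the locally integrable
function `u` on the open set `U`. -/
def HasWeakGradient (U : Set (EuclideanSpace ℝ (Fin d))) (u : EuclideanSpace ℝ (Fin d) → ℝ)
    (g : EuclideanSpace ℝ (Fin d) → EuclideanSpace ℝ (Fin d)) : Prop :=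
  LocallyIntegrableOn u U ∧ LocallyIntegrableOn g U ∧
    ∀ η : EuclideanSpace ℝ (Fin d) → ℝ, ContDiff ℝ ∞ η → HasCompactSupport η → tsupport η ⊆ U →
      ∀ i : Fin d,
        ∫ x in U, u x * fderiv ℝ η x (EuclideanSpace.single i 1) = -∫ x in U, g x i * η x

open Classical in
/-- The weak gradient of `u` on the open set `U` (unique up to a null set); zero if there
is none. -/
noncomputable def weakGradient (U : Set (EuclideanSpace ℝ (Fin d)))
    (u : EuclideanSpace ℝ (Fin d) → ℝ) : EuclideanSpace ℝ (Fin d) → EuclideanSpace ℝ (Fin d) :=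
  if h : ∃ g, HasWeakGradient U u g then h.choose else 0

/-- The Sobolev space `H¹(U)`, for `U` open. -/
def MemH1 (U : Set (EuclideanSpace ℝ (Fin d))) (u : EuclideanSpace ℝ (Fin d) → ℝ) : Prop :=
  MemLp u 2 (volume.restrict U) ∧
    ∃ g, HasWeakGradient U u g ∧ MemLp g 2 (volume.restrict U)

/-- The cube `[-φL/2, φL/2]^d`. -/
def cube (d : ℕ) (φ L : ℝ) : Set (EuclideanSpace ℝ (Fin d)) :=
  {x | ∀ i, x i ∈ Icc (-(φ * L / 2)) (φ * L / 2)}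

/-- The functions with finite rescaled energy: `H¹ ∩ L⁴` on the cube, equal to `-1` outside the
cube, with mean `-1 + φ` on the cube. -/
def Admissible (φ L : ℝ) (u : EuclideanSpace ℝ (Fin d) → ℝ) : Prop :=
  MemH1 (interior (cube d φ L)) u ∧ MemLp u 4 (volume.restrict (cube d φ L)) ∧
    (∀ᵐ x ∂(volume.restrict (cube d φ L)ᶜ), u x = -1) ∧
    ⨍ x in cube d φ L, u x = -1 + φ

open Classical in
/-- The rescaled energy gap to the uniform state. -/
noncomputable def energyGap (φ L : ℝ) (u : EuclideanSpace ℝ (Fin d) → ℝ) : EReal :=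
  if Admissible φ L u then
    ((∫ x in cube d φ L, (φ / 2 * ‖weakGradient (interior (cube d φ L)) u x‖ ^ 2
        + 1 / φ * (G (u x) - G (-1 + φ))) : ℝ) : EReal)
  else ⊤

/-- The divergence of a vector field. -/
noncomputable def divergence (T : EuclideanSpace ℝ (Fin d) → EuclideanSpace ℝ (Fin d))
    (x : EuclideanSpace ℝ (Fin d)) : ℝ :=
  ∑ i, fderiv ℝ T x (EuclideanSpace.single i 1) i

/-- The (De Giorgi) perimeter in `ℝ^d` of a measurable set `C`: the supremum of `∫_C div T` over
compactly supported `C¹` vector fields `T` with `|T| ≤ 1`. -/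
noncomputable def perimeter (C : Set (EuclideanSpace ℝ (Fin d))) : ℝ≥0∞ :=
  ⨆ (T : EuclideanSpace ℝ (Fin d) → EuclideanSpace ℝ (Fin d)) (_ : ContDiff ℝ 1 T)
    (_ : HasCompactSupport T) (_ : ∀ x, ‖T x‖ ≤ 1), ENNReal.ofReal (∫ x in C, divergence T x)

open Classical in
/-- The limit functional, on functions `u` with `u + 1 ∈ L^p`, `p < ∞`. For such `u` with
`u = ±1` almost everywhere, the set `{u = 1}` has finite volume. -/
noncomputable def limitEnergy (ξ : ℝ) (u : EuclideanSpace ℝ (Fin d) → ℝ) : EReal :=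
  if (∀ᵐ x, u x = 1 ∨ u x = -1) ∧ perimeter {x | u x = 1} < ⊤ then
    ((c₀ * (perimeter {x | u x = 1}).toReal - 4 * volume.real {x | u x = 1}
        + 4 * (ξ ^ (d + 1))⁻¹ * volume.real {x | u x = 1} ^ 2 : ℝ) : EReal)
  else ⊤

end CahnHilliard

/-!
With `a = φ (φ L) ^ d`, which tends to `ξ ^ (d + 1)`, the mass constraint says that the excess
`v = u + 1` has integral `a` over the cube `Ω`, and `(1 / φ) ∫ G(-1 + φ) = a (1 - φ / 2) ^ 2`. In
the limit the excess splits into a droplet of height `2` on `C`, of mass `2 |C|`, and a background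
of height `O(φ)` spread over `Ω`, of mass `a - 2 |C|`. Since `G(-1 + s) = s ^ 2 (1 - s / 2) ^ 2`,
the background costs `(a - 2 |C|) ^ 2 / a`, which minus `a` is `-4 |C| + 4 |C| ^ 2 / a`. The
boundary of the droplet costs `c₀ Per(C)`.

*Lower bound.* The potential splits pointwise into a part away from the well `-1`, which dominates
`wellWeight δ (u) ^ 2 / 2`, and a part near it, which dominates `(1 - δ / 4) ^ 2` times the square
of the small values of `v`. The former, with the gradient term, bounds `∫ Φ(u) div T` for a
primitive `Φ` of `wellWeight δ` and every admissible field `T`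
(`HasWeakGradient.integral_comp_mul_divergence_le`). This is proved for mollifications of `u`,
where the kernel average of Young's inequality makes a chain rule in Sobolev spaces unnecessary.
The latter is bounded below by Cauchy–Schwarz and the mass constraint
(`energyGap_lower_bound`); the mass of the large values of `v` converges to `2 |C|`
(`tendsto_integral_largePart`). Passing to the limit first in `n`, then in `δ`, and then taking the
supremum over `T` gives the liminf inequality, the lower semicontinuity of the perimeter included.

*Recovery.* No smooth approximation of `C` by sets, hence no coarea formula, Sard theorem or
signed distance is needed. A set of finite perimeter is approximated by a smooth function `F` with
`∫ |∇F| ≤ Per(C) + ε` (`exists_smooth_approx`). For a level `t ∈ [0, 1]` the field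
`γ ((F - t) / (φ m))`, with `γ` an almost optimal profile and `m` a regularisation of `|∇F|`, is a
phase field for `{F > t}`. At a fixed point its energy density, integrated over `t`, is by the
substitution `s = (F - t) / (φ m)` at most `m` times the one-dimensional energy of `γ`, up to
`O(φ)`; so the energies have average over `t` close to `c₀ ∫ |∇F|`, and the `L¹`-distances to `C`
have small average. Some level is good for both (`exists_level`, `exists_phaseField`). Adding a
constant `θ = O(φ)` on the cube restores the mass; as `G'` vanishes at the wells, this costs the
background energy and a small multiple of the energy of the layer (`energyGap_trial_le`). The
`L^p`-norm of the constant tends to zero because `p > 1`.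
-/

namespace CahnHilliard

open scoped Convolution InnerProductSpace

variable {d : ℕ}

local notation "𝔼" => EuclideanSpace ℝ (Fin d)

/-! ### Divergence and integration by parts -/

lemma fderiv_coord {T : 𝔼 → 𝔼} {x : 𝔼} (hT : DifferentiableAt ℝ T x) (v : 𝔼) (i : Fin d) :
    fderiv ℝ (fun y => T y i) x v = fderiv ℝ T x v i := by
  have h := ((EuclideanSpace.proj i : 𝔼 →L[ℝ] ℝ).hasFDerivAt.comp x
    hT.hasFDerivAt).fderiv
  have h' : (fun y => T y i) = (EuclideanSpace.proj i : 𝔼 →L[ℝ] ℝ) ∘ T := by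
    ext y; simp
  rw [h', h]; simp

lemma contDiff_coord {T : 𝔼 → 𝔼} {n : WithTop ℕ∞} (hT : ContDiff ℝ n T) (i : Fin d) :
    ContDiff ℝ n (fun y => T y i) :=
  contDiff_euclidean.1 hT i

lemma hasCompactSupport_coord {T : 𝔼 → 𝔼} (hT : HasCompactSupport T) (i : Fin d) :
    HasCompactSupport (fun y => T y i) := by
  refine hT.comp_left (g := fun z : 𝔼 => z i) rfl

lemma sum_coord_eq_self (v : 𝔼) : ∑ i, v i • EuclideanSpace.single i (1 : ℝ) = v := by
  have := (EuclideanSpace.basisFun (Fin d) ℝ).sum_repr v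
  simpa using this

lemma clm_eq_sum_coord (A : 𝔼 →L[ℝ] ℝ) (v : 𝔼) :
    A v = ∑ i, A (EuclideanSpace.single i 1) * v i := by
  conv_lhs => rw [← sum_coord_eq_self v]
  simp [mul_comm]

lemma continuous_divergence {T : 𝔼 → 𝔼} (hT : ContDiff ℝ 1 T) : Continuous (divergence T) := by
  unfold divergence
  refine continuous_finsetSum _ fun i _ => ?_
  have h := (hT.continuous_fderiv one_ne_zero).clm_apply
    (continuous_const (y := EuclideanSpace.single i (1 : ℝ)))
  exact (EuclideanSpace.proj i : 𝔼 →L[ℝ] ℝ).continuous.comp h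

lemma hasCompactSupport_divergence {T : 𝔼 → 𝔼} (hT : HasCompactSupport T) :
    HasCompactSupport (divergence T) := by
  refine (hT.fderiv ℝ).comp_left
    (g := fun A : 𝔼 →L[ℝ] 𝔼 => ∑ i, A (EuclideanSpace.single i 1) i) ?_
  simp

lemma integrable_divergence {T : 𝔼 → 𝔼} (hT : ContDiff ℝ 1 T) (hT' : HasCompactSupport T) :
    Integrable (divergence T) :=
  (continuous_divergence hT).integrable_of_hasCompactSupport (hasCompactSupport_divergence hT')

/-- The divergence theorem `∫ f div T = -∫ ⟨∇f, T⟩` for a compactly supported field `T`. -/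
lemma integral_mul_divergence {f : 𝔼 → ℝ} {T : 𝔼 → 𝔼} (hf : ContDiff ℝ 1 f)
    (hT : ContDiff ℝ 1 T) (hT' : HasCompactSupport T) :
    ∫ x, f x * divergence T x = -∫ x, fderiv ℝ f x (T x) := by
  have hdf := hf.continuous_fderiv one_ne_zero
  have i1 : ∀ i : Fin d, Integrable fun x =>
      fderiv ℝ f x (EuclideanSpace.single i 1) * T x i := fun i =>
    ((hdf.clm_apply continuous_const).mul
      (contDiff_coord hT i).continuous).integrable_of_hasCompactSupport
      (hasCompactSupport_coord hT' i).mul_left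
  have i2 : ∀ i : Fin d, Integrable fun x =>
      f x * fderiv ℝ (fun y => T y i) x (EuclideanSpace.single i 1) := fun i =>
    (hf.continuous.mul (((contDiff_coord hT i).continuous_fderiv one_ne_zero).clm_apply
      continuous_const)).integrable_of_hasCompactSupport
      (HasCompactSupport.mul_left
        ((hasCompactSupport_coord hT' i).fderiv_apply ℝ _))
  have h1 : ∀ x, f x * divergence T x =
      ∑ i, f x * fderiv ℝ (fun y => T y i) x (EuclideanSpace.single i 1) := by
    intro x
    rw [divergence, Finset.mul_sum]
    refine Finset.sum_congr rfl fun i _ => ?_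
    rw [fderiv_coord (hT.differentiable one_ne_zero x)]
  have h2 : ∀ x, fderiv ℝ f x (T x) =
      ∑ i, fderiv ℝ f x (EuclideanSpace.single i 1) * T x i := fun x => clm_eq_sum_coord _ _
  simp_rw [h1, h2]
  rw [integral_finsetSum _ fun i _ => i2 i, integral_finsetSum _ fun i _ => i1 i,
    ← Finset.sum_neg_distrib]
  refine Finset.sum_congr rfl fun i _ => ?_
  refine integral_mul_fderiv_eq_neg_fderiv_mul_of_integrable (i1 i) (i2 i) ?_
    (fun x _ => hf.differentiable one_ne_zero x)
    (fun x _ => (contDiff_coord hT i).differentiable one_ne_zero x)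
  exact (hf.continuous.mul (contDiff_coord hT i).continuous).integrable_of_hasCompactSupport
      (hasCompactSupport_coord hT' i).mul_left

/-! ### Weak gradients -/

lemma integrableOn_coord_mul {U : Set 𝔼} {g : 𝔼 → 𝔼}
    (hg : LocallyIntegrableOn g U) {η : 𝔼 → ℝ} (hη : Continuous η) (hη' : HasCompactSupport η)
    (hηU : tsupport η ⊆ U) (i : Fin d) : IntegrableOn (fun x => g x i * η x) U := by
  have h1 : IntegrableOn g (tsupport η) := hg.integrableOn_compact_subset hηU hη'
  have h2 : IntegrableOn (fun x => g x i) (tsupport η) :=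
    (EuclideanSpace.proj i : 𝔼 →L[ℝ] ℝ).integrable_comp h1
  have h3 : IntegrableOn (fun x => g x i * η x) (tsupport η) :=
    h2.mul_continuousOn hη.continuousOn hη'
  have h4 : Integrable (fun x => g x i * η x) := by
    rw [← integrableOn_iff_integrable_of_support_subset (s := tsupport η)]
    · exact h3
    · intro x hx
      exact subset_tsupport _ (right_ne_zero_of_mul hx)
  exact h4.integrableOn

lemma HasWeakGradient.ae_eq {U : Set 𝔼} (hU : IsOpen U) {u : 𝔼 → ℝ} {g g' : 𝔼 → 𝔼}
    (h : HasWeakGradient U u g) (h' : HasWeakGradient U u g') :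
    g =ᵐ[volume.restrict U] g' := by
  have key : ∀ i : Fin d, ∀ᵐ x, x ∈ U → g x i - g' x i = 0 := by
    intro i
    refine hU.ae_eq_zero_of_integral_contDiff_smul_eq_zero ?_ ?_
    · have h1 : LocallyIntegrableOn (fun x => g x - g' x) U := h.2.1.sub h'.2.1
      intro x hx
      obtain ⟨t, ht, ht'⟩ := h1 x hx
      exact ⟨t, ht, (EuclideanSpace.proj i : 𝔼 →L[ℝ] ℝ).integrable_comp ht'⟩
    · intro η hη hη' hηU
      have e1 := h.2.2 η hη hη' hηU i
      have e2 := h'.2.2 η hη hη' hηU i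
      have e3 : ∫ x in U, g x i * η x = ∫ x in U, g' x i * η x := by linarith
      have i1 := integrableOn_coord_mul h.2.1 hη.continuous hη' hηU i
      have i2 := integrableOn_coord_mul h'.2.1 hη.continuous hη' hηU i
      rw [← setIntegral_eq_integral_of_forall_compl_eq_zero (s := U)]
      · calc ∫ x in U, η x • (g x i - g' x i)
            = ∫ x in U, (g x i * η x - g' x i * η x) := by
              congr 1; ext x; simp only [smul_eq_mul]; ring
          _ = 0 := by rw [integral_sub i1 i2, e3, sub_self]
      · intro x hx
        have : η x = 0 := image_eq_zero_of_notMem_tsupport fun hx' => hx (hηU hx')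
        simp [this]
  have hall : ∀ᵐ x, ∀ i : Fin d, x ∈ U → g x i - g' x i = 0 := ae_all_iff.2 key
  refine (ae_restrict_iff' hU.measurableSet).2 ?_
  filter_upwards [hall] with x hx hxU
  ext i
  exact sub_eq_zero.1 (hx i hxU)

lemma weakGradient_ae_eq {U : Set 𝔼} (hU : IsOpen U) {u : 𝔼 → ℝ} {g : 𝔼 → 𝔼}
    (h : HasWeakGradient U u g) : weakGradient U u =ᵐ[volume.restrict U] g := by
  have hex : ∃ g, HasWeakGradient U u g := ⟨g, h⟩
  rw [weakGradient, dif_pos hex]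
  exact hex.choose_spec.ae_eq hU h

/-- The weak-gradient identity tested against vector-valued directions. -/
lemma HasWeakGradient.integral_mul_fderiv {U : Set 𝔼} {u : 𝔼 → ℝ} {g : 𝔼 → 𝔼}
    (h : HasWeakGradient U u g) {η : 𝔼 → ℝ} (hη : ContDiff ℝ ∞ η) (hη' : HasCompactSupport η)
    (hηU : tsupport η ⊆ U) (v : 𝔼) :
    ∫ x in U, u x * fderiv ℝ η x v = -∫ x in U, η x * ⟪g x, v⟫_ℝ := by
  have i1 : ∀ i : Fin d, IntegrableOn
      (fun x => u x * fderiv ℝ η x (EuclideanSpace.single i 1)) U := by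
    intro i
    have hc : Continuous fun x => fderiv ℝ η x (EuclideanSpace.single i (1 : ℝ)) :=
      (hη.continuous_fderiv (by simp)).clm_apply continuous_const
    have h1 : IntegrableOn u (tsupport η) := h.1.integrableOn_compact_subset hηU hη'
    have h3 := h1.mul_continuousOn hc.continuousOn hη'
    have h4 : Integrable (fun x => u x * fderiv ℝ η x (EuclideanSpace.single i (1 : ℝ))) := by
      rw [← integrableOn_iff_integrable_of_support_subset (s := tsupport η)]
      · exact h3
      · intro x hx
        have h5 : fderiv ℝ η x ≠ 0 := by
          intro h0
          apply hx
          simp [h0]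
        exact support_fderiv_subset ℝ h5
    exact h4.integrableOn
  have i2 : ∀ i : Fin d, IntegrableOn (fun x => g x i * η x) U := fun i =>
    integrableOn_coord_mul h.2.1 hη.continuous hη' hηU i
  have e1 : ∀ x, u x * fderiv ℝ η x v =
      ∑ i, v i * (u x * fderiv ℝ η x (EuclideanSpace.single i 1)) := by
    intro x
    rw [clm_eq_sum_coord, Finset.mul_sum]
    exact Finset.sum_congr rfl fun i _ => by ring
  have e2 : ∀ x, η x * ⟪g x, v⟫_ℝ = ∑ i, v i * (g x i * η x) := by
    intro x
    rw [PiLp.inner_apply, Finset.mul_sum]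
    exact Finset.sum_congr rfl fun i _ => by simp; ring
  simp_rw [e1, e2]
  rw [integral_finsetSum _ fun i _ => (i1 i).const_mul _,
    integral_finsetSum _ fun i _ => (i2 i).const_mul _, ← Finset.sum_neg_distrib]
  refine Finset.sum_congr rfl fun i _ => ?_
  rw [integral_const_mul, integral_const_mul, h.2.2 η hη hη' hηU i]
  ring

/-- Mollification commutes with weak differentiation where the kernel stays inside `U`. -/
lemma HasWeakGradient.fderiv_convolution {U : Set 𝔼} (hU : IsOpen U) {u : 𝔼 → ℝ} {g : 𝔼 → 𝔼}
    (h : HasWeakGradient U u g) (hu : LocallyIntegrable (U.indicator u))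
    {η : 𝔼 → ℝ} (hη : ContDiff ℝ ∞ η) (hη' : HasCompactSupport η) {x : 𝔼}
    (hx : tsupport (fun y => η (x - y)) ⊆ U) (v : 𝔼) :
    fderiv ℝ (η ⋆[ContinuousLinearMap.lsmul ℝ ℝ, volume] (U.indicator u)) x v =
      ∫ y in U, η (x - y) * ⟪g y, v⟫_ℝ := by
  have hη1 : ContDiff ℝ 1 η := hη.of_le (by exact_mod_cast le_top)
  have h1 := (hη'.hasFDerivAt_convolution_left (ContinuousLinearMap.lsmul ℝ ℝ) hη1 hu x).fderiv
  have hψ : ContDiff ℝ ∞ (fun y => η (x - y)) := hη.comp (contDiff_const.sub contDiff_id)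
  have hψ' : HasCompactSupport (fun y => η (x - y)) := by
    have := hη'.comp_homeomorph (Homeomorph.subLeft x)
    exact this
  have hfd : ∀ y, fderiv ℝ (fun y => η (x - y)) y v = -fderiv ℝ η (x - y) v := by
    intro y
    have := ((hη1.differentiable one_ne_zero (x - y)).hasFDerivAt.comp y
      ((hasFDerivAt_const x y).sub (hasFDerivAt_id y))).fderiv
    have h2 : (fun y => η (x - y)) = η ∘ fun y => x - y := rfl
    rw [h2]
    erw [this]
    simp
  have hce : ConvolutionExistsAt (fderiv ℝ η) (U.indicator u) x
      (ContinuousLinearMap.precompL 𝔼 (ContinuousLinearMap.lsmul ℝ ℝ)) volume :=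
    (hη'.fderiv ℝ).convolutionExists_left _ (hη1.continuous_fderiv one_ne_zero) hu x
  rw [h1, convolution_def]
  erw [ContinuousLinearMap.integral_apply hce]
  have e1 : ∀ t, (ContinuousLinearMap.precompL 𝔼 (ContinuousLinearMap.lsmul ℝ ℝ)
      (fderiv ℝ η t) (U.indicator u (x - t))) v = fderiv ℝ η t v * U.indicator u (x - t) := by
    intro t; simp [ContinuousLinearMap.precompL_apply]
  simp_rw [e1]
  rw [← integral_sub_left_eq_self _ _ x]
  have e2 : ∀ y, fderiv ℝ η (x - y) v * U.indicator u (x - (x - y)) =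
      U.indicator (fun y => -(u y * fderiv ℝ (fun y => η (x - y)) y v)) y := by
    intro y
    rw [sub_sub_cancel]
    by_cases hy : y ∈ U <;> simp [hy, hfd, mul_comm]
  simp_rw [e2]
  rw [integral_indicator hU.measurableSet, integral_neg,
    h.integral_mul_fderiv hψ hψ' hx v, neg_neg]

/-! ### Mollification and the weak Modica–Mortola inequality -/

lemma integrableOn_mul_inner {U : Set 𝔼} {g : 𝔼 → 𝔼}
    (hg : LocallyIntegrableOn g U) {η : 𝔼 → ℝ} (hη : Continuous η) (hη' : HasCompactSupport η)
    (hηU : tsupport η ⊆ U) (v : 𝔼) : IntegrableOn (fun x => η x * ⟪g x, v⟫_ℝ) U := by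
  have e2 : ∀ x, η x * ⟪g x, v⟫_ℝ = ∑ i, v i * (g x i * η x) := by
    intro x
    rw [PiLp.inner_apply, Finset.mul_sum]
    exact Finset.sum_congr rfl fun i _ => by simp; ring
  simp_rw [e2]
  exact integrable_finsetSum _ fun i _ => (integrableOn_coord_mul hg hη hη' hηU i).const_mul _

variable (d) in
/-- A sequence of smooth bumps at the origin, of radii below `r` shrinking to zero. -/
noncomputable def bumpSeq (r : ℝ) (hr : 0 < r) (k : ℕ) : ContDiffBump (0 : 𝔼) where
  rIn := r / (k + 1) / 2
  rOut := r / (k + 1)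
  rIn_pos := by positivity
  rIn_lt_rOut := half_lt_self (by positivity)

lemma bumpSeq_rOut_le (r : ℝ) (hr : 0 < r) (k : ℕ) : (bumpSeq d r hr k).rOut ≤ r := by
  simp only [bumpSeq]
  exact div_le_self hr.le (by linarith [(Nat.cast_nonneg k : (0 : ℝ) ≤ k)])

lemma tendsto_bumpSeq_rOut (r : ℝ) (hr : 0 < r) :
    Tendsto (fun k => (bumpSeq d r hr k).rOut) atTop (𝓝 0) := by
  simp only [bumpSeq]
  exact tendsto_const_nhds.div_atTop
    (tendsto_atTop_add_const_right _ _ tendsto_natCast_atTop_atTop)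

lemma ae_tendsto_bumpSeq_convolution (r : ℝ) (hr : 0 < r) {f : 𝔼 → ℝ}
    (hf : LocallyIntegrable f) : ∀ᵐ x, Tendsto (fun k =>
      ((bumpSeq d r hr k).normed volume ⋆[ContinuousLinearMap.lsmul ℝ ℝ, volume] f) x) atTop
      (𝓝 (f x)) := by
  refine ContDiffBump.ae_convolution_tendsto_right_of_locallyIntegrable (K := 2)
    (tendsto_bumpSeq_rOut r hr) (Eventually.of_forall fun k => ?_) hf
  simp only [bumpSeq]
  linarith

/-- The mollified form of Young's inequality: testing the gradient of a mollification of `u`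
against a field `T` costs a kinetic term, averaged by the kernel, and a potential term. -/
lemma HasWeakGradient.mul_fderiv_convolution_le {U : Set 𝔼} (hU : IsOpen U) {u : 𝔼 → ℝ}
    {g : 𝔼 → 𝔼} (h : HasWeakGradient U u g) (hu : LocallyIntegrable (U.indicator u))
    (hg : IntegrableOn (fun x => ‖g x‖ ^ 2) U) (b : ContDiffBump (0 : 𝔼)) {x : 𝔼}
    (hx : Metric.closedBall x b.rOut ⊆ U) {v : 𝔼} (hv : ‖v‖ ≤ 1) (c : ℝ) {ε : ℝ} (hε : 0 < ε) :
    -(c * fderiv ℝ (b.normed volume ⋆[ContinuousLinearMap.lsmul ℝ ℝ, volume] (U.indicator u)) x v)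
      ≤ 1 / (2 * ε) * c ^ 2 + ε / 2 * (b.normed volume ⋆[ContinuousLinearMap.lsmul ℝ ℝ, volume]
        (U.indicator fun y => ‖g y‖ ^ 2)) x := by
  set η := b.normed (volume : Measure 𝔼) with hηdef
  have hη : ContDiff ℝ ∞ η := b.contDiff_normed
  have hη' : HasCompactSupport η := b.hasCompactSupport_normed
  have hψ : Continuous (fun y => η (x - y)) :=
    hη.continuous.comp (continuous_const.sub continuous_id)
  have hψ' : HasCompactSupport (fun y => η (x - y)) := hη'.comp_homeomorph (Homeomorph.subLeft x)
  have hψU : tsupport (fun y => η (x - y)) ⊆ U := by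
    refine (closure_minimal ?_ Metric.isClosed_closedBall).trans hx
    intro y hy
    have h1 : x - y ∈ Function.support η := hy
    rw [hηdef, b.support_normed_eq, mem_ball_zero_iff] at h1
    rw [Metric.mem_closedBall, dist_comm, dist_eq_norm]
    exact h1.le
  have hψ0 : ∀ y, 0 ≤ η (x - y) := fun y => b.nonneg_normed _
  rw [h.fderiv_convolution hU hu hη hη' hψU v, ← integral_const_mul, ← integral_neg]
  have hint1 : IntegrableOn (fun y => η (x - y) * ⟪g y, v⟫_ℝ) U :=
    integrableOn_mul_inner h.2.1 hψ hψ' hψU v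
  have hηi : Integrable (fun y => η (x - y)) := hψ.integrable_of_hasCompactSupport hψ'
  obtain ⟨M, hM⟩ := hψ'.exists_bound_of_continuous hψ
  have hint2 : IntegrableOn (fun y => η (x - y) * ‖g y‖ ^ 2) U :=
    hg.bdd_mul hψ.aestronglyMeasurable (Eventually.of_forall hM)
  have hconv : (η ⋆[ContinuousLinearMap.lsmul ℝ ℝ, volume] (U.indicator fun y => ‖g y‖ ^ 2)) x
      = ∫ y in U, η (x - y) * ‖g y‖ ^ 2 := by
    rw [convolution_def, ← integral_sub_left_eq_self _ _ x, ← integral_indicator hU.measurableSet]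
    congr 1
    ext y
    by_cases hy : y ∈ U <;> simp [hy]
  have hone : ∫ y in U, η (x - y) ≤ 1 := by
    calc ∫ y in U, η (x - y) ≤ ∫ y, η (x - y) :=
          setIntegral_le_integral hηi (Eventually.of_forall hψ0)
      _ = ∫ y, η y := integral_sub_left_eq_self _ _ x
      _ = 1 := b.integral_normed
  calc ∫ y in U, -(c * (η (x - y) * ⟪g y, v⟫_ℝ))
      ≤ ∫ y in U, (1 / (2 * ε) * c ^ 2 * η (x - y) + ε / 2 * (η (x - y) * ‖g y‖ ^ 2)) := by
        refine integral_mono (hint1.const_mul c).neg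
          ((hηi.integrableOn.const_mul _).add (hint2.const_mul _)) fun y => ?_
        have h1 : |⟪g y, v⟫_ℝ| ≤ ‖g y‖ := by
          refine (abs_real_inner_le_norm _ _).trans ?_
          exact mul_le_of_le_one_right (norm_nonneg _) hv
        have h2 : -(c * ⟪g y, v⟫_ℝ) ≤ 1 / (2 * ε) * c ^ 2 + ε / 2 * ‖g y‖ ^ 2 := by
          have h3 : -(c * ⟪g y, v⟫_ℝ) ≤ |c| * ‖g y‖ := by
            calc -(c * ⟪g y, v⟫_ℝ) ≤ |c * ⟪g y, v⟫_ℝ| := neg_le_abs _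
              _ = |c| * |⟪g y, v⟫_ℝ| := abs_mul _ _
              _ ≤ |c| * ‖g y‖ := by gcongr
          have h4 : 1 / (2 * ε) * c ^ 2 + ε / 2 * ‖g y‖ ^ 2 - |c| * ‖g y‖
              = (|c| - ε * ‖g y‖) ^ 2 / (2 * ε) := by
            rw [sub_sq, sq_abs]; field_simp; ring
          have h5 : 0 ≤ (|c| - ε * ‖g y‖) ^ 2 / (2 * ε) := by positivity
          linarith
        have := mul_le_mul_of_nonneg_left h2 (hψ0 y)
        simp only
        linarith
    _ = 1 / (2 * ε) * c ^ 2 * (∫ y in U, η (x - y)) +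
          ε / 2 * ∫ y in U, η (x - y) * ‖g y‖ ^ 2 := by
        rw [integral_add (hηi.integrableOn.const_mul _) (hint2.const_mul _), integral_const_mul,
          integral_const_mul]
    _ ≤ _ := by
        rw [hconv]
        exact add_le_add (mul_le_of_le_one_right (by positivity) hone) le_rfl

/-- The Modica–Mortola inequality in weak form. It replaces the chain rule
`∇(Φ ∘ u) = ρ(u) ∇u` for Sobolev functions followed by Young's inequality. -/
lemma HasWeakGradient.integral_comp_mul_divergence_le {U : Set 𝔼} (hU : IsOpen U) {u : 𝔼 → ℝ}
    {g : 𝔼 → 𝔼} (h : HasWeakGradient U u g) (hu : LocallyIntegrable (U.indicator u))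
    (hg : IntegrableOn (fun x => ‖g x‖ ^ 2) U) {Φ ρ : ℝ → ℝ} (hΦ : ∀ s, HasDerivAt Φ (ρ s) s)
    (hρ : Continuous ρ) {M : ℝ} (hΦM : ∀ s, |Φ s| ≤ M) (hρM : ∀ s, |ρ s| ≤ M)
    {T : 𝔼 → 𝔼} (hT : ContDiff ℝ 1 T) (hT' : HasCompactSupport T) (hTU : tsupport T ⊆ U)
    (hT1 : ∀ x, ‖T x‖ ≤ 1) {ε : ℝ} (hε : 0 < ε) :
    ∫ x, Φ (u x) * divergence T x ≤ ε / 2 * (∫ x in U, ‖g x‖ ^ 2)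
      + 1 / (2 * ε) * ∫ x in tsupport T, ρ (u x) ^ 2 := by
  obtain ⟨r, hr, hrU⟩ := hT'.isCompact.exists_cthickening_subset_open hU hTU
  set K := tsupport T with hK
  have hKm : MeasurableSet K := (isClosed_tsupport T).measurableSet
  have hΦd : ContDiff ℝ 1 Φ := by
    rw [contDiff_one_iff_deriv]
    refine ⟨fun s => (hΦ s).differentiableAt, ?_⟩
    have : deriv Φ = ρ := funext fun s => (hΦ s).deriv
    rwa [this]
  set w : ℕ → 𝔼 → ℝ := fun k =>
    ((bumpSeq d r hr k).normed volume ⋆[ContinuousLinearMap.lsmul ℝ ℝ, volume] (U.indicator u))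
    with hw
  set q : 𝔼 → ℝ := U.indicator fun y => ‖g y‖ ^ 2 with hq
  have hqi : Integrable q := (integrable_indicator_iff hU.measurableSet).2 hg
  have hwd : ∀ k, ContDiff ℝ 1 (w k) := fun k =>
    (bumpSeq d r hr k).hasCompactSupport_normed.contDiff_convolution_left _
      ((bumpSeq d r hr k).contDiff_normed (n := 1)) hu
  have hae := ae_tendsto_bumpSeq_convolution r hr hu
  have hMnn : 0 ≤ M := (abs_nonneg _).trans (hΦM 0)
  have hKfin : volume K < ⊤ := hT'.isCompact.measure_lt_top
  have hbρ : ∀ s, ρ s ^ 2 ≤ M ^ 2 := fun s => by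
    rw [← sq_abs]; exact pow_le_pow_left₀ (abs_nonneg _) (hρM s) 2
  -- the inequality for each mollification
  have hineq : ∀ k, ∫ x, Φ (w k x) * divergence T x ≤ ε / 2 * (∫ x in U, ‖g x‖ ^ 2)
      + 1 / (2 * ε) * ∫ x in K, ρ (w k x) ^ 2 := by
    intro k
    set b := bumpSeq d r hr k
    have hηi : Integrable (b.normed (volume : Measure 𝔼)) := b.integrable_normed
    have hci : Integrable (b.normed volume ⋆[ContinuousLinearMap.lsmul ℝ ℝ, volume] q) :=
      hηi.integrable_convolution _ hqi
    have hci2 : ∫ x, (b.normed volume ⋆[ContinuousLinearMap.lsmul ℝ ℝ, volume] q) x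
        = ∫ x in U, ‖g x‖ ^ 2 := by
      rw [integral_convolution _ hηi hqi, b.integral_normed, hq,
        integral_indicator hU.measurableSet]
      simp
    have hKi : Integrable (K.indicator fun x => ρ (w k x) ^ 2) := by
      rw [integrable_indicator_iff hKm]
      exact ((hρ.comp (hwd k).continuous).pow 2).continuousOn.integrableOn_compact hT'.isCompact
    have hfd : ∀ x, fderiv ℝ (fun x => Φ (w k x)) x = ρ (w k x) • fderiv ℝ (w k) x := by
      intro x
      have h1 := (hΦ (w k x)).comp_hasFDerivAt x
        ((hwd k).differentiable one_ne_zero x).hasFDerivAt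
      exact h1.fderiv
    have hLc : Continuous fun x => fderiv ℝ (fun x => Φ (w k x)) x (T x) :=
      ((hΦd.comp (hwd k)).continuous_fderiv one_ne_zero).clm_apply hT.continuous
    have hLi : Integrable fun x => fderiv ℝ (fun x => Φ (w k x)) x (T x) := by
      refine hLc.integrable_of_hasCompactSupport ?_
      refine hT'.mono ?_
      intro x hx hx0
      apply hx
      simp only [hx0, map_zero]
    calc ∫ x, Φ (w k x) * divergence T x
        = -∫ x, fderiv ℝ (fun x => Φ (w k x)) x (T x) :=
          integral_mul_divergence (hΦd.comp (hwd k)) hT hT'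
      _ = ∫ x, -fderiv ℝ (fun x => Φ (w k x)) x (T x) := (integral_neg _).symm
      _ ≤ ∫ x, (1 / (2 * ε) * K.indicator (fun x => ρ (w k x) ^ 2) x + ε / 2 *
            (b.normed volume ⋆[ContinuousLinearMap.lsmul ℝ ℝ, volume] q) x) := by
          refine integral_mono hLi.neg ((hKi.const_mul _).add (hci.const_mul _)) fun x => ?_
          simp only [hfd, smul_apply, smul_eq_mul]
          by_cases hx : x ∈ K
          · rw [indicator_of_mem hx]
            refine h.mul_fderiv_convolution_le hU hu hg b ?_ (hT1 x) _ hε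
            refine Subset.trans ?_ hrU
            refine (Metric.closedBall_subset_closedBall (bumpSeq_rOut_le r hr k)).trans ?_
            exact Metric.closedBall_subset_cthickening hx r
          · have hx0 : T x = 0 := image_eq_zero_of_notMem_tsupport hx
            rw [indicator_of_notMem hx, hx0, map_zero, mul_zero, mul_zero, neg_zero, zero_add]
            refine mul_nonneg (by positivity) ?_
            rw [convolution_def]
            refine integral_nonneg fun t => ?_
            have h1 : 0 ≤ q (x - t) := indicator_nonneg (fun y _ => by positivity) _
            simpa using mul_nonneg (b.nonneg_normed t) h1
      _ = _ := by
          rw [integral_add (hKi.const_mul _) (hci.const_mul _), integral_const_mul,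
            integral_const_mul, hci2, integral_indicator hKm, add_comm]
  have hind : ∀ x ∈ K, U.indicator u x = u x := fun x hx => indicator_of_mem (hTU hx) u
  have hdiv0 : ∀ x, x ∉ K → divergence T x = 0 := by
    intro x hx
    have : fderiv ℝ T x = 0 := by
      by_contra h0
      exact hx (support_fderiv_subset ℝ h0)
    simp [divergence, this]
  have hL : Tendsto (fun k => ∫ x, Φ (w k x) * divergence T x) atTop
      (𝓝 (∫ x, Φ (u x) * divergence T x)) := by
    refine tendsto_integral_of_dominated_convergence (fun x => M * |divergence T x|) ?_ ?_ ?_ ?_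
    · intro k
      exact ((hΦd.continuous.comp (hwd k).continuous).mul
        (continuous_divergence hT)).aestronglyMeasurable
    · exact (integrable_divergence hT hT').abs.const_mul M
    · intro k
      refine Eventually.of_forall fun x => ?_
      rw [Real.norm_eq_abs, abs_mul]
      gcongr
      exact hΦM _
    · filter_upwards [hae] with x hx
      by_cases hxK : x ∈ K
      · rw [hind x hxK] at hx
        exact ((hΦd.continuous.tendsto _).comp hx).mul_const _
      · simp [hdiv0 x hxK]
  have hR : Tendsto (fun k => ∫ x in K, ρ (w k x) ^ 2) atTop (𝓝 (∫ x in K, ρ (u x) ^ 2)) := by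
    refine tendsto_integral_of_dominated_convergence (fun _ => M ^ 2) ?_ ?_ ?_ ?_
    · intro k
      exact ((hρ.comp (hwd k).continuous).pow 2).aestronglyMeasurable
    · exact integrableOn_const hKfin.ne
    · intro k
      refine Eventually.of_forall fun x => ?_
      rw [Real.norm_eq_abs, abs_of_nonneg (sq_nonneg _)]
      exact hbρ _
    · refine (ae_restrict_iff' hKm).2 ?_
      filter_upwards [hae] with x hx hxK
      rw [hind x hxK] at hx
      exact (((hρ.tendsto _).comp hx)).pow 2
  exact le_of_tendsto_of_tendsto' hL ((hR.const_mul _).const_add _) hineq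

/-! ### The cube -/

lemma cube_eq_preimage (φ L : ℝ) : cube d φ L = (MeasurableEquiv.toLp 2 (Fin d → ℝ)).symm ⁻¹'
    (Icc (fun _ => -(φ * L / 2)) (fun _ => φ * L / 2)) := by
  ext x
  simp only [cube, mem_ofPred_eq, mem_preimage, mem_Icc, Pi.le_def]
  exact ⟨fun h => ⟨fun i => (h i).1, fun i => (h i).2⟩, fun h i => ⟨h.1 i, h.2 i⟩⟩

lemma isClosed_cube (φ L : ℝ) : IsClosed (cube d φ L) := by
  have : cube d φ L = ⋂ i, (fun x : 𝔼 => x i) ⁻¹' Icc (-(φ * L / 2)) (φ * L / 2) := by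
    ext x; simp [cube]
  rw [this]
  exact isClosed_iInter fun i => isClosed_Icc.preimage
    (EuclideanSpace.proj i : 𝔼 →L[ℝ] ℝ).continuous

lemma convex_cube (φ L : ℝ) : Convex ℝ (cube d φ L) := by
  have : cube d φ L = ⋂ i, (EuclideanSpace.proj i : 𝔼 →L[ℝ] ℝ) ⁻¹'
      Icc (-(φ * L / 2)) (φ * L / 2) := by
    ext x; simp [cube]
  rw [this]
  exact convex_iInter fun i => (convex_Icc _ _).linear_preimage
    (EuclideanSpace.proj i : 𝔼 →L[ℝ] ℝ).toLinearMap

lemma volume_cube {φ L : ℝ} (h : 0 ≤ φ * L) :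
    volume (cube d φ L) = ENNReal.ofReal ((φ * L) ^ d) := by
  rw [cube_eq_preimage, (EuclideanSpace.volume_preserving_symm_measurableEquiv_toLp
    (Fin d)).measure_preimage measurableSet_Icc.nullMeasurableSet, Real.volume_Icc_pi]
  simp only [sub_neg_eq_add, add_halves, Finset.prod_const, Finset.card_univ, Fintype.card_fin]
  rw [ENNReal.ofReal_pow h]

lemma volume_cube_lt_top {φ L : ℝ} (h : 0 ≤ φ * L) : volume (cube d φ L) < ⊤ := by
  rw [volume_cube h]; exact ENNReal.ofReal_lt_top

lemma volume_real_cube {φ L : ℝ} (h : 0 ≤ φ * L) :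
    volume.real (cube d φ L) = (φ * L) ^ d := by
  rw [measureReal_def, volume_cube h, ENNReal.toReal_ofReal (by positivity)]

lemma interior_cube_ae_eq (φ L : ℝ) :
    (interior (cube d φ L) : Set 𝔼) =ᵐ[volume] cube d φ L :=
  interior_ae_eq_of_null_frontier ((convex_cube φ L).addHaar_frontier volume)

lemma restrict_interior_cube (φ L : ℝ) :
    (volume.restrict (interior (cube d φ L)) : Measure 𝔼) = volume.restrict (cube d φ L) :=
  Measure.restrict_congr_set (interior_cube_ae_eq φ L)

lemma closedBall_subset_interior_cube {φ L R : ℝ} (h : R < φ * L / 2) :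
    Metric.closedBall (0 : 𝔼) R ⊆ interior (cube d φ L) := by
  refine (Metric.closedBall_subset_ball h).trans
    (interior_maximal ?_ Metric.isOpen_ball)
  intro x hx i
  rw [mem_ball_zero_iff] at hx
  have h1 : |x i| ≤ ‖x‖ := by simpa using PiLp.norm_apply_le x i
  have h2 := abs_lt.1 (h1.trans_lt hx)
  exact ⟨h2.1.le, h2.2.le⟩

/-! ### The double-well potential and the truncated profile function -/

lemma G_nonneg (s : ℝ) : 0 ≤ G s := by unfold G; positivity

lemma continuous_G : Continuous G := by unfold G; fun_prop

lemma G_neg_one_add (s : ℝ) : G (-1 + s) = s ^ 2 * (1 - s / 2) ^ 2 := by unfold G; ring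

lemma sqrt_two_mul_G {s : ℝ} (hs : s ∈ Icc (-1 : ℝ) 1) :
    Real.sqrt (2 * G s) = (1 - s ^ 2) / √2 := by
  have h : 0 ≤ 1 - s ^ 2 := by nlinarith [hs.1, hs.2]
  rw [Real.sqrt_eq_iff_mul_self_eq (by have := G_nonneg s; positivity) (by positivity)]
  unfold G
  rw [div_mul_div_comm, Real.mul_self_sqrt (by norm_num)]
  ring

lemma c₀_eq : c₀ = 4 / 3 / √2 := by
  have h : c₀ = ∫ s in (-1 : ℝ)..1, (1 - s ^ 2) / √2 := by
    unfold c₀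
    refine intervalIntegral.integral_congr fun s hs => ?_
    rw [uIcc_of_le (by norm_num)] at hs
    exact sqrt_two_mul_G hs
  rw [h, intervalIntegral.integral_div, intervalIntegral.integral_sub (by simp)
    ((continuous_pow 2).intervalIntegrable _ _)]
  simp only [intervalIntegral.integral_const, integral_pow, smul_eq_mul]
  norm_num

lemma c₀_pos : 0 < c₀ := by rw [c₀_eq]; positivity

/-- The weight `√(2G)` on `[-1, 1]`, lowered by `δ` and cut off at zero. It vanishes near the
wells and outside `[-1, 1]`. -/
noncomputable def wellWeight (δ s : ℝ) : ℝ := max ((1 - s ^ 2) / √2 - δ) 0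

/-- The primitive of `wellWeight δ` vanishing at the well `-1`. -/
noncomputable def wellPrimitive (δ s : ℝ) : ℝ := ∫ r in (-1 : ℝ)..s, wellWeight δ r

lemma continuous_wellWeight (δ : ℝ) : Continuous (wellWeight δ) := by
  unfold wellWeight; fun_prop

lemma wellWeight_nonneg (δ s : ℝ) : 0 ≤ wellWeight δ s := le_max_right _ _

lemma one_le_sqrt_two : (1 : ℝ) ≤ √2 := by
  rw [Real.one_le_sqrt]; norm_num

lemma wellWeight_le_one {δ : ℝ} (hδ : 0 ≤ δ) (s : ℝ) : wellWeight δ s ≤ 1 := by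
  refine max_le ?_ zero_le_one
  have h1 : (1 - s ^ 2) / √2 ≤ 1 := by
    rw [div_le_one (by positivity)]
    nlinarith [one_le_sqrt_two, sq_nonneg s]
  linarith

lemma wellWeight_eq_zero_of_sq {δ s : ℝ} (hδ : 0 ≤ δ) (hs : 1 ≤ s ^ 2) :
    wellWeight δ s = 0 := by
  refine max_eq_right ?_
  have h1 : (1 - s ^ 2) / √2 ≤ 0 := div_nonpos_of_nonpos_of_nonneg (by linarith) (by positivity)
  linarith

lemma wellWeight_eq_zero_of_near {δ r : ℝ} (hr : |r| ≤ δ / 2) : wellWeight δ (-1 + r) = 0 := by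
  refine max_eq_right ?_
  have hδ : 0 ≤ δ := by linarith [abs_nonneg r]
  have h1 : (1 - (-1 + r) ^ 2) / √2 ≤ δ := by
    rw [div_le_iff₀ (by positivity)]
    nlinarith [one_le_sqrt_two, (abs_le.1 hr).2, sq_nonneg r]
  linarith

lemma wellWeight_sq_le {δ : ℝ} (hδ : 0 ≤ δ) (s : ℝ) : wellWeight δ s ^ 2 ≤ 2 * G s := by
  rcases le_or_gt 1 (s ^ 2) with hs | hs
  · rw [wellWeight_eq_zero_of_sq hδ hs]
    have := G_nonneg s
    simp only [ne_eq, OfNat.ofNat_ne_zero, not_false_eq_true, zero_pow]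
    positivity
  · have h1 : wellWeight δ s ≤ (1 - s ^ 2) / √2 := by
      refine max_le (by linarith) (div_nonneg (by linarith) (by positivity))
    calc wellWeight δ s ^ 2 ≤ ((1 - s ^ 2) / √2) ^ 2 :=
          pow_le_pow_left₀ (wellWeight_nonneg _ _) h1 2
      _ = 2 * G s := by
          rw [div_pow, Real.sq_sqrt (by norm_num)]; unfold G; ring

lemma hasDerivAt_wellPrimitive (δ s : ℝ) :
    HasDerivAt (wellPrimitive δ) (wellWeight δ s) s :=
  intervalIntegral.integral_hasDerivAt_right ((continuous_wellWeight δ).intervalIntegrable _ _)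
    ((continuous_wellWeight δ).stronglyMeasurableAtFilter _ _)
    (continuous_wellWeight δ).continuousAt

lemma continuous_wellPrimitive (δ : ℝ) : Continuous (wellPrimitive δ) :=
  continuous_iff_continuousAt.2 fun s => (hasDerivAt_wellPrimitive δ s).continuousAt

lemma wellPrimitive_neg_one (δ : ℝ) : wellPrimitive δ (-1) = 0 := by simp [wellPrimitive]

lemma abs_wellPrimitive_le {δ : ℝ} (hδ : 0 ≤ δ) (s : ℝ) : |wellPrimitive δ s| ≤ 2 := by
  have hmono : Monotone (wellPrimitive δ) :=
    monotone_of_deriv_nonneg (fun s => (hasDerivAt_wellPrimitive δ s).differentiableAt)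
      fun s => by rw [(hasDerivAt_wellPrimitive δ s).deriv]; exact wellWeight_nonneg _ _
  have hle : ∀ a b : ℝ, a ≤ b →
      wellPrimitive δ b - wellPrimitive δ a = ∫ r in a..b, wellWeight δ r := by
    intro a b _
    exact intervalIntegral.integral_interval_sub_left
      ((continuous_wellWeight δ).intervalIntegrable _ _)
      ((continuous_wellWeight δ).intervalIntegrable _ _)
  have hzero : ∀ a b : ℝ, a ≤ b → (∀ r ∈ Icc a b, 1 ≤ r ^ 2) →
      wellPrimitive δ b = wellPrimitive δ a := by
    intro a b hab h
    rw [← sub_eq_zero, hle a b hab]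
    refine intervalIntegral.integral_zero_ae (Eventually.of_forall fun r hr => ?_)
    rw [uIoc_of_le hab] at hr
    exact wellWeight_eq_zero_of_sq hδ (h r ⟨hr.1.le, hr.2⟩)
  have h1 : wellPrimitive δ 1 ≤ 2 := by
    have h2 : wellPrimitive δ 1 ≤ ∫ r in (-1 : ℝ)..1, (1 : ℝ) := by
      refine intervalIntegral.integral_mono_on (by norm_num)
        ((continuous_wellWeight δ).intervalIntegrable _ _) (by simp)
        fun r _ => wellWeight_le_one hδ r
    simp at h2
    linarith
  have hlow : 0 ≤ wellPrimitive δ s := by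
    rcases le_total (-1) s with hs | hs
    · rw [← wellPrimitive_neg_one δ]; exact hmono hs
    · rw [← hzero s (-1) hs fun r hr => by nlinarith [hr.2], wellPrimitive_neg_one]
  have hup : wellPrimitive δ s ≤ 2 := by
    rcases le_total s 1 with hs | hs
    · exact (hmono hs).trans h1
    · rw [hzero 1 s hs fun r hr => by nlinarith [hr.1]]; exact h1
  rw [abs_of_nonneg hlow]; exact hup

/-- Truncating the weight loses at most `2 δ` of the surface tension. -/
lemma c₀_sub_le_wellPrimitive (δ : ℝ) : c₀ - 2 * δ ≤ wellPrimitive δ 1 := by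
  have h : ∫ s in (-1 : ℝ)..1, (Real.sqrt (2 * G s) - δ) ≤ wellPrimitive δ 1 := by
    refine intervalIntegral.integral_mono_on (by norm_num) ?_
      ((continuous_wellWeight δ).intervalIntegrable _ _) fun s hs => ?_
    · have : Continuous fun s => Real.sqrt (2 * G s) - δ := by
        have := continuous_G; fun_prop
      exact this.intervalIntegrable _ _
    · rw [sqrt_two_mul_G hs]
      exact le_max_left _ _
  rw [intervalIntegral.integral_sub] at h
  · simp only [intervalIntegral.integral_const, smul_eq_mul] at h
    unfold c₀
    linarith
  · have : Continuous fun s => Real.sqrt (2 * G s) := by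
      have := continuous_G; fun_prop
    exact this.intervalIntegrable _ _
  · simp

/-! ### The energy in terms of an arbitrary weak gradient -/

lemma integrable_G_of_memLp_four {μ : Measure 𝔼} [IsFiniteMeasure μ] {u : 𝔼 → ℝ}
    (h : MemLp u 4 μ) : Integrable (fun x => G (u x)) μ := by
  have h4 : Integrable (fun x => ‖u x‖ ^ 4) μ := by
    have := h.integrable_norm_pow (p := 4) (by norm_num)
    simpa using this
  have h2 : Integrable (fun x => ‖u x‖ ^ 2) μ := by
    have := (h.mono_exponent (p := 2) (by norm_num)).integrable_norm_pow (p := 2) (by norm_num)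
    simpa using this
  have e : (fun x => G (u x)) = fun x => 1 / 4 - 1 / 2 * ‖u x‖ ^ 2 + 1 / 4 * ‖u x‖ ^ 4 := by
    ext x
    rw [Real.norm_eq_abs, sq_abs, show |u x| ^ 4 = u x ^ 4 from by
      rw [show 4 = 2 * 2 by norm_num, pow_mul, pow_mul, sq_abs]]
    unfold G; ring
  rw [e]
  exact ((integrable_const _).sub (h2.const_mul _)).add (h4.const_mul _)

lemma integrable_norm_sq_of_memLp_two {μ : Measure 𝔼} {g : 𝔼 → 𝔼} (h : MemLp g 2 μ) :
    Integrable (fun x => ‖g x‖ ^ 2) μ := by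
  have := h.integrable_norm_pow (p := 2) (by norm_num)
  simpa using this

/-- The energy may be computed with any square-integrable weak gradient, by almost everywhere
uniqueness; the subtracted constant is the energy of the uniform state. -/
lemma energyGap_eq {φ L : ℝ} (hφ : 0 < φ) (hL : 0 < L) {u : 𝔼 → ℝ} (h : Admissible φ L u)
    {g : 𝔼 → 𝔼} (hg : HasWeakGradient (interior (cube d φ L)) u g)
    (hg2 : MemLp g 2 (volume.restrict (interior (cube d φ L)))) :
    energyGap φ L u = ((φ / 2 * (∫ x in interior (cube d φ L), ‖g x‖ ^ 2)
      + 1 / φ * (∫ x in cube d φ L, G (u x))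
      - φ * (φ * L) ^ d * (1 - φ / 2) ^ 2 : ℝ) : EReal) := by
  have hφL : 0 ≤ φ * L := by positivity
  have : IsFiniteMeasure (volume.restrict (cube d φ L)) :=
    ⟨by simpa using volume_cube_lt_top hφL⟩
  rw [energyGap, if_pos h]
  congr 1
  have hae : weakGradient (interior (cube d φ L)) u =ᵐ[volume.restrict (cube d φ L)] g := by
    rw [← restrict_interior_cube]; exact weakGradient_ae_eq isOpen_interior hg
  have hG := integrable_G_of_memLp_four h.2.1
  have hg2' : Integrable (fun x => ‖g x‖ ^ 2) (volume.restrict (cube d φ L)) := by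
    rw [← restrict_interior_cube]; exact integrable_norm_sq_of_memLp_two hg2
  have e1 : ∫ x in cube d φ L, (φ / 2 * ‖weakGradient (interior (cube d φ L)) u x‖ ^ 2
        + 1 / φ * (G (u x) - G (-1 + φ)))
      = ∫ x in cube d φ L, (φ / 2 * ‖g x‖ ^ 2 + 1 / φ * (G (u x) - G (-1 + φ))) := by
    refine integral_congr_ae ?_
    filter_upwards [hae] with x hx
    rw [hx]
  have hsub : Integrable (fun x => G (u x) - G (-1 + φ)) (volume.restrict (cube d φ L)) :=
    hG.sub (integrable_const _)
  rw [e1, integral_add (hg2'.const_mul _) (hsub.const_mul _),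
    integral_const_mul, integral_const_mul, integral_sub hG (integrable_const _),
    restrict_interior_cube, setIntegral_const, volume_real_cube hφL, G_neg_one_add]
  simp only [smul_eq_mul]
  field_simp
  ring

/-! ### The lower bound for a single function -/

/-- The part of the excess `s = u + 1` of size larger than `δ`, which carries the mass of the
droplet; the rest is the background. -/
noncomputable def largePart (δ s : ℝ) : ℝ := if |s| ≤ δ then 0 else s

lemma measurable_largePart (δ : ℝ) : Measurable (largePart δ) :=
  Measurable.ite (measurableSet_le measurable_norm measurable_const) measurable_const measurable_id

lemma abs_sub_largePart_le {δ : ℝ} (hδ : 0 ≤ δ) (s : ℝ) : |s - largePart δ s| ≤ δ := by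
  unfold largePart; split_ifs with h <;> simp [h, hδ]

lemma abs_largePart_le (δ s : ℝ) : |largePart δ s| ≤ |s| := by
  unfold largePart; split_ifs with h <;> simp

lemma largePart_zero (δ : ℝ) : largePart δ 0 = 0 := by
  simp [largePart]

/-- The pointwise splitting of the potential into layer and background: for each `s` one of the
two terms on the left vanishes. -/
lemma wellWeight_sq_add_le {δ : ℝ} (hδ : 0 ≤ δ) (hδ1 : δ ≤ 1) (s : ℝ) :
    wellWeight δ (-1 + s) ^ 2 / 2 + (1 - δ / 4) ^ 2 * (s - largePart (δ / 2) s) ^ 2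
      ≤ G (-1 + s) := by
  by_cases hs : |s| ≤ δ / 2
  · rw [wellWeight_eq_zero_of_near hs, G_neg_one_add, largePart, if_pos hs]
    have h2 := abs_le.1 hs
    have h1 : (1 - δ / 4) ^ 2 ≤ (1 - s / 2) ^ 2 :=
      pow_le_pow_left₀ (by linarith) (by linarith) 2
    nlinarith [mul_le_mul_of_nonneg_left h1 (sq_nonneg s)]
  · rw [largePart, if_neg hs]
    have := wellWeight_sq_le hδ (-1 + s)
    simp only [sub_self, ne_eq, OfNat.ofNat_ne_zero, not_false_eq_true, zero_pow, mul_zero]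
    linarith

/-- The mass constraint turns into a Cauchy–Schwarz bound for the background. -/
lemma sq_integral_div_le {Q : Set 𝔼} (hQ : volume Q < ⊤) (hQ0 : 0 < volume.real Q) {w : 𝔼 → ℝ}
    (hw : IntegrableOn w Q) (hw2 : IntegrableOn (fun x => w x ^ 2) Q) :
    (∫ x in Q, w x) ^ 2 / volume.real Q ≤ ∫ x in Q, w x ^ 2 := by
  set m := ∫ x in Q, w x
  set c := m / volume.real Q
  have : IsFiniteMeasure (volume.restrict Q) := ⟨by simpa using hQ⟩
  have h := integral_mono (μ := volume.restrict Q) (f := fun x => 2 * c * w x - c ^ 2)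
    ((hw.const_mul _).sub (integrable_const _)) hw2 fun x => by
      simp only
      nlinarith [sq_nonneg (w x - c)]
  rw [integral_sub (hw.const_mul _) (integrable_const _), integral_const_mul,
    setIntegral_const, smul_eq_mul] at h
  have e : 2 * c * m - volume.real Q * c ^ 2 = m ^ 2 / volume.real Q := by
    simp only [c]; field_simp; ring
  change 2 * c * m - volume.real Q * c ^ 2 ≤ _ at h
  linarith

lemma energyGap_ge_potential {φ L : ℝ} (hφ : 0 < φ) (hL : 0 < L) {u : 𝔼 → ℝ}
    (h : Admissible φ L u) :
    ((1 / φ * (∫ x in cube d φ L, G (u x)) - φ * (φ * L) ^ d * (1 - φ / 2) ^ 2 : ℝ) : EReal)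
      ≤ energyGap φ L u := by
  obtain ⟨g, hg, hg2⟩ := h.1.2
  rw [energyGap_eq hφ hL h hg hg2, EReal.coe_le_coe_iff]
  have : 0 ≤ φ / 2 * ∫ x in interior (cube d φ L), ‖g x‖ ^ 2 :=
    mul_nonneg (by positivity) (integral_nonneg fun x => by positivity)
  linarith

lemma integrable_of_memLp_cube {φ L : ℝ} (hφL : 0 ≤ φ * L) {u : 𝔼 → ℝ} {q : ℝ≥0∞} (hq : 1 ≤ q)
    (h : MemLp u q (volume.restrict (cube d φ L))) : IntegrableOn u (cube d φ L) := by
  have : IsFiniteMeasure (volume.restrict (cube d φ L)) :=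
    ⟨by simpa using volume_cube_lt_top hφL⟩
  exact h.integrable hq

/-- The Modica–Mortola bound for the layer and the mass bound for the background, combined. -/
lemma energyGap_lower_bound {φ L : ℝ} (hφ : 0 < φ) (hL : 0 < L) {v : 𝔼 → ℝ}
    (h : Admissible φ L (fun x => -1 + v x)) {T : 𝔼 → 𝔼} (hT : ContDiff ℝ 1 T)
    (hT' : HasCompactSupport T) (hT1 : ∀ x, ‖T x‖ ≤ 1)
    (hTU : tsupport T ⊆ interior (cube d φ L)) {δ : ℝ} (hδ : 0 < δ) (hδ1 : δ ≤ 1) :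
    (((∫ x, wellPrimitive δ (-1 + v x) * divergence T x)
      + (1 - δ / 4) ^ 2 * ((φ * (φ * L) ^ d - ∫ x, largePart (δ / 2) (v x)) ^ 2 /
        (φ * (φ * L) ^ d)) - φ * (φ * L) ^ d * (1 - φ / 2) ^ 2 : ℝ) : EReal)
      ≤ energyGap φ L (fun x => -1 + v x) := by
  obtain ⟨g, hg, hg2⟩ := h.1.2
  rw [energyGap_eq hφ hL h hg hg2, EReal.coe_le_coe_iff]
  have hφL : 0 ≤ φ * L := by positivity
  set Q := cube d φ L with hQdef
  set U := interior Q with hUdef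
  have hUo : IsOpen U := isOpen_interior
  have hQm : MeasurableSet Q := (isClosed_cube φ L).measurableSet
  have hQfin : volume Q < ⊤ := volume_cube_lt_top hφL
  have hQr : volume.real Q = (φ * L) ^ d := volume_real_cube hφL
  have : IsFiniteMeasure (volume.restrict Q) := ⟨by simpa using hQfin⟩
  have hui : IntegrableOn (fun x => -1 + v x) Q :=
    integrable_of_memLp_cube hφL (by norm_num) h.2.1
  have hvi : IntegrableOn v Q := by
    have := hui.add (integrable_const (1 : ℝ))
    refine this.congr (Eventually.of_forall fun x => ?_)
    simp
  have hG := integrable_G_of_memLp_four h.2.1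
  have hloc : LocallyIntegrable (U.indicator fun x => -1 + v x) := by
    refine Integrable.locallyIntegrable ?_
    rw [integrable_indicator_iff hUo.measurableSet]
    exact hui.mono_set interior_subset
  have hg2' : IntegrableOn (fun x => ‖g x‖ ^ 2) U := integrable_norm_sq_of_memLp_two hg2
  have hchain := hg.integral_comp_mul_divergence_le hUo hloc hg2' (hasDerivAt_wellPrimitive δ)
    (continuous_wellWeight δ) (abs_wellPrimitive_le hδ.le)
    (fun s => by
      rw [abs_of_nonneg (wellWeight_nonneg δ s)]
      linarith [wellWeight_le_one hδ.le s]) hT hT' hTU hT1 hφ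
  -- integrability of the two parts of the potential
  set w : 𝔼 → ℝ := fun x => v x - largePart (δ / 2) (v x) with hwdef
  have hwb : ∀ x, |w x| ≤ δ / 2 := fun x => abs_sub_largePart_le (by linarith) _
  have htr : IntegrableOn (fun x => largePart (δ / 2) (v x)) Q := by
    refine Integrable.mono hvi
      ((measurable_largePart _).comp_aemeasurable hvi.aemeasurable).aestronglyMeasurable ?_
    exact Eventually.of_forall fun x => abs_largePart_le _ _
  have hwi : IntegrableOn w Q := hvi.sub htr
  have hw2 : IntegrableOn (fun x => w x ^ 2) Q := by
    refine Integrable.of_bound (hwi.aestronglyMeasurable.pow 2) ((δ / 2) ^ 2)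
      (Eventually.of_forall fun x => ?_)
    rw [Real.norm_eq_abs, abs_pow]
    exact pow_le_pow_left₀ (abs_nonneg _) (hwb x) 2
  have hρ2 : IntegrableOn (fun x => wellWeight δ (-1 + v x) ^ 2) Q := by
    refine Integrable.of_bound ((((continuous_wellWeight δ).pow 2).measurable.comp_aemeasurable
      hui.aemeasurable).aestronglyMeasurable) 1 (Eventually.of_forall fun x => ?_)
    rw [Real.norm_eq_abs, abs_of_nonneg (sq_nonneg _)]
    exact pow_le_one₀ (wellWeight_nonneg _ _) (wellWeight_le_one hδ.le _)
  have hsplit : (∫ x in Q, wellWeight δ (-1 + v x) ^ 2) / 2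
      + (1 - δ / 4) ^ 2 * (∫ x in Q, w x ^ 2) ≤ ∫ x in Q, G (-1 + v x) := by
    rw [← integral_div, ← integral_const_mul, ← integral_add (hρ2.div_const 2) (hw2.const_mul _)]
    exact integral_mono ((hρ2.div_const 2).add (hw2.const_mul _)) hG
      fun x => wellWeight_sq_add_le hδ.le hδ1 (v x)
  have hKQ : ∫ x in tsupport T, wellWeight δ (-1 + v x) ^ 2
      ≤ ∫ x in Q, wellWeight δ (-1 + v x) ^ 2 :=
    setIntegral_mono_set hρ2 (Eventually.of_forall fun x => sq_nonneg _)
      (hTU.trans interior_subset).eventuallyLE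
  -- the mass of the background
  have hQpos : 0 < volume.real Q := by rw [hQr]; positivity
  have hmass : ∫ x in Q, v x = φ * (φ * L) ^ d := by
    have h1 := h.2.2.2
    rw [setAverage_eq, integral_add (integrable_const _) hvi, setIntegral_const,
      smul_eq_mul, smul_eq_mul] at h1
    rw [← hQr]
    change (volume.real Q)⁻¹ * _ = _ at h1
    have h2 : volume.real Q * (-1 + φ) = volume.real Q * -1 + ∫ x in Q, v x := by
      rw [← h1]; field_simp
    linarith
  have htrint : ∫ x in Q, largePart (δ / 2) (v x) = ∫ x, largePart (δ / 2) (v x) := by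
    refine setIntegral_eq_integral_of_ae_compl_eq_zero ?_
    have h1 := (ae_restrict_iff' hQm.compl).1 h.2.2.1
    filter_upwards [h1] with x hx hxQ
    have h2 : v x = 0 := by linarith [hx hxQ]
    rw [h2, largePart_zero]
  have hwint : ∫ x in Q, w x = φ * (φ * L) ^ d - ∫ x, largePart (δ / 2) (v x) := by
    rw [← htrint, ← hmass, ← integral_sub hvi htr]
  have hcs := sq_integral_div_le hQfin hQpos hwi hw2
  rw [hwint, hQr] at hcs
  set m := φ * (φ * L) ^ d - ∫ x, largePart (δ / 2) (v x)
  have hcs' : m ^ 2 / (φ * (φ * L) ^ d) ≤ 1 / φ * ∫ x in Q, w x ^ 2 := by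
    calc m ^ 2 / (φ * (φ * L) ^ d) = 1 / φ * (m ^ 2 / (φ * L) ^ d) := by
          field_simp
      _ ≤ _ := by gcongr
  have h3 : 1 / (2 * φ) * (∫ x in tsupport T, wellWeight δ (-1 + v x) ^ 2)
      + (1 - δ / 4) ^ 2 * (m ^ 2 / (φ * (φ * L) ^ d)) ≤ 1 / φ * ∫ x in Q, G (-1 + v x) := by
    calc _ ≤ 1 / (2 * φ) * (∫ x in Q, wellWeight δ (-1 + v x) ^ 2)
          + (1 - δ / 4) ^ 2 * (1 / φ * ∫ x in Q, w x ^ 2) := by gcongr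
      _ = 1 / φ * ((∫ x in Q, wellWeight δ (-1 + v x) ^ 2) / 2
          + (1 - δ / 4) ^ 2 * (∫ x in Q, w x ^ 2)) := by
          field_simp
      _ ≤ _ := by gcongr
  linarith

/-! ### Convergence of the droplet mass -/

lemma le_rpow_of_lt {q : ℝ} (hq : 1 ≤ q) {η t : ℝ} (hη : 0 < η) (ht : η ≤ t) :
    t ≤ η ^ (1 - q) * t ^ q := by
  have ht0 : 0 < t := hη.trans_le ht
  have h1 : t ^ (1 - q) ≤ η ^ (1 - q) :=
    Real.rpow_le_rpow_of_nonpos hη ht (by linarith)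
  calc t = t ^ (1 - q) * t ^ q := by
        rw [← Real.rpow_add ht0]; simp
    _ ≤ _ := by gcongr

lemma le_add_rpow {q : ℝ} (hq : 1 ≤ q) {η t : ℝ} (hη : 0 < η) (ht : 0 ≤ t) :
    t ≤ η + η ^ (1 - q) * t ^ q := by
  rcases le_or_gt η t with h | h
  · linarith [le_rpow_of_lt hq hη h]
  · have : 0 ≤ η ^ (1 - q) * t ^ q := by positivity
    linarith

lemma abs_largePart_sub_le {q : ℝ} (hq : 1 ≤ q) {δ η : ℝ} (hδ : 0 < δ) (hδ1 : δ ≤ 1) (hη : 0 < η)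
    {s t : ℝ} (ht : t = 0 ∨ t = 2) :
    |largePart δ s - t| ≤ η * t + (2 + δ ^ (1 - q) + η ^ (1 - q)) * |s - t| ^ q := by
  have hd0 : 0 < δ ^ (1 - q) := by positivity
  have he0 : 0 < η ^ (1 - q) := by positivity
  have hp0 : 0 ≤ |s - t| ^ q := by positivity
  rcases ht with rfl | rfl
  · unfold largePart
    split_ifs with h
    · simp only [sub_self, abs_zero, mul_zero, zero_add]
      positivity
    · have := le_rpow_of_lt hq hδ (not_le.1 h).le
      simp only [sub_zero, mul_zero, zero_add] at hp0 ⊢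
      nlinarith
  · unfold largePart
    split_ifs with h
    · have h1 : 1 ≤ |s - 2| := by
        rw [abs_sub_comm, le_abs]; left; linarith [(abs_le.1 h).2]
      have h2 : 1 ≤ |s - 2| ^ q := Real.one_le_rpow h1 (by linarith)
      rw [zero_sub, abs_neg, abs_two]
      nlinarith
    · have := le_add_rpow hq hη (abs_nonneg (s - 2))
      nlinarith

/-- Under `L^q`-convergence to a two-valued function, the mass of the large part converges, on
a space of infinite measure and without any uniform integrability hypothesis. -/
lemma tendsto_integral_largePart {q : ℝ} (hq : 1 ≤ q) {δ : ℝ} (hδ : 0 < δ) (hδ1 : δ ≤ 1)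
    {v : 𝔼 → ℝ} {y : ℕ → 𝔼 → ℝ} (hv : ∀ᵐ x, v x = 0 ∨ v x = 2)
    (hvi : Integrable v) (hym : ∀ n, AEStronglyMeasurable (y n))
    (hyi : ∀ n, Integrable fun x => |y n x - v x| ^ q)
    (hlim : Tendsto (fun n => ∫ x, |y n x - v x| ^ q) atTop (𝓝 0)) :
    Tendsto (fun n => ∫ x, largePart δ (y n x)) atTop (𝓝 (∫ x, v x)) := by
  have hbound : ∀ η : ℝ, 0 < η → ∀ n, ∀ᵐ x, |largePart δ (y n x) - v x| ≤
      η * v x + (2 + δ ^ (1 - q) + η ^ (1 - q)) * |y n x - v x| ^ q := by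
    intro η hη n
    filter_upwards [hv] with x hx
    exact abs_largePart_sub_le hq hδ hδ1 hη hx
  have hdi : ∀ n, Integrable fun x => largePart δ (y n x) - v x := by
    intro n
    refine Integrable.mono' ((hvi.const_mul 1).add ((hyi n).const_mul _)) ?_ (hbound 1 one_pos n)
    exact (((measurable_largePart δ).comp_aemeasurable (hym n).aemeasurable).sub
      hvi.aemeasurable).aestronglyMeasurable
  have hli : ∀ n, Integrable fun x => largePart δ (y n x) := by
    intro n
    refine ((hdi n).add hvi).congr (Eventually.of_forall fun x => ?_)
    simp
  rw [Metric.tendsto_atTop']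
  intro ε hε
  have hv0 : 0 ≤ ∫ x, v x := integral_nonneg_of_ae (by
    filter_upwards [hv] with x hx
    rcases hx with hx | hx <;> simp [hx])
  set η := ε / (2 * ((∫ x, v x) + 1)) with hηdef
  have hη : 0 < η := by positivity
  set c := 2 + δ ^ (1 - q) + η ^ (1 - q) with hc
  have hc0 : 0 < c := by positivity
  have h1 : ∀ᶠ n in atTop, ∫ x, |y n x - v x| ^ q < ε / (2 * c) :=
    hlim.eventually_lt_const (by positivity)
  obtain ⟨N, hN⟩ := eventually_atTop.1 h1
  refine ⟨N, fun n hn => ?_⟩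
  rw [Real.dist_eq, ← integral_sub (hli n) hvi]
  calc |∫ x, (largePart δ (y n x) - v x)| ≤ ∫ x, |largePart δ (y n x) - v x| :=
        abs_integral_le_integral_abs
    _ ≤ ∫ x, (η * v x + c * |y n x - v x| ^ q) :=
        integral_mono_ae (hdi n).abs ((hvi.const_mul _).add ((hyi n).const_mul _)) (hbound η hη n)
    _ = η * (∫ x, v x) + c * ∫ x, |y n x - v x| ^ q := by
        rw [integral_add (hvi.const_mul _) ((hyi n).const_mul _), integral_const_mul,
          integral_const_mul]
    _ < ε / 2 + ε / 2 := by
        refine add_lt_add_of_le_of_lt ?_ ?_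
        · rw [hηdef, div_mul_eq_mul_div, div_le_div_iff₀ (by positivity) (by norm_num)]
          nlinarith
        · calc _ < c * (ε / (2 * c)) := by gcongr; exact hN n hn.le
            _ = ε / 2 := by field_simp
    _ = ε := add_halves ε

/-! ### The liminf inequality -/

lemma ofReal_integral_divergence_le_perimeter {C : Set 𝔼} {T : 𝔼 → 𝔼} (hT : ContDiff ℝ 1 T)
    (hT' : HasCompactSupport T) (hT1 : ∀ x, ‖T x‖ ≤ 1) :
    ENNReal.ofReal (∫ x in C, divergence T x) ≤ perimeter C :=
  le_iSup_of_le T (le_iSup_of_le hT (le_iSup_of_le hT' (le_iSup_of_le hT1 le_rfl)))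

/-- If the potential energy over the exhausting cubes tends to zero, the limit takes its values in
the wells, by Fatou. -/
lemma ae_eq_or_of_tendsto_potential {φ L : ℕ → ℝ}
    (hφL : Tendsto (fun n => φ n * L n) atTop atTop) {u : 𝔼 → ℝ} {y : ℕ → 𝔼 → ℝ}
    (hy : ∀ n, AEStronglyMeasurable (y n))
    (hae : ∀ᵐ x, Tendsto (fun n => y n x) atTop (𝓝 (u x)))
    (hi : ∀ n, IntegrableOn (fun x => G (y n x)) (cube d (φ n) (L n)))
    (hlim : Tendsto (fun n => ∫ x in cube d (φ n) (L n), G (y n x)) atTop (𝓝 0)) :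
    ∀ᵐ x, u x = 1 ∨ u x = -1 := by
  set F : ℕ → 𝔼 → ℝ≥0∞ := fun n =>
    (cube d (φ n) (L n)).indicator (fun x => ENNReal.ofReal (G (y n x))) with hF
  have hFm : ∀ n, AEMeasurable (F n) := fun n =>
    (ENNReal.measurable_ofReal.comp_aemeasurable (continuous_G.measurable.comp_aemeasurable
      (hy n).aemeasurable)).indicator (isClosed_cube _ _).measurableSet
  have hFint : ∀ n, ∫⁻ x, F n x = ENNReal.ofReal (∫ x in cube d (φ n) (L n), G (y n x)) := by
    intro n
    rw [hF, lintegral_indicator (isClosed_cube _ _).measurableSet,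
      ofReal_integral_eq_lintegral_ofReal (hi n) (Eventually.of_forall fun x => G_nonneg _)]
  have hpt : ∀ᵐ x, Tendsto (fun n => F n x) atTop (𝓝 (ENNReal.ofReal (G (u x)))) := by
    filter_upwards [hae] with x hx
    have h1 : Tendsto (fun n => ENNReal.ofReal (G (y n x))) atTop
        (𝓝 (ENNReal.ofReal (G (u x)))) :=
      (ENNReal.continuous_ofReal.tendsto _).comp ((continuous_G.tendsto _).comp hx)
    refine h1.congr' ?_
    filter_upwards [hφL.eventually_gt_atTop (2 * ‖x‖)] with n hn
    have hx : x ∈ cube d (φ n) (L n) := interior_subset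
      (closedBall_subset_interior_cube (R := ‖x‖) (by linarith) (by simp))
    simp only [hF, indicator_of_mem hx]
  have hle : ∫⁻ x, ENNReal.ofReal (G (u x)) ≤ 0 := by
    calc ∫⁻ x, ENNReal.ofReal (G (u x)) = ∫⁻ x, liminf (fun n => F n x) atTop := by
          refine lintegral_congr_ae ?_
          filter_upwards [hpt] with x hx
          exact hx.liminf_eq.symm
      _ ≤ liminf (fun n => ∫⁻ x, F n x) atTop := lintegral_liminf_le' hFm
      _ = 0 := by
          simp_rw [hFint]
          have := (ENNReal.continuous_ofReal.tendsto _).comp hlim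
          rw [ENNReal.ofReal_zero] at this
          exact this.liminf_eq
  have hum : AEMeasurable u := aemeasurable_of_tendsto_metrizable_ae _
    (fun n => (hy n).aemeasurable) hae
  have h0 := (lintegral_eq_zero_iff' (ENNReal.measurable_ofReal.comp_aemeasurable
    (continuous_G.measurable.comp_aemeasurable hum))).1 (le_antisymm hle bot_le)
  filter_upwards [h0] with x hx
  have h1 : G (u x) ≤ 0 := by simpa using hx
  have h2 : (1 - u x ^ 2) ^ 2 = 0 := by
    have := G_nonneg (u x)
    unfold G at h1 this
    linarith
  have h3 : (u x - 1) * (u x + 1) = 0 := by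
    have := pow_eq_zero_iff (two_ne_zero) |>.1 h2
    linarith
  rcases mul_eq_zero.1 h3 with h | h
  · left; linarith
  · right; linarith

/-- Compactness form of the lower bound: a bound on the energies passes to the limit. -/
lemma limitEnergy_le_of_energyGap_le {q : ℝ} (hq : 1 ≤ q) {ξ : ℝ} (hξ : 0 < ξ) {φ L : ℕ → ℝ}
    (hφ : ∀ n, 0 < φ n) (hL : ∀ n, 0 < L n) (hφ0 : Tendsto φ atTop (𝓝 0))
    (hφL : Tendsto (fun n => φ n * L n) atTop atTop)
    (ha : Tendsto (fun n => φ n * (φ n * L n) ^ d) atTop (𝓝 (ξ ^ (d + 1))))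
    {v : 𝔼 → ℝ} {y : ℕ → 𝔼 → ℝ} (hv : Measurable v) (hvq : Integrable fun x => |v x| ^ q)
    (hym : ∀ n, AEStronglyMeasurable (y n))
    (hyi : ∀ n, Integrable fun x => |y n x - v x| ^ q)
    (hlim : Tendsto (fun n => ∫ x, |y n x - v x| ^ q) atTop (𝓝 0))
    (hae : ∀ᵐ x, Tendsto (fun n => y n x) atTop (𝓝 (v x)))
    (hadm : ∀ n, Admissible (φ n) (L n) (fun x => -1 + y n x)) {r : ℝ}
    (hr : ∀ n, energyGap (φ n) (L n) (fun x => -1 + y n x) ≤ (r : EReal)) :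
    limitEnergy ξ (fun x => -1 + v x) ≤ (r : EReal) := by
  set a : ℕ → ℝ := fun n => φ n * (φ n * L n) ^ d with hadef
  set a₀ := ξ ^ (d + 1) with ha₀
  have ha₀pos : 0 < a₀ := by positivity
  have hfac : Tendsto (fun n => (1 - φ n / 2) ^ 2) atTop (𝓝 1) := by
    have := ((hφ0.div_const 2).const_sub 1).pow 2
    simpa using this
  have hconst : Tendsto (fun n => a n * (1 - φ n / 2) ^ 2) atTop (𝓝 a₀) := by
    simpa using ha.mul hfac
  have hGi : ∀ n, IntegrableOn (fun x => G (-1 + y n x)) (cube d (φ n) (L n)) := by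
    intro n
    have : IsFiniteMeasure (volume.restrict (cube d (φ n) (L n))) :=
      ⟨by simpa using volume_cube_lt_top (mul_nonneg (hφ n).le (hL n).le)⟩
    exact integrable_G_of_memLp_four (hadm n).2.1
  -- the wells
  have hwells : ∀ᵐ x, -1 + v x = 1 ∨ -1 + v x = -1 := by
    refine ae_eq_or_of_tendsto_potential hφL (fun n => (hym n).const_add (-1))
      (by filter_upwards [hae] with x hx using hx.const_add (-1)) hGi ?_
    refine squeeze_zero (fun n => integral_nonneg fun x => G_nonneg _)
      (g := fun n => φ n * (r + a n * (1 - φ n / 2) ^ 2)) (fun n => ?_) ?_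
    · have h1 := EReal.coe_le_coe_iff.1
        ((energyGap_ge_potential (hφ n) (hL n) (hadm n)).trans (hr n))
      have h2 : 1 / φ n * (∫ x in cube d (φ n) (L n), G (-1 + y n x))
          ≤ r + a n * (1 - φ n / 2) ^ 2 := by simp only [hadef]; linarith
      rw [one_div, inv_mul_le_iff₀ (hφ n)] at h2
      exact h2
    · simpa using hφ0.mul (hconst.const_add r)
  have hv02 : ∀ᵐ x, v x = 0 ∨ v x = 2 := by
    filter_upwards [hwells] with x hx
    rcases hx with hx | hx
    · right; linarith
    · left; linarith
  have hvi : Integrable v := by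
    refine Integrable.mono' hvq hv.aestronglyMeasurable ?_
    filter_upwards [hv02] with x hx
    rcases hx with hx | hx
    · rw [hx]; simp; positivity
    · rw [hx, Real.norm_eq_abs, abs_two]
      exact Real.self_le_rpow_of_one_le (by norm_num) hq
  set C : Set 𝔼 := {x | -1 + v x = 1} with hC
  have hCm : MeasurableSet C := measurableSet_eq_fun (hv.const_add _) measurable_const
  have hvC : v =ᵐ[volume] C.indicator fun _ => (2 : ℝ) := by
    filter_upwards [hv02] with x hx
    by_cases hxC : x ∈ C
    · rw [indicator_of_mem hxC]
      have : -1 + v x = 1 := hxC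
      linarith
    · rw [indicator_of_notMem hxC]
      rcases hx with hx | hx
      · exact hx
      · exact absurd (show -1 + v x = 1 by rw [hx]; norm_num) hxC
  set V := volume.real C with hV
  have hvint : ∫ x, v x = 2 * V := by
    rw [integral_congr_ae hvC, integral_indicator hCm, setIntegral_const, smul_eq_mul, mul_comm]
  set X := (a₀ - 2 * V) ^ 2 / a₀ with hX
  -- the limit inequality for a fixed field
  have hfield : ∀ T : 𝔼 → 𝔼, ContDiff ℝ 1 T → HasCompactSupport T → (∀ x, ‖T x‖ ≤ 1) →
      ∀ δ : ℝ, 0 < δ → δ ≤ 1 →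
      wellPrimitive δ 1 * (∫ x in C, divergence T x) + (1 - δ / 4) ^ 2 * X - a₀ ≤ r := by
    intro T hT hT' hT1 δ hδ hδ1
    have l1 : Tendsto (fun n => ∫ x, wellPrimitive δ (-1 + y n x) * divergence T x) atTop
        (𝓝 (wellPrimitive δ 1 * ∫ x in C, divergence T x)) := by
      have e : wellPrimitive δ 1 * (∫ x in C, divergence T x)
          = ∫ x, wellPrimitive δ (-1 + v x) * divergence T x := by
        rw [← integral_const_mul, ← integral_indicator hCm]
        refine integral_congr_ae ?_
        filter_upwards [hvC] with x hx
        rw [hx]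
        by_cases hxC : x ∈ C
        · simp only [indicator_of_mem hxC]; norm_num
        · simp [indicator_of_notMem hxC, wellPrimitive_neg_one]
      rw [e]
      refine tendsto_integral_of_dominated_convergence (fun x => 2 * |divergence T x|) ?_ ?_ ?_ ?_
      · intro n
        exact ((continuous_wellPrimitive δ).measurable.comp_aemeasurable
          ((hym n).const_add (-1)).aemeasurable).aestronglyMeasurable.mul
          (continuous_divergence hT).aestronglyMeasurable
      · exact (integrable_divergence hT hT').abs.const_mul 2
      · intro n
        refine Eventually.of_forall fun x => ?_
        rw [Real.norm_eq_abs, abs_mul]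
        gcongr
        exact abs_wellPrimitive_le hδ.le _
      · filter_upwards [hae] with x hx
        exact (((continuous_wellPrimitive δ).tendsto _).comp (hx.const_add (-1))).mul_const _
    have l2 := tendsto_integral_largePart hq (half_pos hδ) (by linarith) hv02 hvi hym hyi hlim
    rw [hvint] at l2
    have l3 : Tendsto (fun n => (1 - δ / 4) ^ 2 *
        ((a n - ∫ x, largePart (δ / 2) (y n x)) ^ 2 / a n)) atTop
        (𝓝 ((1 - δ / 4) ^ 2 * X)) :=
      (((ha.sub l2).pow 2).div ha ha₀pos.ne').const_mul _
    have l4 := (l1.add l3).sub hconst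
    refine le_of_tendsto l4 ?_
    obtain ⟨R, hR⟩ := hT'.isCompact.isBounded.subset_closedBall 0
    filter_upwards [hφL.eventually_gt_atTop (2 * R)] with n hn
    have h1 := energyGap_lower_bound (hφ n) (hL n) (hadm n) hT hT' hT1
      (hR.trans (closedBall_subset_interior_cube (by linarith))) hδ hδ1
    exact EReal.coe_le_coe_iff.1 (h1.trans (hr n))
  -- removing the truncation of the potential
  have hfield0 : ∀ T : 𝔼 → 𝔼, ContDiff ℝ 1 T → HasCompactSupport T → (∀ x, ‖T x‖ ≤ 1) →
      0 ≤ ∫ x in C, divergence T x → c₀ * (∫ x in C, divergence T x) + X - a₀ ≤ r := by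
    intro T hT hT' hT1 hD
    set D := ∫ x in C, divergence T x
    have hc : Continuous fun δ : ℝ => (c₀ - 2 * δ) * D + (1 - δ / 4) ^ 2 * X - a₀ := by fun_prop
    have hl : Tendsto (fun δ : ℝ => (c₀ - 2 * δ) * D + (1 - δ / 4) ^ 2 * X - a₀) (𝓝[>] 0)
        (𝓝 (c₀ * D + X - a₀)) := by
      have := (hc.tendsto 0).mono_left (nhdsWithin_le_nhds (s := Ioi (0 : ℝ)))
      simpa using this
    refine le_of_tendsto hl ?_
    filter_upwards [Ioc_mem_nhdsGT (zero_lt_one' ℝ)] with δ hδ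
    have h1 := hfield T hT hT' hT1 δ hδ.1 hδ.2
    have h2 := mul_le_mul_of_nonneg_right (c₀_sub_le_wellPrimitive δ) hD
    linarith
  have hbase : 0 ≤ (r + a₀ - X) / c₀ := by
    have h0 : divergence (fun _ : 𝔼 => (0 : 𝔼)) = 0 := by ext x; simp [divergence]
    have h1 := hfield0 (fun _ => 0) contDiff_const HasCompactSupport.zero (by simp) (by simp [h0])
    simp only [h0, Pi.zero_apply, integral_zero, mul_zero] at h1
    exact div_nonneg (by linarith) c₀_pos.le
  have hper : perimeter C ≤ ENNReal.ofReal ((r + a₀ - X) / c₀) := by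
    refine iSup_le fun T => iSup_le fun hT => iSup_le fun hT' => iSup_le fun hT1 => ?_
    rcases le_total 0 (∫ x in C, divergence T x) with hD | hD
    · refine ENNReal.ofReal_le_ofReal ?_
      rw [le_div_iff₀ c₀_pos]
      have := hfield0 T hT hT' hT1 hD
      linarith
    · rw [ENNReal.ofReal_of_nonpos hD]; exact bot_le
  have hperfin : perimeter C < ⊤ := hper.trans_lt ENNReal.ofReal_lt_top
  have hper' : (perimeter C).toReal ≤ (r + a₀ - X) / c₀ := by
    have := ENNReal.toReal_mono ENNReal.ofReal_ne_top hper
    rwa [ENNReal.toReal_ofReal hbase] at this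
  rw [limitEnergy, if_pos ⟨hwells, hperfin⟩, EReal.coe_le_coe_iff]
  rw [le_div_iff₀ c₀_pos] at hper'
  have e : X = a₀ - 4 * V + 4 * a₀⁻¹ * V ^ 2 := by
    rw [hX]; field_simp; ring
  change c₀ * (perimeter C).toReal - 4 * V + 4 * a₀⁻¹ * V ^ 2 ≤ r
  linarith

lemma integral_abs_rpow_eq {p : ℝ≥0∞} [Fact (1 ≤ p)] (hp : p < ⊤)
    (f : Lp ℝ p (volume : Measure 𝔼)) :
    Integrable (fun x => |f x| ^ p.toReal) ∧ ∫ x, |f x| ^ p.toReal = ‖f‖ ^ p.toReal := by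
  have hp1 : 1 ≤ p := Fact.out
  have hp0 : p ≠ 0 := (zero_lt_one.trans_le hp1).ne'
  have hpr : 0 < p.toReal := ENNReal.toReal_pos hp0 hp.ne
  have h := Lp.memLp f
  refine ⟨by simpa using h.integrable_norm_rpow hp0 hp.ne, ?_⟩
  rw [Lp.norm_def, h.eLpNorm_eq_integral_rpow_norm hp0 hp.ne,
    ENNReal.toReal_ofReal (by positivity), Real.rpow_inv_rpow _ hpr.ne']
  · rfl
  · exact integral_nonneg fun x => by positivity

lemma integral_abs_sub_rpow_eq {p : ℝ≥0∞} [Fact (1 ≤ p)] (hp : p < ⊤)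
    (f g : Lp ℝ p (volume : Measure 𝔼)) :
    Integrable (fun x => |f x - g x| ^ p.toReal) ∧
      ∫ x, |f x - g x| ^ p.toReal = ‖f - g‖ ^ p.toReal := by
  obtain ⟨h1, h2⟩ := integral_abs_rpow_eq hp (f - g)
  have e : (fun x => |(f - g) x| ^ p.toReal) =ᵐ[volume] fun x => |f x - g x| ^ p.toReal := by
    filter_upwards [Lp.coeFn_sub f g] with x hx
    rw [hx, Pi.sub_apply]
  exact ⟨h1.congr e, by rw [← h2]; exact (integral_congr_ae e).symm⟩

lemma limitEnergy_le_liminf {p : ℝ≥0∞} [Fact (1 ≤ p)] (hp' : p < ⊤)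
    {ξ : ℝ} (hξ : 0 < ξ) {φ L : ℕ → ℝ}
    (hφ : ∀ n, 0 < φ n) (hL : ∀ n, 0 < L n) (hφ0 : Tendsto φ atTop (𝓝 0))
    (hφL : Tendsto (fun n => φ n * L n) atTop atTop)
    (ha : Tendsto (fun n => φ n * (φ n * L n) ^ d) atTop (𝓝 (ξ ^ (d + 1))))
    {v : Lp ℝ p (volume : Measure 𝔼)} {y : ℕ → Lp ℝ p (volume : Measure 𝔼)}
    (hy : Tendsto y atTop (𝓝 v)) :
    limitEnergy ξ (fun x => -1 + v x) ≤
      liminf (fun n => energyGap (φ n) (L n) (fun x => -1 + y n x)) atTop := by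
  by_contra! hlt
  obtain ⟨r, hr1, hr2⟩ := EReal.lt_iff_exists_real_btwn.1 hlt
  obtain ⟨σ, hσ, hσr⟩ := extraction_of_frequently_atTop
    (frequently_lt_of_liminf_lt (by isBoundedDefault) hr1)
  have hyσ : Tendsto (fun n => y (σ n)) atTop (𝓝 v) := hy.comp hσ.tendsto_atTop
  obtain ⟨τ, hτ, hae⟩ := (tendstoInMeasure_of_tendsto_Lp hyσ).exists_seq_tendsto_ae
  have hστ : Tendsto (fun n => σ (τ n)) atTop atTop := hσ.tendsto_atTop.comp hτ.tendsto_atTop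
  have hq : 1 ≤ p.toReal := by
    have := ENNReal.toReal_mono hp'.ne (Fact.out : 1 ≤ p)
    simpa using this
  refine absurd hr2 (not_lt.2 ?_)
  refine limitEnergy_le_of_energyGap_le hq hξ (φ := fun n => φ (σ (τ n)))
    (L := fun n => L (σ (τ n))) (fun n => hφ _) (fun n => hL _) (hφ0.comp hστ) (hφL.comp hστ)
    (ha.comp hστ) (y := fun n => y (σ (τ n))) (Lp.stronglyMeasurable v).measurable
    (integral_abs_rpow_eq hp' v).1 (fun n => Lp.aestronglyMeasurable _)
    (fun n => (integral_abs_sub_rpow_eq hp' _ _).1) ?_ hae (fun n => ?_) (fun n => (hσr _).le)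
  · simp_rw [fun n => (integral_abs_sub_rpow_eq hp' (y (σ (τ n))) v).2]
    have h1 : Tendsto (fun n => ‖y (σ (τ n)) - v‖) atTop (𝓝 0) := by
      have := (tendsto_iff_norm_sub_tendsto_zero.1 hy).comp hστ
      exact this
    have h2 := h1.rpow_const (p := p.toReal) (Or.inr (by linarith))
    rwa [Real.zero_rpow (by linarith)] at h2
  · by_contra hn
    have := hσr (τ n)
    rw [energyGap, if_neg hn] at this
    exact not_top_lt this

/-! ### Smooth approximation of sets of finite perimeter -/

lemma integral_divergence_le_perimeter {C : Set 𝔼} (hP : perimeter C < ⊤) {T : 𝔼 → 𝔼}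
    (hT : ContDiff ℝ 1 T) (hT' : HasCompactSupport T) (hT1 : ∀ x, ‖T x‖ ≤ 1) :
    ∫ x in C, divergence T x ≤ (perimeter C).toReal := by
  rw [← ENNReal.ofReal_le_iff_le_toReal hP.ne]
  exact ofReal_integral_divergence_le_perimeter hT hT' hT1

/-- Mollification does not increase the perimeter: by Fubini, the mollified indicator tested
against `div T` is an average of `∫_C div T(· + t)`, and translates of `T` are admissible. -/
lemma integral_convolution_indicator_mul_divergence_le {C : Set 𝔼} (hC : MeasurableSet C)
    (hP : perimeter C < ⊤) (b : ContDiffBump (0 : 𝔼)) {T : 𝔼 → 𝔼}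
    (hT : ContDiff ℝ 1 T) (hT' : HasCompactSupport T) (hT1 : ∀ x, ‖T x‖ ≤ 1) :
    ∫ x, (b.normed volume ⋆[ContinuousLinearMap.lsmul ℝ ℝ, volume] (C.indicator 1)) x
      * divergence T x ≤ (perimeter C).toReal := by
  set η := b.normed (volume : Measure 𝔼)
  have hηi : Integrable η := b.integrable_normed
  have hdi := integrable_divergence hT hT'
  have hone : Measurable (C.indicator (1 : 𝔼 → ℝ)) := measurable_one.indicator hC
  have hone1 : ∀ x, ‖C.indicator (1 : 𝔼 → ℝ) x‖ ≤ 1 := fun x => by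
    by_cases hx : x ∈ C <;> simp [hx]
  have hprod : Integrable (fun z : 𝔼 × 𝔼 => divergence T z.1 * η z.2 *
      C.indicator (1 : 𝔼 → ℝ) (z.1 - z.2)) (volume.prod volume) :=
    (hdi.mul_prod hηi).mul_bdd (c := 1)
      (hone.comp (measurable_fst.sub measurable_snd)).aestronglyMeasurable
      (Eventually.of_forall fun z => hone1 _)
  have hshift : ∀ t : 𝔼, ∫ x, divergence T x * C.indicator (1 : 𝔼 → ℝ) (x - t)
      ≤ (perimeter C).toReal := by
    intro t
    have hTt : ContDiff ℝ 1 fun x => T (x + t) := hT.comp (contDiff_id.add contDiff_const)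
    have hTt' : HasCompactSupport fun x => T (x + t) :=
      hT'.comp_homeomorph (Homeomorph.addRight t)
    have h := integral_divergence_le_perimeter hP hTt hTt' fun x => hT1 _
    rw [← integral_add_right_eq_self _ t]
    refine le_of_eq_of_le ?_ h
    rw [← integral_indicator hC]
    congr 1
    ext x
    have hdiv : divergence (fun x => T (x + t)) x = divergence T (x + t) := by
      simp only [divergence, fderiv_comp_add_right]
    by_cases hx : x ∈ C <;> simp [hx, hdiv]
  calc ∫ x, (η ⋆[ContinuousLinearMap.lsmul ℝ ℝ, volume] (C.indicator 1)) x * divergence T x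
      = ∫ x, ∫ t, divergence T x * η t * C.indicator (1 : 𝔼 → ℝ) (x - t) := by
        congr 1
        ext x
        rw [convolution_def, mul_comm, ← integral_const_mul]
        congr 1
        ext t
        simp [mul_assoc]
    _ = ∫ t, ∫ x, divergence T x * η t * C.indicator (1 : 𝔼 → ℝ) (x - t) :=
        integral_integral_swap hprod
    _ ≤ ∫ t, η t * (perimeter C).toReal := by
        refine integral_mono hprod.integral_prod_right (hηi.mul_const _) fun t => ?_
        have e : ∫ x, divergence T x * η t * C.indicator (1 : 𝔼 → ℝ) (x - t)
            = η t * ∫ x, divergence T x * C.indicator (1 : 𝔼 → ℝ) (x - t) := by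
          rw [← integral_const_mul]
          congr 1; ext x; ring
        simp only [e]
        exact mul_le_mul_of_nonneg_left (hshift t) (b.nonneg_normed t)
    _ = (perimeter C).toReal := by
        rw [integral_mul_const, b.integral_normed, one_mul]

lemma norm_gradient (f : 𝔼 → ℝ) (x : 𝔼) : ‖gradient f x‖ = ‖fderiv ℝ f x‖ := by
  simp [gradient]

lemma contDiff_gradient {f : 𝔼 → ℝ} (hf : ContDiff ℝ ∞ f) : ContDiff ℝ ∞ (gradient f) :=
  (InnerProductSpace.toDual ℝ 𝔼).symm.contDiff.comp (hf.fderiv_right (m := ∞) (by simp))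

lemma fderiv_apply_eq_inner_gradient (f : 𝔼 → ℝ) (x v : 𝔼) :
    fderiv ℝ f x v = ⟪gradient f x, v⟫_ℝ := by
  simp [gradient, InnerProductSpace.toDual_symm_apply]

/-- The slope `|∇F|`, made smooth and bounded below by `κ`. -/
noncomputable def regularizedSlope (F : 𝔼 → ℝ) (κ : ℝ) (x : 𝔼) : ℝ :=
  Real.sqrt (‖gradient F x‖ ^ 2 + κ ^ 2)

lemma contDiff_regularizedSlope {F : 𝔼 → ℝ} (hF : ContDiff ℝ ∞ F) {κ : ℝ} (hκ : 0 < κ) :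
    ContDiff ℝ ∞ (regularizedSlope F κ) :=
  (((contDiff_gradient hF).norm_sq ℝ).add contDiff_const).sqrt fun x => by positivity

lemma le_regularizedSlope (F : 𝔼 → ℝ) (κ : ℝ) (x : 𝔼) : κ ≤ regularizedSlope F κ x :=
  Real.le_sqrt_of_sq_le (by nlinarith [sq_nonneg ‖gradient F x‖])

lemma norm_fderiv_le_regularizedSlope (F : 𝔼 → ℝ) (κ : ℝ) (x : 𝔼) :
    ‖fderiv ℝ F x‖ ≤ regularizedSlope F κ x := by
  rw [← norm_gradient]
  exact Real.le_sqrt_of_sq_le (by nlinarith [sq_nonneg κ])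

lemma regularizedSlope_le {F : 𝔼 → ℝ} {κ : ℝ} (hκ : 0 < κ) (x : 𝔼) :
    regularizedSlope F κ x ≤ ‖fderiv ℝ F x‖ + κ := by
  rw [← norm_gradient]
  refine Real.sqrt_le_iff.2 ⟨by positivity, ?_⟩
  nlinarith [norm_nonneg (gradient F x)]

lemma regularizedSlope_eq {F : 𝔼 → ℝ} {κ : ℝ} (hκ : 0 < κ) {x : 𝔼} (hx : x ∉ tsupport F) :
    regularizedSlope F κ x = κ := by
  have h0 : fderiv ℝ F x = 0 := by
    by_contra h0
    exact hx (support_fderiv_subset ℝ h0)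
  have h1 : ‖gradient F x‖ = 0 := by rw [norm_gradient, h0, norm_zero]
  rw [regularizedSlope, h1]
  simp [Real.sqrt_sq hκ.le]

lemma exists_norm_fderiv_regularizedSlope_le {F : 𝔼 → ℝ} (hF : ContDiff ℝ ∞ F)
    (hF' : HasCompactSupport F) {κ : ℝ} (hκ : 0 < κ) :
    ∃ K₀, ∀ x, ‖fderiv ℝ (regularizedSlope F κ) x‖ ≤ K₀ := by
  have hs := contDiff_regularizedSlope hF hκ
  have h1 : HasCompactSupport fun x => regularizedSlope F κ x - κ :=
    HasCompactSupport.intro hF' fun x hx => by rw [regularizedSlope_eq hκ hx, sub_self]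
  have h2 : fderiv ℝ (regularizedSlope F κ) = fderiv ℝ fun x => regularizedSlope F κ x - κ := by
    ext1 x
    rw [fderiv_sub_const]
  have h3 : HasCompactSupport (fderiv ℝ (regularizedSlope F κ)) := by
    rw [h2]; exact h1.fderiv ℝ
  exact h3.exists_bound_of_continuous (hs.continuous_fderiv (by simp))

/-- If `∫ f div T ≤ P` for all admissible `T`, then `∫ χ |∇f| ≤ P` for all cutoffs `χ`: the
regularised direction `-χ ∇f / √(|∇f|² + κ²)` is an admissible field. -/
lemma integral_cutoff_mul_norm_fderiv_le {f χ : 𝔼 → ℝ} (hf : ContDiff ℝ ∞ f) {P : ℝ}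
    (hP : ∀ T : 𝔼 → 𝔼, ContDiff ℝ 1 T → HasCompactSupport T → (∀ x, ‖T x‖ ≤ 1) →
      ∫ x, f x * divergence T x ≤ P)
    (hχ : ContDiff ℝ ∞ χ) (hχ' : HasCompactSupport χ) (hχ0 : ∀ x, 0 ≤ χ x) (hχ1 : ∀ x, χ x ≤ 1) :
    ∫ x, χ x * ‖fderiv ℝ f x‖ ≤ P := by
  have hχi : Integrable χ := hχ.continuous.integrable_of_hasCompactSupport hχ'
  have hdf : Continuous fun x => ‖fderiv ℝ f x‖ := (hf.continuous_fderiv (by simp)).norm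
  have hi : Integrable fun x => χ x * ‖fderiv ℝ f x‖ :=
    (hχ.continuous.mul hdf).integrable_of_hasCompactSupport hχ'.mul_right
  have key : ∀ κ : ℝ, 0 < κ → ∫ x, χ x * ‖fderiv ℝ f x‖ ≤ P + κ * ∫ x, χ x := by
    intro κ hκ
    set m := regularizedSlope f κ with hm
    have hmκ : ∀ x, κ ≤ m x := le_regularizedSlope f κ
    have hmpos : ∀ x, 0 < m x := fun x => hκ.trans_le (hmκ x)
    have hms : ContDiff ℝ ∞ m := contDiff_regularizedSlope hf hκ
    have hgm : ∀ x, ‖gradient f x‖ ≤ m x := fun x => by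
      rw [norm_gradient]; exact norm_fderiv_le_regularizedSlope f κ x
    set T : 𝔼 → 𝔼 := fun x => -((χ x / m x) • gradient f x) with hTdef
    have hT : ContDiff ℝ 1 T :=
      (((hχ.div hms fun x => (hmpos x).ne').smul (contDiff_gradient hf)).neg).of_le
        (by exact_mod_cast le_top)
    have hT' : HasCompactSupport T := by
      refine hχ'.mono fun x hx hx0 => hx ?_
      simp only [hTdef, hx0, zero_div, zero_smul, neg_zero]
    have hT1 : ∀ x, ‖T x‖ ≤ 1 := by
      intro x
      simp only [hTdef]
      rw [norm_neg, norm_smul, Real.norm_eq_abs, abs_of_nonneg (div_nonneg (hχ0 x) (hmpos x).le),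
        div_mul_eq_mul_div, div_le_one (hmpos x)]
      exact (mul_le_of_le_one_left (norm_nonneg _) (hχ1 x)).trans (hgm x)
    have h1 := hP T hT hT' hT1
    rw [integral_mul_divergence (hf.of_le (by exact_mod_cast le_top)) hT hT', ← integral_neg] at h1
    have e : ∀ x, -(fderiv ℝ f x (T x)) = χ x * (‖gradient f x‖ ^ 2 / m x) := by
      intro x
      rw [fderiv_apply_eq_inner_gradient]
      simp only [hTdef]
      rw [inner_neg_right, inner_smul_right, real_inner_self_eq_norm_sq]
      ring
    simp_rw [e] at h1
    have hi2 : Integrable fun x => χ x * (‖gradient f x‖ ^ 2 / m x) := by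
      refine (hχ.continuous.mul ((((contDiff_gradient hf).continuous.norm.pow 2).div
        hms.continuous fun x => (hmpos x).ne'))).integrable_of_hasCompactSupport hχ'.mul_right
    have h2 : ∫ x, χ x * ‖fderiv ℝ f x‖
        ≤ ∫ x, (χ x * (‖gradient f x‖ ^ 2 / m x) + κ * χ x) := by
      refine integral_mono hi (hi2.add (hχi.const_mul _)) fun x => ?_
      have h3 : ‖fderiv ℝ f x‖ ≤ ‖gradient f x‖ ^ 2 / m x + κ := by
        rw [← norm_gradient, ← sub_le_iff_le_add, le_div_iff₀ (hmpos x)]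
        have h4 : m x ≤ ‖gradient f x‖ + κ := by
          rw [norm_gradient]; exact regularizedSlope_le hκ x
        have h5 := hgm x
        have h6 := hmκ x
        nlinarith [norm_nonneg (gradient f x)]
      have := mul_le_mul_of_nonneg_left h3 (hχ0 x)
      simp only
      linarith
    rw [integral_add hi2 (hχi.const_mul _), integral_const_mul] at h2
    linarith
  have hl : Tendsto (fun κ : ℝ => P + κ * ∫ x, χ x) (𝓝[>] 0) (𝓝 P) := by
    have hc : Continuous fun κ : ℝ => P + κ * ∫ x, χ x := by fun_prop
    have := (hc.tendsto 0).mono_left (nhdsWithin_le_nhds (s := Ioi (0 : ℝ)))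
    simpa using this
  refine ge_of_tendsto hl ?_
  filter_upwards [self_mem_nhdsWithin] with κ hκ
  exact key κ hκ

/-- Smooth cutoffs of balls of radius `R`, with gradient of order `1 / R`. -/
lemma exists_cutoff : ∃ M : ℝ, 0 ≤ M ∧ ∀ R : ℝ, 1 ≤ R → ∃ χ : 𝔼 → ℝ, ContDiff ℝ ∞ χ ∧
    HasCompactSupport χ ∧ (∀ x, 0 ≤ χ x) ∧ (∀ x, χ x ≤ 1) ∧ (∀ x, ‖x‖ ≤ R → χ x = 1) ∧
    ∀ x, ‖fderiv ℝ χ x‖ ≤ M / R := by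
  set b : ContDiffBump (0 : 𝔼) := ⟨1, 2, one_pos, one_lt_two⟩ with hb
  have hbs : ContDiff ℝ ∞ b := b.contDiff
  obtain ⟨M, hM⟩ := (b.hasCompactSupport.fderiv ℝ).exists_bound_of_continuous
    (hbs.continuous_fderiv (by simp))
  refine ⟨M, (norm_nonneg _).trans (hM 0), fun R hR => ?_⟩
  have hR0 : 0 < R := by linarith
  refine ⟨fun x => b (R⁻¹ • x), hbs.comp (contDiff_const_smul _), ?_, fun x => b.nonneg,
    fun x => b.le_one, fun x hx => ?_, fun x => ?_⟩
  · exact b.hasCompactSupport.comp_smul (inv_ne_zero hR0.ne')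
  · refine b.one_of_mem_closedBall ?_
    rw [mem_closedBall_zero_iff, norm_smul, norm_inv, Real.norm_eq_abs, abs_of_pos hR0]
    exact (inv_mul_le_one₀ hR0).2 hx
  · have h1 : fderiv ℝ (fun x => b (R⁻¹ • x)) x = R⁻¹ • fderiv ℝ b (R⁻¹ • x) := by
      exact fderiv_comp_smul R⁻¹
    rw [h1, norm_smul, norm_inv, Real.norm_eq_abs, abs_of_pos hR0, div_eq_inv_mul]
    gcongr
    exact hM _

/-- A set of finite volume and perimeter is approximated by a smooth function whose total
variation does not exceed the perimeter by more than `ε`. -/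
lemma exists_smooth_approx {C : Set 𝔼} (hC : MeasurableSet C) (hCv : volume C < ⊤)
    (hP : perimeter C < ⊤) {ε : ℝ} (hε : 0 < ε) :
    ∃ F : 𝔼 → ℝ, ContDiff ℝ ∞ F ∧ HasCompactSupport F ∧ (∀ x, 0 ≤ F x) ∧ (∀ x, F x ≤ 1) ∧
      Integrable (fun x => |F x - C.indicator 1 x|) ∧
      ∫ x, |F x - C.indicator 1 x| ≤ ε ∧ ∫ x, ‖fderiv ℝ F x‖ ≤ (perimeter C).toReal + ε := by
  set i : 𝔼 → ℝ := C.indicator 1 with hi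
  have hii : Integrable i := (integrable_indicator_iff hC).2 (integrableOn_const hCv.ne)
  have hi0 : ∀ x, 0 ≤ i x := fun x => indicator_nonneg (fun _ _ => zero_le_one) x
  have hi1 : ∀ x, i x ≤ 1 := fun x => by by_cases hx : x ∈ C <;> simp [hi, hx]
  obtain ⟨M, hM0, hM⟩ := exists_cutoff (d := d)
  -- a ball which carries most of the volume
  have htail : Tendsto (fun R : ℝ => ∫ x, (Metric.closedBall (0 : 𝔼) R)ᶜ.indicator i x) atTop
      (𝓝 0) := by
    have h0 : (0 : ℝ) = ∫ x : 𝔼, (0 : ℝ) := by simp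
    rw [h0]
    refine tendsto_integral_filter_of_dominated_convergence i ?_ ?_ hii ?_
    · exact Eventually.of_forall fun R =>
        (hii.indicator Metric.isClosed_closedBall.measurableSet.compl).aestronglyMeasurable
    · refine Eventually.of_forall fun R => Eventually.of_forall fun x => ?_
      refine (norm_indicator_le_norm_self _ _).trans ?_
      rw [Real.norm_eq_abs, abs_of_nonneg (hi0 x)]
    · refine Eventually.of_forall fun x => ?_
      refine tendsto_const_nhds.congr' ?_
      filter_upwards [eventually_ge_atTop ‖x‖] with R hR
      rw [indicator_of_notMem]
      simpa using hR
  have hMR : Tendsto (fun R : ℝ => M / R * ∫ x, i x) atTop (𝓝 0) := by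
    have := (tendsto_const_nhds (x := M)).div_atTop (tendsto_id (α := ℝ) (x := atTop))
    simpa using this.mul_const (∫ x, i x)
  obtain ⟨R, hR1, hRt, hRM⟩ := ((eventually_ge_atTop (1 : ℝ)).and
    ((htail.eventually_lt_const (half_pos hε)).and (hMR.eventually_lt_const hε))).exists
  obtain ⟨χ, hχ, hχ', hχ0, hχ1, hχR, hχd⟩ := hM R hR1
  have hχi : Integrable χ := hχ.continuous.integrable_of_hasCompactSupport hχ'
  -- the mollifications
  set f : ℕ → 𝔼 → ℝ := fun k =>
    ((bumpSeq d 1 one_pos k).normed volume ⋆[ContinuousLinearMap.lsmul ℝ ℝ, volume] i) with hf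
  have hfs : ∀ k, ContDiff ℝ ∞ (f k) := fun k =>
    (bumpSeq d 1 one_pos k).hasCompactSupport_normed.contDiff_convolution_left _
      (bumpSeq d 1 one_pos k).contDiff_normed hii.locallyIntegrable
  have hfi : ∀ k, Integrable (f k) := fun k =>
    (bumpSeq d 1 one_pos k).integrable_normed.integrable_convolution _ hii
  have hfint : ∀ k, ∫ x, f k x = ∫ x, i x := fun k => by
    rw [hf, integral_convolution _ (bumpSeq d 1 one_pos k).integrable_normed hii,
      (bumpSeq d 1 one_pos k).integral_normed]
    simp
  have hf0 : ∀ k x, 0 ≤ f k x := fun k x => by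
    simp only [hf, convolution_def]
    exact integral_nonneg fun t => by
      simpa using mul_nonneg ((bumpSeq d 1 one_pos k).nonneg_normed t) (hi0 _)
  have hf1 : ∀ k x, f k x ≤ 1 := fun k x => by
    set b := bumpSeq d 1 one_pos k
    have hb : Integrable (b.normed (volume : Measure 𝔼)) := b.integrable_normed
    calc f k x = ∫ t, b.normed volume t * i (x - t) := by simp [hf, convolution_def, b]
      _ ≤ ∫ t, b.normed volume t := by
          refine integral_mono_of_nonneg
            (Eventually.of_forall fun t => mul_nonneg (b.nonneg_normed t) (hi0 _)) hb
            (Eventually.of_forall fun t => ?_)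
          exact mul_le_of_le_one_right (b.nonneg_normed t) (hi1 _)
      _ = 1 := b.integral_normed
  have hconv : Tendsto (fun k => ∫ x, χ x * |f k x - i x|) atTop (𝓝 0) := by
    have h0 : (0 : ℝ) = ∫ x : 𝔼, (0 : ℝ) := by simp
    rw [h0]
    refine tendsto_integral_of_dominated_convergence χ ?_ hχi ?_ ?_
    · intro k
      exact hχ.continuous.aestronglyMeasurable.mul
        ((hfi k).sub hii).aestronglyMeasurable.norm
    · refine fun k => Eventually.of_forall fun x => ?_
      rw [Real.norm_eq_abs, abs_mul, abs_of_nonneg (hχ0 x), abs_abs]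
      refine mul_le_of_le_one_right (hχ0 x) ?_
      rw [abs_le]
      constructor <;> linarith [hf0 k x, hf1 k x, hi0 x, hi1 x]
    · filter_upwards [ae_tendsto_bumpSeq_convolution 1 one_pos hii.locallyIntegrable] with x hx
      have h1 : Tendsto (fun k => χ x * |f k x - i x|) atTop (𝓝 (χ x * |i x - i x|)) :=
        ((hx.sub_const _).abs).const_mul _
      simpa using h1
  obtain ⟨k, hk⟩ := (hconv.eventually_lt_const (half_pos hε)).exists
  have hFs : ContDiff ℝ ∞ fun x => χ x * f k x := hχ.mul (hfs k)
  have hFi : Integrable fun x => |χ x * f k x - i x| :=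
    ((hFs.continuous.integrable_of_hasCompactSupport hχ'.mul_right).sub hii).abs
  refine ⟨fun x => χ x * f k x, hFs, hχ'.mul_right, fun x => mul_nonneg (hχ0 x) (hf0 k x),
    fun x => mul_le_one₀ (hχ1 x) (hf0 k x) (hf1 k x), hFi, ?_, ?_⟩
  · have hi3 : Integrable fun x => χ x * |f k x - i x| :=
      ((hfi k).sub hii).abs.bdd_mul (c := 1) hχ.continuous.aestronglyMeasurable
        (Eventually.of_forall fun x => by
          rw [Real.norm_eq_abs, abs_of_nonneg (hχ0 x)]; exact hχ1 x)
    have hi4 : Integrable ((Metric.closedBall (0 : 𝔼) R)ᶜ.indicator i) :=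
      hii.indicator Metric.isClosed_closedBall.measurableSet.compl
    calc ∫ x, |χ x * f k x - i x|
        ≤ ∫ x, (χ x * |f k x - i x| + (Metric.closedBall (0 : 𝔼) R)ᶜ.indicator i x) := by
          refine integral_mono hFi (hi3.add hi4) fun x => ?_
          have h1 : |χ x * f k x - i x| ≤ χ x * |f k x - i x| + (1 - χ x) * i x := by
            have e : χ x * f k x - i x = χ x * (f k x - i x) + -((1 - χ x) * i x) := by ring
            rw [e]
            refine (abs_add_le _ _).trans ?_
            rw [abs_neg, abs_mul, abs_of_nonneg (hχ0 x),
              abs_of_nonneg (mul_nonneg (sub_nonneg.2 (hχ1 x)) (hi0 x))]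
          refine h1.trans (add_le_add le_rfl ?_)
          by_cases hx : x ∈ Metric.closedBall (0 : 𝔼) R
          · rw [hχR x (by simpa using hx)]
            simp [hx]
          · rw [indicator_of_mem (show x ∈ (Metric.closedBall (0 : 𝔼) R)ᶜ from hx)]
            exact mul_le_of_le_one_left (hi0 x) (by linarith [hχ0 x])
      _ ≤ ε := by rw [integral_add hi3 hi4]; linarith
  · have hd1 : ∀ x, ‖fderiv ℝ (fun x => χ x * f k x) x‖
        ≤ χ x * ‖fderiv ℝ (f k) x‖ + M / R * f k x := by
      intro x
      rw [fderiv_fun_mul (hχ.differentiable (by simp) x) ((hfs k).differentiable (by simp) x)]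
      refine (norm_add_le _ _).trans ?_
      rw [norm_smul, norm_smul, Real.norm_eq_abs, Real.norm_eq_abs, abs_of_nonneg (hχ0 x),
        abs_of_nonneg (hf0 k x), mul_comm (f k x)]
      gcongr
      · exact hf0 k x
      · exact hχd x
    have hdi : Integrable fun x => ‖fderiv ℝ (fun x => χ x * f k x) x‖ :=
      ((hFs.continuous_fderiv (by simp)).integrable_of_hasCompactSupport
        (hχ'.mul_right.fderiv ℝ)).norm
    have hi5 : Integrable fun x => χ x * ‖fderiv ℝ (f k) x‖ :=
      (hχ.continuous.mul ((hfs k).continuous_fderiv (by simp)).norm).integrable_of_hasCompactSupport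
        hχ'.mul_right
    calc ∫ x, ‖fderiv ℝ (fun x => χ x * f k x) x‖
        ≤ ∫ x, (χ x * ‖fderiv ℝ (f k) x‖ + M / R * f k x) :=
          integral_mono hdi (hi5.add ((hfi k).const_mul _)) hd1
      _ = (∫ x, χ x * ‖fderiv ℝ (f k) x‖) + M / R * ∫ x, i x := by
          rw [integral_add hi5 ((hfi k).const_mul _), integral_const_mul, hfint]
      _ ≤ (perimeter C).toReal + ε := by
          refine add_le_add ?_ hRM.le
          exact integral_cutoff_mul_norm_fderiv_le (hfs k)
            (fun T hT hT' hT1 => integral_convolution_indicator_mul_divergence_le hC hP _ hT hT' hT1)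
            hχ hχ' hχ0 hχ1

/-! ### Almost optimal transition profiles of finite width -/

/-- The optimal profile `tanh (s / √2)`, the solution of `θ' = √(2 G(θ))`, `θ(0) = 0`. -/
noncomputable def optimalProfile (s : ℝ) : ℝ := 1 - 2 / (Real.exp (√2 * s) + 1)

lemma optimalProfile_mem (s : ℝ) : -1 < optimalProfile s ∧ optimalProfile s < 1 := by
  have h := Real.exp_pos (√2 * s)
  have h1 : 2 / (Real.exp (√2 * s) + 1) < 2 := by
    rw [div_lt_iff₀ (by linarith)]; linarith
  have h2 : 0 < 2 / (Real.exp (√2 * s) + 1) := by positivity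
  unfold optimalProfile
  constructor <;> linarith

lemma hasDerivAt_optimalProfile (s : ℝ) :
    HasDerivAt optimalProfile ((1 - optimalProfile s ^ 2) / √2) s := by
  have h := Real.exp_pos (√2 * s)
  have h2 : √2 ^ 2 = 2 := Real.sq_sqrt (by norm_num)
  have h1 : HasDerivAt (fun s => Real.exp (√2 * s) + 1) (Real.exp (√2 * s) * √2) s := by
    have := (((hasDerivAt_id s).const_mul √2).exp).add_const 1
    simpa using this
  have h3 := ((hasDerivAt_const s (2 : ℝ)).div h1 (by positivity)).const_sub 1
  refine h3.congr_deriv ?_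
  unfold optimalProfile
  field_simp
  ring_nf
  rw [h2]
  ring

lemma continuous_optimalProfile : Continuous optimalProfile :=
  continuous_iff_continuousAt.2 fun s => (hasDerivAt_optimalProfile s).continuousAt

lemma tendsto_optimalProfile_atTop : Tendsto optimalProfile atTop (𝓝 1) := by
  have h1 : Tendsto (fun s : ℝ => Real.exp (√2 * s) + 1) atTop atTop :=
    tendsto_atTop_add_const_right _ _ (Real.tendsto_exp_atTop.comp
      (tendsto_id.const_mul_atTop (by positivity)))
  have := ((tendsto_const_nhds (x := (2 : ℝ))).div_atTop h1).const_sub 1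
  rw [sub_zero] at this
  exact this

lemma tendsto_optimalProfile_atBot : Tendsto optimalProfile atBot (𝓝 (-1)) := by
  have h1 : Tendsto (fun s : ℝ => Real.exp (√2 * s) + 1) atBot (𝓝 (0 + 1)) :=
    (Real.tendsto_exp_atBot.comp (tendsto_id.const_mul_atBot (by positivity))).add_const 1
  have := ((tendsto_const_nhds (x := (2 : ℝ))).div h1 (by norm_num)).const_sub 1
  norm_num at this
  exact this

lemma integral_optimalProfile_le (a b : ℝ) :
    ∫ s in a..b, (((1 - optimalProfile s ^ 2) / √2) ^ 2 / 2 + G (optimalProfile s)) ≤ c₀ := by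
  have hd : ∀ s ∈ uIcc a b, HasDerivAt
      (fun s => (optimalProfile s - optimalProfile s ^ 3 / 3) / √2)
      (((1 - optimalProfile s ^ 2) / √2) ^ 2 / 2 + G (optimalProfile s)) s := by
    intro s _
    have h := hasDerivAt_optimalProfile s
    have h1 := (h.sub ((h.pow 3).div_const 3)).div_const √2
    refine h1.congr_deriv ?_
    have h2 : √2 ^ 2 = 2 := Real.sq_sqrt (by norm_num)
    unfold G
    rw [div_pow, h2]
    field_simp
    rw [h2]
    push_cast
    ring
  rw [intervalIntegral.integral_eq_sub_of_hasDerivAt hd, c₀_eq, ← sub_div]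
  · gcongr
    obtain ⟨h1, h2⟩ := optimalProfile_mem a
    obtain ⟨h3, h4⟩ := optimalProfile_mem b
    nlinarith [mul_nonneg (sq_nonneg (1 - optimalProfile b)) (by linarith : 0 ≤ 2 + optimalProfile b),
      mul_nonneg (sq_nonneg (1 + optimalProfile a)) (by linarith : 0 ≤ 2 - optimalProfile a)]
  · have := continuous_optimalProfile
    have h := continuous_G.comp this
    have : Continuous fun s => ((1 - optimalProfile s ^ 2) / √2) ^ 2 / 2 + G (optimalProfile s) := by
      refine Continuous.add ?_ h
      fun_prop
    exact this.intervalIntegrable _ _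

/-- The derivative of the optimal profile is cut off outside a long interval and renormalised, so
that the transition from `-1` to `1` is completed in finite width. -/
lemma exists_profile {ε : ℝ} (hε : 0 < ε) : ∃ (γ γ' : ℝ → ℝ) (S : ℝ), 0 < S ∧
    (∀ s, HasDerivAt γ (γ' s) s) ∧ Continuous γ' ∧ (∀ s, |γ s| ≤ 1) ∧
    (∀ s, s ≤ -S → γ s = -1) ∧ (∀ s, S ≤ s → γ s = 1) ∧ (∀ s, S ≤ |s| → γ' s = 0) ∧
    ∫ s, (γ' s ^ 2 / 2 + G (γ s)) ≤ c₀ + ε := by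
  -- the half-width `S` makes the renormalisation factor close to one
  have hlim : Tendsto (fun S => (2 / (optimalProfile S - optimalProfile (-S))) ^ 4 * c₀) atTop
      (𝓝 c₀) := by
    have h1 := tendsto_optimalProfile_atTop.sub
      (tendsto_optimalProfile_atBot.comp tendsto_neg_atTop_atBot)
    have h2 := (((tendsto_const_nhds (x := (2 : ℝ))).div h1 (by norm_num)).pow 4).mul_const c₀
    norm_num at h2
    exact h2
  obtain ⟨S, hS1, hS2⟩ := ((hlim.eventually_lt_const (lt_add_of_pos_right c₀ hε)).and
    (eventually_gt_atTop 0)).exists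
  set θ' : ℝ → ℝ := fun s => (1 - optimalProfile s ^ 2) / √2 with hθ'
  have hθc : Continuous θ' := by have := continuous_optimalProfile; simp only [hθ']; fun_prop
  have hθ0 : ∀ s, 0 ≤ θ' s := fun s => by
    obtain ⟨h1, h2⟩ := optimalProfile_mem s
    exact div_nonneg (by nlinarith) (by positivity)
  set k : ℝ → ℝ := fun s => max 0 (min 1 (2 - |s| / S)) with hk
  have hkc : Continuous k := by simp only [hk]; fun_prop
  have hk0 : ∀ s, 0 ≤ k s := fun s => le_max_left _ _
  have hk1 : ∀ s, k s ≤ 1 := fun s => max_le zero_le_one (min_le_left _ _)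
  set h : ℝ → ℝ := fun s => θ' s * k s with hh
  have hhc : Continuous h := hθc.mul hkc
  have hh0 : ∀ s, 0 ≤ h s := fun s => mul_nonneg (hθ0 s) (hk0 s)
  have hhθ : ∀ s, h s ≤ θ' s := fun s => mul_le_of_le_one_right (hθ0 s) (hk1 s)
  have hhz : ∀ s, 2 * S ≤ |s| → h s = 0 := fun s hs => by
    have h1 : 2 ≤ |s| / S := by rw [le_div_iff₀ hS2]; exact hs
    have : k s = 0 := by
      simp only [hk]
      exact max_eq_left ((min_le_right _ _).trans (by linarith))
    simp only [hh, this, mul_zero]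
  have hhi : ∀ a b, IntervalIntegrable h volume a b := fun a b => hhc.intervalIntegrable a b
  have hθint : ∀ a b, ∫ s in a..b, θ' s = optimalProfile b - optimalProfile a := fun a b =>
    intervalIntegral.integral_eq_sub_of_hasDerivAt (fun s _ => hasDerivAt_optimalProfile s)
      (hθc.intervalIntegrable a b)
  have hle : ∀ a b, a ≤ b → ∫ s in a..b, h s ≤ optimalProfile b - optimalProfile a := by
    intro a b hab
    rw [← hθint]
    exact intervalIntegral.integral_mono_on hab (hhi a b) (hθc.intervalIntegrable a b)
      fun s _ => hhθ s
  have hnn : ∀ a b, a ≤ b → 0 ≤ ∫ s in a..b, h s := fun a b hab =>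
    intervalIntegral.integral_nonneg hab fun s _ => hh0 s
  have hvan : ∀ a b, a ≤ b → (∀ s ∈ Icc a b, 2 * S ≤ |s|) → ∫ s in a..b, h s = 0 := by
    intro a b hab hs
    refine intervalIntegral.integral_zero_ae (Eventually.of_forall fun s hs' => ?_)
    rw [uIoc_of_le hab] at hs'
    exact hhz s (hs s ⟨hs'.1.le, hs'.2⟩)
  have hadd : ∀ a b c, (∫ s in a..b, h s) + ∫ s in b..c, h s = ∫ s in a..c, h s := fun a b c =>
    intervalIntegral.integral_add_adjacent_intervals (hhi a b) (hhi b c)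
  set I := ∫ s in (-(2 * S))..(2 * S), h s with hI
  have hΔ : 0 < optimalProfile S - optimalProfile (-S) := by
    rw [← hθint]
    refine intervalIntegral.intervalIntegral_pos_of_pos (hθc.intervalIntegrable _ _) (fun s => ?_)
      (by linarith)
    obtain ⟨h1, h2⟩ := optimalProfile_mem s
    exact div_pos (by nlinarith) (by positivity)
  have hIlow : optimalProfile S - optimalProfile (-S) ≤ I := by
    have e : ∫ s in (-S)..S, h s = ∫ s in (-S)..S, θ' s := by
      refine intervalIntegral.integral_congr fun s hs => ?_
      rw [uIcc_of_le (by linarith)] at hs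
      have h1 : |s| / S ≤ 1 := by rw [div_le_one hS2]; exact abs_le.2 hs
      have h2 : k s = 1 := by
        simp only [hk]
        rw [min_eq_left (by linarith), max_eq_right zero_le_one]
      simp only [hh, h2, mul_one]
    rw [← hθint, ← e, hI, ← hadd (-(2 * S)) (-S) (2 * S), ← hadd (-S) S (2 * S)]
    have h1 := hnn (-(2 * S)) (-S) (by linarith)
    have h2 := hnn S (2 * S) (by linarith)
    linarith
  have hIpos : 0 < I := hΔ.trans_le hIlow
  have hIle : I ≤ 2 := by
    have h1 := hle (-(2 * S)) (2 * S) (by linarith)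
    have h2 := (optimalProfile_mem (2 * S)).2
    have h3 := (optimalProfile_mem (-(2 * S))).1
    linarith
  set c := 2 / I with hc
  have hc1 : 1 ≤ c := by rw [hc, one_le_div hIpos]; exact hIle
  have hcI : c * I = 2 := by rw [hc]; field_simp
  set γ : ℝ → ℝ := fun s => -1 + c * ∫ r in (-(2 * S))..s, h r with hγ
  have hγ1 : ∀ s, 1 - γ s = c * ∫ r in s..(2 * S), h r := by
    intro s
    have := hadd (-(2 * S)) s (2 * S)
    simp only [hγ]
    have h2 : c * (∫ r in (-(2 * S))..s, h r) + c * (∫ r in s..(2 * S), h r) = 2 := by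
      rw [← mul_add, this]; exact hcI
    linarith
  have hγlow : ∀ s, s ≤ -(2 * S) → γ s = -1 := by
    intro s hs
    have h1 : ∫ r in (-(2 * S))..s, h r = 0 := by
      rw [intervalIntegral.integral_symm, hvan s _ hs, neg_zero]
      intro r hr
      rw [abs_of_nonpos (by linarith [hr.2])]; linarith [hr.2]
    simp only [hγ, h1]; ring
  have hγup : ∀ s, 2 * S ≤ s → γ s = 1 := by
    intro s hs
    have h1 : ∫ r in s..(2 * S), h r = 0 := by
      rw [intervalIntegral.integral_symm, hvan _ s hs, neg_zero]
      intro r hr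
      rw [abs_of_nonneg (by linarith [hr.1])]; exact hr.1
    have := hγ1 s
    rw [h1] at this
    linarith
  have hγd : ∀ s, HasDerivAt γ (c * h s) s := by
    intro s
    have h1 := intervalIntegral.integral_hasDerivAt_right (hhi (-(2 * S)) s)
      (hhc.stronglyMeasurableAtFilter _ _) hhc.continuousAt
    exact (h1.const_mul c).const_add (-1)
  -- the profile is between the wells, and closer to them than `c` times the optimal one
  have hlower : ∀ s, 0 ≤ 1 + γ s ∧ 0 ≤ 1 - γ s := by
    intro s
    rcases le_total s (-(2 * S)) with h1 | h1
    · rw [hγlow s h1]; norm_num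
    rcases le_total (2 * S) s with h2 | h2
    · rw [hγup s h2]; norm_num
    rw [hγ1]
    have h3 := hnn _ _ h1
    have h4 := hnn _ _ h2
    refine ⟨?_, by positivity⟩
    have : 1 + γ s = c * ∫ r in (-(2 * S))..s, h r := by simp only [hγ]; ring
    rw [this]; positivity
  have hupper : ∀ s ∈ Icc (-(2 * S)) (2 * S), 1 + γ s ≤ c * (1 + optimalProfile s) ∧
      1 - γ s ≤ c * (1 - optimalProfile s) := by
    intro s hs
    constructor
    · have : 1 + γ s = c * ∫ r in (-(2 * S))..s, h r := by simp only [hγ]; ring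
      rw [this]
      gcongr
      linarith [hle _ _ hs.1, (optimalProfile_mem (-(2 * S))).1]
    · rw [hγ1]
      gcongr
      linarith [hle _ _ hs.2, (optimalProfile_mem (2 * S)).2]
  have hpt : ∀ s ∈ Icc (-(2 * S)) (2 * S), (c * h s) ^ 2 / 2 + G (γ s) ≤
      c ^ 4 * (θ' s ^ 2 / 2 + G (optimalProfile s)) := by
    intro s hs
    obtain ⟨u1, u2⟩ := hupper s hs
    obtain ⟨l1, l2⟩ := hlower s
    have hGf : ∀ r, G r = ((1 + r) * (1 - r)) ^ 2 / 4 := fun r => by unfold G; ring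
    have g1 : G (γ s) ≤ c ^ 4 * G (optimalProfile s) := by
      have h1 : (1 + γ s) * (1 - γ s) ≤
          (c * (1 + optimalProfile s)) * (c * (1 - optimalProfile s)) :=
        mul_le_mul u1 u2 l2 (l1.trans u1)
      have h2 := pow_le_pow_left₀ (mul_nonneg l1 l2) h1 2
      rw [hGf, hGf]
      calc _ ≤ (c * (1 + optimalProfile s) * (c * (1 - optimalProfile s))) ^ 2 / 4 := by gcongr
        _ = _ := by ring
    have g2 : (c * h s) ^ 2 ≤ c ^ 4 * θ' s ^ 2 := by
      calc (c * h s) ^ 2 = c ^ 2 * h s ^ 2 := by ring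
        _ ≤ c ^ 4 * θ' s ^ 2 := by
            have := hh0 s
            have := hhθ s
            gcongr
            norm_num
    linarith
  have hcont : Continuous fun s => (c * h s) ^ 2 / 2 + G (γ s) := by
    have hγc : Continuous γ := continuous_iff_continuousAt.2 fun s => (hγd s).continuousAt
    have := continuous_G.comp hγc
    exact (((continuous_const.mul hhc).pow 2).div_const 2).add this
  refine ⟨γ, fun s => c * h s, 2 * S, by linarith, hγd, continuous_const.mul hhc, fun s => ?_,
    hγlow, hγup, fun s hs => by simp only [hhz s hs, mul_zero], ?_⟩
  · obtain ⟨l1, l2⟩ := hlower s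
    exact abs_le.2 ⟨by linarith, by linarith⟩
  · have hsupp : ∀ s, s ∉ Ioc (-(2 * S)) (2 * S) → (c * h s) ^ 2 / 2 + G (γ s) = 0 := by
      intro s hs
      rw [mem_Ioc, not_and_or, not_lt, not_le] at hs
      rcases hs with hs | hs
      · rw [hγlow s hs, hhz s (by rw [abs_of_nonpos (by linarith)]; linarith)]
        norm_num [G]
      · rw [hγup s hs.le, hhz s (by rw [abs_of_nonneg (by linarith)]; linarith)]
        norm_num [G]
    rw [← setIntegral_eq_integral_of_forall_compl_eq_zero hsupp,
      ← intervalIntegral.integral_of_le (by linarith)]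
    calc ∫ s in (-(2 * S))..(2 * S), ((c * h s) ^ 2 / 2 + G (γ s))
        ≤ ∫ s in (-(2 * S))..(2 * S), c ^ 4 * (θ' s ^ 2 / 2 + G (optimalProfile s)) := by
          refine intervalIntegral.integral_mono_on (by linarith) (hcont.intervalIntegrable _ _) ?_
            hpt
          have := continuous_G.comp continuous_optimalProfile
          exact (continuous_const.mul (((hθc.pow 2).div_const 2).add this)).intervalIntegrable _ _
      _ ≤ c ^ 4 * c₀ := by
          rw [intervalIntegral.integral_const_mul]
          gcongr
          exact integral_optimalProfile_le _ _
      _ ≤ (2 / (optimalProfile S - optimalProfile (-S))) ^ 4 * c₀ := by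
          have := c₀_pos
          rw [hc]
          gcongr
      _ ≤ c₀ + ε := hS1.le

/-! ### Phase fields with small energy, by averaging over level sets -/

/-- The substitution `s = (a - t) / b` in the average over levels `t`. -/
lemma setIntegral_comp_sub_div_le {e : ℝ → ℝ} (he0 : ∀ s, 0 ≤ e s) (hei : Integrable e)
    (a τ : ℝ) {b : ℝ} (hb : 0 < b) :
    ∫ t in Icc τ 1, e ((a - t) / b) ≤ b * ∫ s, e s := by
  have h1 : Integrable fun t => e ((a - t) / b) := by
    have := (hei.comp_div hb.ne').comp_sub_left a
    exact this
  calc ∫ t in Icc τ 1, e ((a - t) / b) ≤ ∫ t, e ((a - t) / b) :=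
        setIntegral_le_integral h1 (Eventually.of_forall fun t => he0 _)
    _ = ∫ t, e (t / b) := integral_sub_left_eq_self (fun s => e (s / b)) volume a
    _ = b * ∫ s, e s := by
        rw [Measure.integral_comp_div, abs_of_pos hb, smul_eq_mul]

/-- Averaged over the level `t`, the phase field `γ ((a - t) / b)` differs from the phase `±1` of
the set only for levels between the value `a` and the indicator, up to the layer width. -/
lemma setIntegral_abs_profile_sub_le {γ : ℝ → ℝ} {S : ℝ} (hS : 0 < S) (hγc : Continuous γ)
    (hγ1 : ∀ s, |γ s| ≤ 1) (hlow : ∀ s, s ≤ -S → γ s = -1) (hup : ∀ s, S ≤ s → γ s = 1)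
    {a : ℝ} (ha0 : 0 ≤ a) (ha1 : a ≤ 1) {b τ i : ℝ} (hb : 0 < b) (hτ : 0 ≤ τ)
    (hi : i = 0 ∨ i = 1) :
    ∫ t in Icc τ 1, |γ ((a - t) / b) - (2 * i - 1)| ≤ 2 * (|a - i| + S * b) := by
  have hSb : 0 < S * b := by positivity
  have hbd : ∀ s, |γ s - (2 * i - 1)| ≤ 2 := by
    intro s
    have h1 := abs_le.1 (hγ1 s)
    rw [abs_le]
    rcases hi with rfl | rfl <;> constructor <;> linarith
  have hint : IntegrableOn (fun t => |γ ((a - t) / b) - (2 * i - 1)|) (Icc τ 1) := by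
    have : Continuous fun t => |γ ((a - t) / b) - (2 * i - 1)| := by fun_prop
    exact this.continuousOn.integrableOn_compact isCompact_Icc
  -- outside `J` the integrand vanishes
  have key : ∀ J : Set ℝ, MeasurableSet J → (∀ t ∈ Icc τ 1, t ∉ J →
      γ ((a - t) / b) = 2 * i - 1) → volume.real (Icc τ 1 ∩ J) ≤ |a - i| + S * b →
      ∫ t in Icc τ 1, |γ ((a - t) / b) - (2 * i - 1)| ≤ 2 * (|a - i| + S * b) := by
    intro J hJ hz hvol
    calc ∫ t in Icc τ 1, |γ ((a - t) / b) - (2 * i - 1)|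
        ≤ ∫ t in Icc τ 1, J.indicator (fun _ => (2 : ℝ)) t := by
          refine setIntegral_mono_on hint ((integrable_const _).indicator hJ)
            measurableSet_Icc fun t ht => ?_
          by_cases htJ : t ∈ J
          · rw [indicator_of_mem htJ]; exact hbd _
          · rw [indicator_of_notMem htJ, hz t ht htJ, sub_self, abs_zero]
      _ = volume.real (Icc τ 1 ∩ J) * 2 := by
          rw [setIntegral_indicator hJ, setIntegral_const, smul_eq_mul]
      _ ≤ _ := by linarith
  rcases hi with rfl | rfl
  · refine key (Iic (a + S * b)) measurableSet_Iic (fun t _ ht => ?_) ?_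
    · rw [hlow _ ?_]; · norm_num
      rw [div_le_iff₀ hb]
      have : a + S * b < t := not_le.1 ht
      linarith
    · calc volume.real (Icc τ 1 ∩ Iic (a + S * b)) ≤ volume.real (Icc 0 (a + S * b)) := by
            refine measureReal_mono (fun t ht => ⟨hτ.trans ht.1.1, ht.2⟩) ?_
            simp
        _ = |a - 0| + S * b := by
            rw [Real.volume_real_Icc_of_le (by linarith), sub_zero, sub_zero, abs_of_nonneg ha0]
  · refine key (Ici (a - S * b)) measurableSet_Ici (fun t _ ht => ?_) ?_
    · rw [hup _ ?_]; · norm_num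
      rw [le_div_iff₀ hb]
      have : t < a - S * b := not_le.1 ht
      linarith
    · calc volume.real (Icc τ 1 ∩ Ici (a - S * b)) ≤ volume.real (Icc (a - S * b) 1) := by
            refine measureReal_mono (fun t ht => ⟨ht.2, ht.1.2⟩) ?_
            simp
        _ = |a - 1| + S * b := by
            rw [Real.volume_real_Icc_of_le (by linarith), abs_of_nonpos (by linarith)]
            ring

/-- The phase field obtained from the profile `γ` by rescaling the level `F - t` with the
regularised slope `m`: to first order, `(F - t) / m` is the signed distance to `{F = t}`. -/
noncomputable def levelField (γ : ℝ → ℝ) (F m : 𝔼 → ℝ) (φ t : ℝ) (x : 𝔼) : ℝ :=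
  γ ((F x - t) / (φ * m x))

lemma contDiff_levelField {γ : ℝ → ℝ} (hγ : ContDiff ℝ 1 γ) {F m : 𝔼 → ℝ} (hF : ContDiff ℝ 1 F)
    (hm : ContDiff ℝ 1 m) (hm0 : ∀ x, 0 < m x) {φ : ℝ} (hφ : 0 < φ) (t : ℝ) :
    ContDiff ℝ 1 (levelField γ F m φ t) :=
  hγ.comp ((hF.sub contDiff_const).div (contDiff_const.mul hm) fun x =>
    (mul_pos hφ (hm0 x)).ne')

lemma norm_fderiv_levelField_le {γ γ' : ℝ → ℝ} {S : ℝ} (hS : 0 < S)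
    (hγ : ∀ s, HasDerivAt γ (γ' s) s) (hγ'0 : ∀ s, S ≤ |s| → γ' s = 0) {F m : 𝔼 → ℝ}
    (hF : ContDiff ℝ 1 F) (hm : ContDiff ℝ 1 m) {κ K₀ : ℝ} (hκ : 0 < κ) (hmκ : ∀ x, κ ≤ m x)
    (hFm : ∀ x, ‖fderiv ℝ F x‖ ≤ m x) (hmK : ∀ x, ‖fderiv ℝ m x‖ ≤ K₀)
    {φ : ℝ} (hφ : 0 < φ) (t : ℝ) (x : 𝔼) :
    ‖fderiv ℝ (levelField γ F m φ t) x‖ ≤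
      |γ' ((F x - t) / (φ * m x))| / φ * (1 + φ * S * K₀ / κ) := by
  set z := (F x - t) / (φ * m x) with hz
  have hm0 : 0 < m x := hκ.trans_le (hmκ x)
  have hK0 : 0 ≤ K₀ := (norm_nonneg _).trans (hmK x)
  have hFd := (hF.differentiable one_ne_zero x).hasFDerivAt
  have hmd := (hm.differentiable one_ne_zero x).hasFDerivAt
  have h1 : HasFDerivAt (fun y => (F y - t) / (φ * m y))
      ((1 / (φ * m x)) • (fderiv ℝ F x - (φ * z) • fderiv ℝ m x)) x := by
    have h2 : HasFDerivAt (fun y => (F y - t) * (φ * m y)⁻¹) _ x :=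
      (hFd.sub_const t).mul ((hasDerivAt_inv (mul_pos hφ hm0).ne').comp_hasFDerivAt x
        (hmd.const_mul φ))
    refine HasFDerivAt.congr_fderiv (f' := _) (by simpa only [div_eq_mul_inv] using h2) ?_
    ext v
    simp only [add_apply, smul_apply, smul_eq_mul,
      sub_apply, hz]
    field_simp
    ring
  have h3 : fderiv ℝ (levelField γ F m φ t) x =
      γ' z • ((1 / (φ * m x)) • (fderiv ℝ F x - (φ * z) • fderiv ℝ m x)) :=
    ((hγ z).comp_hasFDerivAt x h1).fderiv
  rw [h3, norm_smul, norm_smul, Real.norm_eq_abs, Real.norm_eq_abs,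
    abs_of_pos (by positivity : 0 < 1 / (φ * m x))]
  rcases le_or_gt S |z| with hSz | hSz
  · rw [hγ'0 z hSz]; simp
  · have h4 : ‖fderiv ℝ F x - (φ * z) • fderiv ℝ m x‖ ≤ m x + φ * S * K₀ := by
      refine (norm_sub_le _ _).trans (add_le_add (hFm x) ?_)
      rw [norm_smul, Real.norm_eq_abs, abs_mul, abs_of_pos hφ]
      gcongr
      exact hmK x
    have h5 : 1 / (φ * m x) * (m x + φ * S * K₀) ≤ 1 / φ * (1 + φ * S * K₀ / κ) := by
      have e : 1 / (φ * m x) * (m x + φ * S * K₀) = 1 / φ * (1 + φ * S * K₀ / m x) := by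
        field_simp
      rw [e]
      have := hmκ x
      gcongr
    calc |γ' z| * (1 / (φ * m x) * ‖fderiv ℝ F x - (φ * z) • fderiv ℝ m x‖)
        ≤ |γ' z| * (1 / φ * (1 + φ * S * K₀ / κ)) := by
          refine mul_le_mul_of_nonneg_left (le_trans ?_ h5) (abs_nonneg _)
          exact mul_le_mul_of_nonneg_left h4 (by positivity)
      _ = _ := by ring

/-- For one of the levels `t`, energy and distance to the set are bounded by their averages over
`t`. By the change of variables `t ↦ (F x - t) / (φ m x)` the averages are explicit. -/
lemma exists_level {γ γ' : ℝ → ℝ} {S : ℝ} (hS : 0 < S)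
    (hγ : ∀ s, HasDerivAt γ (γ' s) s) (hγ'c : Continuous γ') (hγ1 : ∀ s, |γ s| ≤ 1)
    (hlow : ∀ s, s ≤ -S → γ s = -1) (hup : ∀ s, S ≤ s → γ s = 1)
    (hγ'0 : ∀ s, S ≤ |s| → γ' s = 0) {F m : 𝔼 → ℝ}
    (hF : ContDiff ℝ 1 F) (hF0 : ∀ x, 0 ≤ F x) (hF1 : ∀ x, F x ≤ 1)
    (hm : ContDiff ℝ 1 m) {κ K₀ : ℝ} (hκ : 0 < κ) (hmκ : ∀ x, κ ≤ m x)
    (hFm : ∀ x, ‖fderiv ℝ F x‖ ≤ m x) (hmK : ∀ x, ‖fderiv ℝ m x‖ ≤ K₀)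
    {C : Set 𝔼} (hC : MeasurableSet C) {B : Set 𝔼} (hB : IsCompact B) {K : ℝ} (hK : 0 ≤ K)
    {φ : ℝ} (hφ : 0 < φ) {τ : ℝ} (hτ0 : 0 ≤ τ) (hτ1 : τ < 1) :
    ∃ t ∈ Icc τ 1,
      (∫ x in B, (φ / 2 * ‖fderiv ℝ (levelField γ F m φ t) x‖ ^ 2
        + 1 / φ * G (levelField γ F m φ t x)))
      + K * (∫ x in B, |levelField γ F m φ t x - (2 * C.indicator 1 x - 1)|)
      ≤ (1 - τ)⁻¹ * ((1 + φ * S * K₀ / κ) ^ 2 * (∫ s, (γ' s ^ 2 / 2 + G (γ s))) * (∫ x in B, m x)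
        + 2 * K * ((∫ x in B, |F x - C.indicator 1 x|) + S * φ * ∫ x in B, m x)) := by
  have hm0 : ∀ x, 0 < m x := fun x => hκ.trans_le (hmκ x)
  have hγc : Continuous γ := continuous_iff_continuousAt.2 fun s => (hγ s).continuousAt
  have hγd : ContDiff ℝ 1 γ := by
    rw [contDiff_one_iff_deriv]
    refine ⟨fun s => (hγ s).differentiableAt, ?_⟩
    have : deriv γ = γ' := funext fun s => (hγ s).deriv
    rwa [this]
  set e : ℝ → ℝ := fun s => γ' s ^ 2 / 2 + G (γ s) with he
  have hec : Continuous e := ((hγ'c.pow 2).div_const 2).add (continuous_G.comp hγc)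
  have he0 : ∀ s, 0 ≤ e s := fun s => add_nonneg (by positivity) (G_nonneg _)
  have hes : HasCompactSupport e := by
    refine HasCompactSupport.intro (isCompact_Icc (a := -S) (b := S)) fun s hs => ?_
    rw [mem_Icc, not_and_or, not_le, not_le] at hs
    simp only [he]
    rcases hs with hs | hs
    · rw [hlow s hs.le, hγ'0 s (by rw [abs_of_nonpos (by linarith)]; linarith)]; norm_num [G]
    · rw [hup s hs.le, hγ'0 s (by rw [abs_of_nonneg (by linarith)]; linarith)]; norm_num [G]
  have hei : Integrable e := hec.integrable_of_hasCompactSupport hes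
  obtain ⟨Me, hMe⟩ := hes.exists_bound_of_continuous hec
  set β := (1 + φ * S * K₀ / κ) ^ 2 with hβ
  have hK₀ : 0 ≤ K₀ := (norm_nonneg _).trans (hmK 0)
  have hβ1 : 1 ≤ β := by
    have h1 : 0 ≤ φ * S * K₀ / κ := by positivity
    exact one_le_pow₀ (by linarith)
  set i : 𝔼 → ℝ := C.indicator 1 with hi
  have him : Measurable i := measurable_one.indicator hC
  have hi01 : ∀ x, i x = 0 ∨ i x = 1 := fun x => by
    by_cases hx : x ∈ C <;> simp [hi, hx]
  have hBfin : volume B < ⊤ := hB.measure_lt_top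
  have : IsFiniteMeasure (volume.restrict B) := ⟨by simpa using hBfin⟩
  have hmi : IntegrableOn m B := hm.continuous.continuousOn.integrableOn_compact hB
  have hFii : IntegrableOn (fun x => |F x - i x|) B := by
    refine Integrable.of_bound (hF.continuous.measurable.sub him).norm.aestronglyMeasurable 1
      (Eventually.of_forall fun x => ?_)
    rw [Real.norm_eq_abs, abs_abs, abs_le]
    rcases hi01 x with h | h <;> rw [h] <;> constructor <;> linarith [hF0 x, hF1 x]
  -- the joint density in the level and the point
  set z : ℝ × 𝔼 → ℝ := fun q => (F q.2 - q.1) / (φ * m q.2) with hz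
  have hzc : Continuous z :=
    ((hF.continuous.comp continuous_snd).sub continuous_fst).div
      (continuous_const.mul (hm.continuous.comp continuous_snd))
      fun q => (mul_pos hφ (hm0 _)).ne'
  set H₁ : ℝ × 𝔼 → ℝ := fun q => β / φ * e (z q) with hH₁
  set H₂ : ℝ × 𝔼 → ℝ := fun q => |γ (z q) - (2 * i q.2 - 1)| with hH₂
  have hγi : ∀ s x, |γ s - (2 * i x - 1)| ≤ 2 := by
    intro s x
    have h1 := abs_le.1 (hγ1 s)
    rw [abs_le]
    rcases hi01 x with h | h <;> rw [h] <;> constructor <;> linarith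
  have hH₁i : Integrable H₁ ((volume.restrict (Icc τ 1)).prod (volume.restrict B)) := by
    refine Integrable.of_bound (continuous_const.mul (hec.comp hzc)).aestronglyMeasurable
      (β / φ * Me) (Eventually.of_forall fun q => ?_)
    rw [norm_mul, Real.norm_eq_abs, abs_of_nonneg (by positivity)]
    gcongr
    exact hMe _
  have hH₂i : Integrable H₂ ((volume.restrict (Icc τ 1)).prod (volume.restrict B)) := by
    refine Integrable.of_bound (((hγc.comp hzc).measurable.sub
      (((him.comp measurable_snd).const_mul 2).sub_const 1)).norm.aestronglyMeasurable) 2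
      (Eventually.of_forall fun q => ?_)
    rw [Real.norm_eq_abs, abs_abs]
    exact hγi _ _
  have hHi : Integrable (fun q => H₁ q + K * H₂ q)
      ((volume.restrict (Icc τ 1)).prod (volume.restrict B)) := hH₁i.add (hH₂i.const_mul K)
  obtain ⟨t, ht, htle⟩ := exists_le_setAverage (μ := volume) (s := Icc τ 1)
    (f := fun t => ∫ x in B, (H₁ (t, x) + K * H₂ (t, x))) (by simp [hτ1]) (by simp)
    hHi.integral_prod_left
  refine ⟨t, ht, ?_⟩
  -- the average
  have hcγ : 0 ≤ ∫ s, e s := integral_nonneg he0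
  have hptx : ∀ x, ∫ t in Icc τ 1, (H₁ (t, x) + K * H₂ (t, x)) ≤
      β * (∫ s, e s) * m x + 2 * K * (|F x - i x| + S * φ * m x) := by
    intro x
    have hb : 0 < φ * m x := mul_pos hφ (hm0 x)
    have i1 : IntegrableOn (fun t => H₁ (t, x)) (Icc τ 1) :=
      ((continuous_const.mul (hec.comp hzc)).comp
        (Continuous.prodMk_left x)).continuousOn.integrableOn_compact isCompact_Icc
    have i2 : IntegrableOn (fun t => H₂ (t, x)) (Icc τ 1) :=
      ((((hγc.comp hzc).comp (Continuous.prodMk_left x)).sub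
        (continuous_const (y := 2 * i x - 1))).abs).continuousOn.integrableOn_compact isCompact_Icc
    rw [integral_add i1 (i2.const_mul K), integral_const_mul K fun t => H₂ (t, x)]
    have h1 : ∫ t in Icc τ 1, H₁ (t, x) ≤ β * (∫ s, e s) * m x := by
      simp only [hH₁, hz]
      rw [integral_const_mul]
      calc β / φ * ∫ t in Icc τ 1, e ((F x - t) / (φ * m x))
          ≤ β / φ * (φ * m x * ∫ s, e s) := by
            gcongr
            exact setIntegral_comp_sub_div_le he0 hei (F x) τ hb
        _ = _ := by field_simp
    have h2 : ∫ t in Icc τ 1, H₂ (t, x) ≤ 2 * (|F x - i x| + S * (φ * m x)) :=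
      setIntegral_abs_profile_sub_le hS hγc hγ1 hlow hup (hF0 x) (hF1 x) hb hτ0 (hi01 x)
    have h3 := mul_le_mul_of_nonneg_left h2 hK
    linarith
  have havg : ⨍ t in Icc τ 1, ∫ x in B, (H₁ (t, x) + K * H₂ (t, x)) ≤
      (1 - τ)⁻¹ * (β * (∫ s, e s) * (∫ x in B, m x)
        + 2 * K * ((∫ x in B, |F x - i x|) + S * φ * ∫ x in B, m x)) := by
    rw [setAverage_eq, Real.volume_real_Icc_of_le hτ1.le, smul_eq_mul]
    have hτ' : 0 ≤ (1 - τ)⁻¹ := inv_nonneg.2 (by linarith)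
    refine mul_le_mul_of_nonneg_left ?_ hτ'
    rw [integral_integral_swap hHi]
    have hri : IntegrableOn (fun x => β * (∫ s, e s) * m x
        + 2 * K * (|F x - i x| + S * φ * m x)) B :=
      (hmi.const_mul _).add ((hFii.add (hmi.const_mul _)).const_mul _)
    calc ∫ x in B, ∫ t in Icc τ 1, (H₁ (t, x) + K * H₂ (t, x))
        ≤ ∫ x in B, (β * (∫ s, e s) * m x + 2 * K * (|F x - i x| + S * φ * m x)) :=
          integral_mono hHi.integral_prod_right hri hptx
      _ = _ := by
          have hri2 : IntegrableOn (fun x => |F x - i x| + S * φ * m x) B :=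
            hFii.add (hmi.const_mul _)
          rw [integral_add (hmi.const_mul _) (hri2.const_mul _),
            integral_const_mul, integral_const_mul, integral_add hFii (hmi.const_mul _),
            integral_const_mul]
  refine le_trans ?_ (htle.trans havg)
  -- the energy density is below the joint density
  have hwd : ContDiff ℝ 1 (levelField γ F m φ t) :=
    contDiff_levelField hγd hF hm hm0 hφ t
  have hEc : Continuous fun x => φ / 2 * ‖fderiv ℝ (levelField γ F m φ t) x‖ ^ 2
      + 1 / φ * G (levelField γ F m φ t x) :=
    (continuous_const.mul ((hwd.continuous_fderiv one_ne_zero).norm.pow 2)).add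
      (continuous_const.mul (continuous_G.comp hwd.continuous))
  have i1 : IntegrableOn (fun x => H₁ (t, x)) B :=
    ((continuous_const.mul (hec.comp hzc)).comp
      (Continuous.prodMk_right t)).continuousOn.integrableOn_compact hB
  have i2 : IntegrableOn (fun x => H₂ (t, x)) B := by
    refine Integrable.of_bound ((((hγc.comp hzc).comp
      (Continuous.prodMk_right t)).measurable.sub
      ((him.const_mul 2).sub_const 1)).norm.aestronglyMeasurable) 2
      (Eventually.of_forall fun x => ?_)
    rw [Real.norm_eq_abs, abs_abs]
    exact hγi _ _
  rw [integral_add i1 (i2.const_mul K), integral_const_mul K fun x => H₂ (t, x)]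
  refine add_le_add ?_ le_rfl
  refine integral_mono (hEc.continuousOn.integrableOn_compact hB) i1 fun x => ?_
  have h1 := norm_fderiv_levelField_le hS hγ hγ'0 hF hm hκ hmκ hFm hmK hφ t x
  have h2 := pow_le_pow_left₀ (norm_nonneg _) h1 2
  have h3 : 0 ≤ G (γ (z (t, x))) := G_nonneg _
  calc φ / 2 * ‖fderiv ℝ (levelField γ F m φ t) x‖ ^ 2 + 1 / φ * G (levelField γ F m φ t x)
      ≤ φ / 2 * (|γ' (z (t, x))| / φ * (1 + φ * S * K₀ / κ)) ^ 2 + 1 / φ * G (γ (z (t, x))) := by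
        refine add_le_add ?_ le_rfl
        gcongr
    _ = β / φ * (γ' (z (t, x)) ^ 2 / 2) + 1 / φ * G (γ (z (t, x))) := by
        rw [mul_pow, div_pow, sq_abs, ← hβ]
        field_simp
    _ ≤ β / φ * (γ' (z (t, x)) ^ 2 / 2) + β / φ * G (γ (z (t, x))) := by gcongr
    _ = H₁ (t, x) := by simp only [hH₁, he]; ring

/-- For all small widths `φ`, a set of finite perimeter has a `C¹` phase field, equal to `-1`
outside a fixed ball, which is close in `L¹` and almost optimal in energy. -/
lemma exists_phaseField {C : Set 𝔼} (hC : MeasurableSet C) (hCv : volume C < ⊤)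
    (hP : perimeter C < ⊤) {ε : ℝ} (hε : 0 < ε) :
    ∃ R : ℝ, 0 < R ∧ ∀ᶠ φ in 𝓝[>] (0 : ℝ), ∃ w : 𝔼 → ℝ, ContDiff ℝ 1 w ∧ (∀ x, |w x| ≤ 1) ∧
      (∀ x, R < ‖x‖ → w x = -1) ∧
      ∫ x, (φ / 2 * ‖fderiv ℝ w x‖ ^ 2 + 1 / φ * G (w x)) ≤ c₀ * (perimeter C).toReal + ε ∧
      ∫ x, |w x - (2 * C.indicator 1 x - 1)| ≤ ε := by
  wlog hε1 : ε ≤ 1 generalizing ε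
  · obtain ⟨R, hR, h⟩ := this one_pos le_rfl
    refine ⟨R, hR, h.mono fun φ ⟨w, h1, h2, h3, h4, h5⟩ => ⟨w, h1, h2, h3, ?_, ?_⟩⟩ <;> linarith
  set P := (perimeter C).toReal with hPdef
  have hP0 : 0 ≤ P := ENNReal.toReal_nonneg
  have hc := c₀_pos
  set ε₂ := ε / (4 * (P + 1)) with hε₂
  have hε₂0 : 0 < ε₂ := by positivity
  have e2 : ε₂ * P ≤ ε / 4 := by
    rw [hε₂, div_mul_eq_mul_div, div_le_div_iff₀ (by positivity) (by norm_num)]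
    nlinarith
  set K := (c₀ * P + 1) / ε with hKdef
  have hK : 0 < K := by positivity
  set ε₁ := ε / (4 * (c₀ + ε₂ + 2 * K)) with hε₁
  have hε₁0 : 0 < ε₁ := by positivity
  have e1 : (c₀ + ε₂) * ε₁ + 2 * K * ε₁ = ε / 4 := by
    rw [hε₁]; field_simp
  obtain ⟨F, hF, hF', hF0, hF1, hFi, hFε, hFP⟩ := exists_smooth_approx hC hCv hP hε₁0
  obtain ⟨γ, γ', S, hS, hγ, hγ'c, hγ1, hlow, hup, hγ'0, hγε⟩ := exists_profile hε₂0
  obtain ⟨R₀, hR₀⟩ := hF'.isCompact.isBounded.subset_closedBall 0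
  set R := max R₀ 1 with hRdef
  have hR : 0 < R := lt_max_of_lt_right one_pos
  set B := Metric.closedBall (0 : 𝔼) R with hBdef
  have hFB : tsupport F ⊆ B := hR₀.trans (Metric.closedBall_subset_closedBall (le_max_left _ _))
  have hB : IsCompact B := isCompact_closedBall _ _
  have hBm : MeasurableSet B := hB.measurableSet
  set κ := ε / (8 * ((c₀ + ε₂) * (volume.real B + 1))) with hκdef
  have hκ : 0 < κ := by positivity
  have e3 : (c₀ + ε₂) * (κ * volume.real B) ≤ ε / 8 := by
    have h0 : 0 ≤ volume.real B := measureReal_nonneg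
    have : (c₀ + ε₂) * (κ * (volume.real B + 1)) = ε / 8 := by rw [hκdef]; field_simp
    have h2 : κ * volume.real B ≤ κ * (volume.real B + 1) := by gcongr; linarith
    calc _ ≤ (c₀ + ε₂) * (κ * (volume.real B + 1)) := by gcongr
      _ = _ := this
  set m := regularizedSlope F κ with hm
  have hms := contDiff_regularizedSlope hF hκ
  obtain ⟨K₀, hK₀⟩ := exists_norm_fderiv_regularizedSlope_le hF hF' hκ
  set i : 𝔼 → ℝ := C.indicator 1 with hi
  have hii : Integrable i := (integrable_indicator_iff hC).2 (integrableOn_const hCv.ne)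
  have hi0 : ∀ x, 0 ≤ i x := fun x => indicator_nonneg (fun _ _ => zero_le_one) x
  set cγ := ∫ s, (γ' s ^ 2 / 2 + G (γ s)) with hcγ
  have hcγ0 : 0 ≤ cγ := integral_nonneg fun s => add_nonneg (by positivity) (G_nonneg _)
  set Im := ∫ x in B, m x with hIm
  set IF := ∫ x in B, |F x - i x| with hIF
  set J := ∫ x in Bᶜ, i x with hJ
  have hdFi : Integrable fun x => ‖fderiv ℝ F x‖ :=
    ((hF.continuous_fderiv (by simp)).integrable_of_hasCompactSupport (hF'.fderiv ℝ)).norm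
  have hImle : Im ≤ P + ε₁ + κ * volume.real B := by
    calc Im ≤ ∫ x in B, (‖fderiv ℝ F x‖ + κ) :=
          setIntegral_mono (hms.continuous.continuousOn.integrableOn_compact hB)
            (hdFi.integrableOn.add (integrableOn_const hB.measure_lt_top.ne))
            fun x => regularizedSlope_le hκ x
      _ = (∫ x in B, ‖fderiv ℝ F x‖) + κ * volume.real B := by
          rw [integral_add hdFi.integrableOn (integrableOn_const hB.measure_lt_top.ne),
            setIntegral_const, smul_eq_mul, mul_comm κ]
      _ ≤ P + ε₁ + κ * volume.real B := by
          have := setIntegral_le_integral (s := B) hdFi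
            (Eventually.of_forall fun x => norm_nonneg _)
          linarith
  have hIm0 : 0 ≤ Im := setIntegral_nonneg hBm fun x _ => hκ.le.trans (le_regularizedSlope F κ x)
  have hIFJ : IF + J = ∫ x, |F x - i x| := by
    rw [← integral_add_compl hBm hFi]
    congr 1
    refine setIntegral_congr_fun hBm.compl fun x hx => ?_
    have h0 : F x = 0 := image_eq_zero_of_notMem_tsupport fun h => hx (hFB h)
    simp only [h0, zero_sub, abs_neg]
    rw [abs_of_nonneg (hi0 x)]
  -- the bound for the chosen level converges as `φ → 0`
  set b : ℝ → ℝ := fun φ => (1 - S * φ * κ)⁻¹ * ((1 + φ * S * K₀ / κ) ^ 2 * cγ * Im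
    + 2 * K * (IF + S * φ * Im)) + K * (2 * J) with hb
  have hblim : Tendsto b (𝓝[>] 0) (𝓝 (cγ * Im + 2 * K * IF + K * (2 * J))) := by
    have hc : ContinuousAt b 0 := by
      refine ContinuousAt.add (ContinuousAt.mul (ContinuousAt.inv₀ (by fun_prop) (by simp))
        (by fun_prop)) continuousAt_const
    have := hc.tendsto.mono_left (nhdsWithin_le_nhds (s := Ioi (0 : ℝ)))
    simpa [hb] using this
  have hlt : cγ * Im + 2 * K * IF + K * (2 * J) < c₀ * P + ε := by
    have h1 : cγ * Im ≤ (c₀ + ε₂) * (P + ε₁ + κ * volume.real B) :=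
      mul_le_mul hγε hImle hIm0 (by positivity)
    have h2 : 2 * K * (IF + J) ≤ 2 * K * ε₁ := by rw [hIFJ]; gcongr
    nlinarith
  have hτ : Tendsto (fun φ : ℝ => S * φ * κ) (𝓝[>] 0) (𝓝 0) := by
    have hc : Continuous fun φ : ℝ => S * φ * κ := by fun_prop
    have := (hc.tendsto 0).mono_left (nhdsWithin_le_nhds (s := Ioi (0 : ℝ)))
    simpa using this
  refine ⟨R, hR, ?_⟩
  filter_upwards [hblim.eventually_lt_const hlt, hτ.eventually_lt_const one_pos,
    self_mem_nhdsWithin] with φ hbφ hτφ hφ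
  have hφ : 0 < φ := hφ
  obtain ⟨t, ht, htle⟩ := exists_level hS hγ hγ'c hγ1 hlow hup hγ'0
    (hF.of_le (by exact_mod_cast le_top)) hF0 hF1 (hms.of_le (by exact_mod_cast le_top)) hκ
    (le_regularizedSlope F κ) (norm_fderiv_le_regularizedSlope F κ) hK₀ hC hB hK.le hφ
    (by positivity : 0 ≤ S * φ * κ) hτφ
  set w := levelField γ F m φ t with hw
  have hγd : ContDiff ℝ 1 γ := by
    rw [contDiff_one_iff_deriv]
    refine ⟨fun s => (hγ s).differentiableAt, ?_⟩
    have : deriv γ = γ' := funext fun s => (hγ s).deriv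
    rwa [this]
  have hwd : ContDiff ℝ 1 w := contDiff_levelField hγd (hF.of_le (by exact_mod_cast le_top))
    (hms.of_le (by exact_mod_cast le_top)) (fun x => hκ.trans_le (le_regularizedSlope F κ x)) hφ t
  have hwB : ∀ x, x ∉ B → w x = -1 := by
    intro x hx
    have hx' : x ∉ tsupport F := fun h => hx (hFB h)
    have h0 : F x = 0 := image_eq_zero_of_notMem_tsupport hx'
    simp only [hw, levelField, hm, h0, regularizedSlope_eq hκ hx']
    refine hlow _ ?_
    rw [div_le_iff₀ (by positivity)]
    nlinarith [ht.1]
  have hdwB : ∀ x, x ∉ B → fderiv ℝ w x = 0 := by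
    intro x hx
    have h1 : w =ᶠ[𝓝 x] fun _ => -1 := by
      filter_upwards [Metric.isClosed_closedBall.isOpen_compl.mem_nhds hx] with y hy
      exact hwB y hy
    rw [h1.fderiv_eq, fderiv_const_apply]
  have hE : ∫ x in B, (φ / 2 * ‖fderiv ℝ w x‖ ^ 2 + 1 / φ * G (w x))
      = ∫ x, (φ / 2 * ‖fderiv ℝ w x‖ ^ 2 + 1 / φ * G (w x)) := by
    refine setIntegral_eq_integral_of_forall_compl_eq_zero fun x hx => ?_
    rw [hdwB x hx, hwB x hx]
    norm_num [G]
  have hwi : Integrable fun x => w x + 1 := by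
    refine (hwd.continuous.add continuous_const).integrable_of_hasCompactSupport ?_
    exact HasCompactSupport.intro hB fun x hx => by simp [hwB x hx]
  have hDi : Integrable fun x => |w x - (2 * i x - 1)| := by
    refine (hwi.sub (hii.const_mul 2)).abs.congr (Eventually.of_forall fun x => ?_)
    simp only [Pi.sub_apply]
    congr 1; ring
  have hD : ∫ x, |w x - (2 * i x - 1)| = (∫ x in B, |w x - (2 * i x - 1)|) + 2 * J := by
    rw [← integral_add_compl hBm hDi, ← integral_const_mul]
    congr 1
    refine setIntegral_congr_fun hBm.compl fun x hx => ?_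
    simp only [hwB x hx]
    rw [show (-1 : ℝ) - (2 * i x - 1) = -(2 * i x) by ring, abs_neg, abs_of_nonneg]
    linarith [hi0 x]
  rw [hE] at htle
  have hE0 : 0 ≤ ∫ x, (φ / 2 * ‖fderiv ℝ w x‖ ^ 2 + 1 / φ * G (w x)) :=
    integral_nonneg fun x => add_nonneg (by positivity)
      (mul_nonneg (by positivity) (G_nonneg _))
  have hD0 : 0 ≤ ∫ x, |w x - (2 * i x - 1)| := integral_nonneg fun x => abs_nonneg _
  have htot : (∫ x, (φ / 2 * ‖fderiv ℝ w x‖ ^ 2 + 1 / φ * G (w x)))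
      + K * (∫ x, |w x - (2 * i x - 1)|) < c₀ * P + ε := by
    refine lt_of_le_of_lt ?_ hbφ
    rw [hD, mul_add, ← add_assoc]
    simp only [hb]
    exact add_le_add htle le_rfl
  refine ⟨w, hwd, fun x => hγ1 _, fun x hx => hwB x (by simpa [hBdef] using hx), ?_, ?_⟩
  · have := mul_nonneg hK.le hD0
    linarith
  · have h1 : K * (∫ x, |w x - (2 * i x - 1)|) ≤ c₀ * P + 1 := by linarith
    rw [hKdef, div_mul_eq_mul_div, div_le_iff₀ hε] at h1
    have h2 : 0 < c₀ * P + 1 := by positivity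
    exact le_of_mul_le_mul_left h1 h2

/-! ### Restoring the mass constraint -/

/-- A shift of a phase by `θ` costs a small multiple of its potential and a term of order `θ ^ 2`;
there is no linear term, as `|G'| ≤ 2 √G` on `[-1, 1]`. -/
lemma G_add_le {w θ lam : ℝ} (hw : |w| ≤ 1) (hθ : |θ| ≤ 1) (hlam : 0 < lam) :
    G (w + θ) ≤ (1 + lam) * G w + 9 / 4 * (1 + 1 / lam) * θ ^ 2 := by
  set r := w + w + θ with hr
  have hr3 : |r| ≤ 3 := by
    have := abs_le.1 hw
    have := abs_le.1 hθ
    rw [abs_le]; constructor <;> simp only [hr] <;> linarith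
  have hr9 : r ^ 2 ≤ 9 := by rw [← sq_abs]; nlinarith [abs_nonneg r]
  have e : G (w + θ) = ((1 - w ^ 2) - θ * r) ^ 2 / 4 := by unfold G; simp only [hr]; ring
  have h1 : ((1 - w ^ 2) - θ * r) ^ 2 ≤
      (1 + lam) * (1 - w ^ 2) ^ 2 + (1 + 1 / lam) * (θ * r) ^ 2 := by
    have h2 : (1 + lam) * (1 - w ^ 2) ^ 2 + (1 + 1 / lam) * (θ * r) ^ 2
        - ((1 - w ^ 2) - θ * r) ^ 2 = (lam * (1 - w ^ 2) + θ * r) ^ 2 / lam := by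
      field_simp; ring
    have h3 : 0 ≤ (lam * (1 - w ^ 2) + θ * r) ^ 2 / lam := by positivity
    linarith
  have h4 : (θ * r) ^ 2 ≤ 9 * θ ^ 2 := by
    rw [mul_pow]; nlinarith [sq_nonneg θ]
  have h5 : (1 + 1 / lam) * (θ * r) ^ 2 ≤ (1 + 1 / lam) * (9 * θ ^ 2) := by gcongr
  rw [e]
  unfold G
  linarith

/-- A `C¹` function has its classical gradient as weak gradient. -/
lemma hasWeakGradient_of_contDiff {U : Set 𝔼} {w : 𝔼 → ℝ} (hw : ContDiff ℝ 1 w)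
    {u : 𝔼 → ℝ} (hu : u =ᵐ[volume.restrict U] w) : HasWeakGradient U u (gradient w) := by
  have hg : Continuous (gradient w) :=
    (InnerProductSpace.toDual ℝ 𝔼).symm.continuous.comp (hw.continuous_fderiv one_ne_zero)
  refine ⟨?_, (hg.locallyIntegrable (μ := volume)).locallyIntegrableOn U, fun η hη hη' hηU i => ?_⟩
  · intro x hx
    obtain ⟨t, ht, ht'⟩ :=
      (hw.continuous.locallyIntegrable (μ := volume)).locallyIntegrableOn U x hx
    refine ⟨t ∩ U, inter_mem ht self_mem_nhdsWithin, ?_⟩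
    refine (ht'.mono_set inter_subset_left).congr ?_
    have h1 : u =ᵐ[volume.restrict (t ∩ U)] w :=
      ae_restrict_of_ae_restrict_of_subset inter_subset_right hu
    exact h1.symm
  · have hη1 : ContDiff ℝ 1 η := hη.of_le (by exact_mod_cast le_top)
    have hdη : ∀ x, x ∉ U → fderiv ℝ η x = 0 := by
      intro x hx
      by_contra h0
      exact hx (hηU (support_fderiv_subset ℝ h0))
    have hη0 : ∀ x, x ∉ U → η x = 0 := fun x hx =>
      image_eq_zero_of_notMem_tsupport fun h => hx (hηU h)
    have hdw := hw.continuous_fderiv one_ne_zero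
    have hdη' := hη1.continuous_fderiv one_ne_zero
    have e1 : ∫ x in U, u x * fderiv ℝ η x (EuclideanSpace.single i 1)
        = ∫ x, w x * fderiv ℝ η x (EuclideanSpace.single i 1) := by
      rw [← setIntegral_eq_integral_of_forall_compl_eq_zero (s := U)
        (f := fun x => w x * fderiv ℝ η x (EuclideanSpace.single i 1))
        fun x hx => by simp [hdη x hx]]
      refine integral_congr_ae ?_
      filter_upwards [hu] with x hx
      rw [hx]
    have e2 : ∫ x in U, gradient w x i * η x
        = ∫ x, fderiv ℝ w x (EuclideanSpace.single i 1) * η x := by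
      rw [← setIntegral_eq_integral_of_forall_compl_eq_zero (s := U)
        (f := fun x => fderiv ℝ w x (EuclideanSpace.single i 1) * η x)
        fun x hx => by simp [hη0 x hx]]
      congr 1
      ext x
      rw [fderiv_apply_eq_inner_gradient, EuclideanSpace.inner_single_right]
      simp
    rw [e1, e2]
    refine integral_mul_fderiv_eq_neg_fderiv_mul_of_integrable ?_ ?_ ?_
      (fun x _ => hw.differentiable one_ne_zero x) fun x _ => hη1.differentiable one_ne_zero x
    · exact ((hdw.clm_apply continuous_const).mul hη.continuous).integrable_of_hasCompactSupport
        hη'.mul_left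
    · exact (hw.continuous.mul (hdη'.clm_apply continuous_const)).integrable_of_hasCompactSupport
        (HasCompactSupport.mul_left (hη'.fderiv_apply ℝ _))
    · exact (hw.continuous.mul hη.continuous).integrable_of_hasCompactSupport hη'.mul_left

/-- The phase field `w` raised on the cube by the constant `θ` that fixes the mean, and set to
`-1` outside; as an excess over `-1`. -/
noncomputable def trialExcess (φ L θ : ℝ) (w : 𝔼 → ℝ) : 𝔼 → ℝ :=
  (cube d φ L).indicator fun x => w x + 1 + θ

/-- Energy of the mass-corrected phase field: the constant `θ` costs the background energy
`(a - A)² / a`, where `a = φ |Ω|` is the total mass and `A` that of the phase field, up to errors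
of higher order on the ball of radius `R`. -/
lemma energyGap_trial_le {φ L : ℝ} (hφ : 0 < φ) (hL : 0 < L) {w : 𝔼 → ℝ} (hw : ContDiff ℝ 1 w)
    (hw1 : ∀ x, |w x| ≤ 1) {R : ℝ} (hR : R < φ * L / 2) (hwR : ∀ x, R < ‖x‖ → w x = -1)
    {A a θ : ℝ} (hA : A = ∫ x, (w x + 1)) (ha : a = φ * (φ * L) ^ d)
    (hθ : θ = φ * (a - A) / a) (hθ1 : |θ| ≤ 1) {lam : ℝ} (hlam : 0 < lam) {v : 𝔼 → ℝ}
    (hv : v =ᵐ[volume] trialExcess φ L θ w) :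
    energyGap φ L (fun x => -1 + v x) ≤
      (((1 + lam) * (∫ x, (φ / 2 * ‖fderiv ℝ w x‖ ^ 2 + 1 / φ * G (w x)))
        + (a - A) ^ 2 / a * (1 - θ / 2) ^ 2 - a * (1 - φ / 2) ^ 2
        + 1 / φ * (9 / 4 * (1 + 1 / lam) * θ ^ 2 * volume.real (Metric.closedBall (0 : 𝔼) R)) : ℝ)
        : EReal) := by
  have hφL : 0 ≤ φ * L := by positivity
  set Q := cube d φ L with hQdef
  set U := interior Q with hUdef
  set B := Metric.closedBall (0 : 𝔼) R with hBdef
  have hUo : IsOpen U := isOpen_interior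
  have hBU : B ⊆ U := closedBall_subset_interior_cube hR
  have hBQ : B ⊆ Q := hBU.trans interior_subset
  have hB : IsCompact B := isCompact_closedBall _ _
  have hQm : MeasurableSet Q := (isClosed_cube φ L).measurableSet
  have hQfin : volume Q < ⊤ := volume_cube_lt_top hφL
  have hQr : volume.real Q = (φ * L) ^ d := volume_real_cube hφL
  have : IsFiniteMeasure (volume.restrict Q) := ⟨by simpa using hQfin⟩
  have hwB : ∀ x, x ∉ B → w x = -1 := fun x hx => hwR x (by simpa [hBdef] using hx)
  have hdwB : ∀ x, x ∉ B → fderiv ℝ w x = 0 := by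
    intro x hx
    have h1 : w =ᶠ[𝓝 x] fun _ => -1 := by
      filter_upwards [Metric.isClosed_closedBall.isOpen_compl.mem_nhds hx] with y hy
      exact hwB y hy
    rw [h1.fderiv_eq, fderiv_const_apply]
  have huQ : (fun x => -1 + v x) =ᵐ[volume.restrict Q] fun x => w x + θ := by
    refine (ae_restrict_iff' hQm).2 ?_
    filter_upwards [hv] with x hx hxQ
    rw [hx, trialExcess, indicator_of_mem hxQ]
    ring
  have huU : (fun x => -1 + v x) =ᵐ[volume.restrict U] fun x => w x + θ :=
    ae_restrict_of_ae_restrict_of_subset interior_subset huQ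
  have hwθ : ContDiff ℝ 1 fun x => w x + θ := hw.add contDiff_const
  have hweak : HasWeakGradient U (fun x => -1 + v x) (gradient fun x => w x + θ) :=
    hasWeakGradient_of_contDiff hwθ huU
  have hgn : ∀ x, ‖gradient (fun x => w x + θ) x‖ = ‖fderiv ℝ w x‖ := by
    intro x; rw [norm_gradient, fderiv_add_const]
  have hdwc : Continuous fun x => ‖fderiv ℝ w x‖ := (hw.continuous_fderiv one_ne_zero).norm
  have hdws : HasCompactSupport fun x => ‖fderiv ℝ w x‖ :=
    HasCompactSupport.intro hB fun x hx => by rw [hdwB x hx, norm_zero]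
  obtain ⟨M, hM⟩ := hdws.exists_bound_of_continuous hdwc
  have hbound : ∀ q : ℝ≥0∞, MemLp (fun x => -1 + v x) q (volume.restrict Q) := by
    intro q
    refine (memLp_congr_ae huQ).2 ?_
    refine MemLp.of_bound hwθ.continuous.aestronglyMeasurable 2 (Eventually.of_forall fun x => ?_)
    have := norm_add_le (w x) θ
    have h1 := hw1 x
    rw [Real.norm_eq_abs] at this ⊢
    rw [Real.norm_eq_abs, Real.norm_eq_abs] at this
    linarith
  have hUQ : volume.restrict U = volume.restrict Q := restrict_interior_cube φ L
  have hg2 : MemLp (gradient fun x => w x + θ) 2 (volume.restrict U) := by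
    rw [hUQ]
    refine MemLp.of_bound ?_ M (Eventually.of_forall fun x => ?_)
    · exact ((InnerProductSpace.toDual ℝ 𝔼).symm.continuous.comp
        (hwθ.continuous_fderiv one_ne_zero)).aestronglyMeasurable
    · rw [hgn]; simpa using hM x
  have ha0 : 0 < a := by rw [ha]; positivity
  have hwi : Integrable fun x => w x + 1 := by
    refine (hw.continuous.add continuous_const).integrable_of_hasCompactSupport ?_
    exact HasCompactSupport.intro hB fun x hx => by simp [hwB x hx]
  have hwQ : ∫ x in Q, (w x + 1) = A := by
    rw [hA]
    exact setIntegral_eq_integral_of_forall_compl_eq_zero fun x hx => by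
      rw [hwB x fun h => hx (hBQ h)]; norm_num
  have hadm : Admissible φ L (fun x => -1 + v x) := by
    refine ⟨⟨?_, _, hweak, hg2⟩, hbound 4, ?_, ?_⟩
    · rw [restrict_interior_cube]; exact hbound 2
    · refine (ae_restrict_iff' hQm.compl).2 ?_
      filter_upwards [hv] with x hx hxQ
      rw [hx, trialExcess, indicator_of_notMem hxQ, add_zero]
    · rw [setAverage_eq, integral_congr_ae huQ]
      have e : ∀ x, w x + θ = (w x + 1) + (θ - 1) := fun x => by ring
      simp_rw [e]
      rw [integral_add hwi.integrableOn (integrable_const _), hwQ, setIntegral_const, hQr,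
        smul_eq_mul, smul_eq_mul]
      have hQ0 : 0 < (φ * L) ^ d := by positivity
      rw [inv_mul_eq_iff_eq_mul₀ hQ0.ne']
      have h1 : (φ * L) ^ d * θ = a - A := by
        rw [hθ]
        have : a / φ = (φ * L) ^ d := by rw [ha]; field_simp
        rw [← this]; field_simp
      have h2 : (φ * L) ^ d * φ = a := by rw [ha, mul_comm]
      linear_combination h1 - h2
  rw [energyGap_eq hφ hL hadm hweak hg2, EReal.coe_le_coe_iff, ← ha]
  -- the gradient term
  have hGi : Integrable fun x => G (w x) := by
    refine (continuous_G.comp hw.continuous).integrable_of_hasCompactSupport ?_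
    exact HasCompactSupport.intro hB fun x hx => by simp [hwB x hx, G]
  have hdi : Integrable fun x => ‖fderiv ℝ w x‖ ^ 2 :=
    (hdwc.pow 2).integrable_of_hasCompactSupport
      (HasCompactSupport.intro hB fun x hx => by simp [hdwB x hx])
  have h1 : ∫ x in U, ‖gradient (fun x => w x + θ) x‖ ^ 2 ≤ ∫ x, ‖fderiv ℝ w x‖ ^ 2 := by
    simp_rw [hgn]
    exact setIntegral_le_integral hdi (Eventually.of_forall fun x => by positivity)
  -- the potential term
  set k := 9 / 4 * (1 + 1 / lam) * θ ^ 2 with hk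
  have hk0 : 0 ≤ k := by positivity
  have h2 : ∫ x in Q, G (-1 + v x) ≤ (1 + lam) * (∫ x, G (w x)) + G (-1 + θ) * (φ * L) ^ d
      + k * volume.real B := by
    have e1 : ∫ x in Q, G (-1 + v x) = ∫ x in Q, G (w x + θ) := by
      refine integral_congr_ae ?_
      filter_upwards [huQ] with x hx
      rw [hx]
    have hind : IntegrableOn (B.indicator fun _ => k) Q :=
      (integrable_const k).indicator hB.measurableSet
    have hsum1 : IntegrableOn (fun x => (1 + lam) * G (w x)) Q := hGi.integrableOn.const_mul _
    have hsum2 : IntegrableOn (fun x => (1 + lam) * G (w x) + G (-1 + θ)) Q :=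
      hsum1.add (integrable_const _)
    have e2 : ∫ x in Q, ((1 + lam) * G (w x) + G (-1 + θ) + B.indicator (fun _ => k) x)
        = (1 + lam) * (∫ x in Q, G (w x)) + G (-1 + θ) * (φ * L) ^ d + k * volume.real B := by
      rw [integral_add hsum2 hind, integral_add hsum1 (integrable_const _),
        integral_const_mul, setIntegral_const, hQr, setIntegral_indicator hB.measurableSet,
        inter_eq_right.2 hBQ, setIntegral_const, smul_eq_mul, smul_eq_mul]
      ring
    rw [e1]
    calc ∫ x in Q, G (w x + θ)
        ≤ ∫ x in Q, ((1 + lam) * G (w x) + G (-1 + θ) + B.indicator (fun _ => k) x) := by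
          refine integral_mono ((integrable_G_of_memLp_four (hbound 4)).congr ?_)
            (hsum2.add hind) fun x => ?_
          · filter_upwards [huQ] with x hx
            rw [hx]
          · have hG1 := G_nonneg (-1 + θ)
            have hG2 := G_nonneg (w x)
            by_cases hx : x ∈ B
            · simp only [indicator_of_mem hx]
              have := G_add_le (hw1 x) hθ1 hlam
              linarith
            · simp only [indicator_of_notMem hx, hwB x hx]
              have : 0 ≤ (1 + lam) * G (-1) := mul_nonneg (by linarith) (G_nonneg _)
              linarith
      _ = _ := e2
      _ ≤ _ := by
          have := setIntegral_le_integral (s := Q) hGi (Eventually.of_forall fun x => G_nonneg _)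
          have h3 : (1 + lam) * (∫ x in Q, G (w x)) ≤ (1 + lam) * ∫ x, G (w x) := by gcongr
          linarith
  have h3 : 1 / φ * (G (-1 + θ) * (φ * L) ^ d) = (a - A) ^ 2 / a * (1 - θ / 2) ^ 2 := by
    have e3 : (φ * L) ^ d = a / φ := by rw [ha]; field_simp
    rw [G_neg_one_add, e3]
    have e4 : θ ^ 2 = φ ^ 2 * (a - A) ^ 2 / a ^ 2 := by rw [hθ]; ring
    rw [e4]
    field_simp
  have hE : ∫ x, (φ / 2 * ‖fderiv ℝ w x‖ ^ 2 + 1 / φ * G (w x))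
      = φ / 2 * (∫ x, ‖fderiv ℝ w x‖ ^ 2) + 1 / φ * ∫ x, G (w x) := by
    rw [integral_add (hdi.const_mul _) (hGi.const_mul _), integral_const_mul, integral_const_mul]
  have h4 : 1 / φ * (∫ x in Q, G (-1 + v x)) ≤ 1 / φ * ((1 + lam) * (∫ x, G (w x))
      + G (-1 + θ) * (φ * L) ^ d + k * volume.real B) := by gcongr
  have h5 : φ / 2 * (∫ x in U, ‖gradient (fun x => w x + θ) x‖ ^ 2)
      ≤ (1 + lam) * (φ / 2 * ∫ x, ‖fderiv ℝ w x‖ ^ 2) := by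
    have h6 : 0 ≤ ∫ x, ‖fderiv ℝ w x‖ ^ 2 := integral_nonneg fun x => by positivity
    calc _ ≤ φ / 2 * (∫ x, ‖fderiv ℝ w x‖ ^ 2) := by gcongr
      _ ≤ _ := le_mul_of_one_le_left (by positivity) (by linarith)
  rw [hE]
  have h7 : 1 / φ * ((1 + lam) * (∫ x, G (w x))
      + G (-1 + θ) * (φ * L) ^ d + k * volume.real B)
      = (1 + lam) * (1 / φ * ∫ x, G (w x)) + 1 / φ * (G (-1 + θ) * (φ * L) ^ d)
        + 1 / φ * (k * volume.real B) := by ring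
  rw [h7, h3] at h4
  linarith

/-! ### Recovery sequences -/

/-- A diagonal argument: approximate recovery for every tolerance gives a recovery sequence. -/
lemma exists_recovery_of_forall_eventually {X : Type*} [PseudoMetricSpace X] {F : ℕ → X → EReal}
    {x : X} {c : ℝ} (h : ∀ ε : ℝ, 0 < ε → ∀ᶠ n in atTop, ∃ y, dist y x ≤ ε ∧
      F n y ≤ ((c + ε : ℝ) : EReal)) :
    ∃ y : ℕ → X, Tendsto y atTop (𝓝 x) ∧ limsup (fun n => F n (y n)) atTop ≤ (c : EReal) := by
  classical
  set S : ℕ → ℕ → Prop := fun n k =>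
    ∃ y, dist y x ≤ 1 / ((k : ℝ) + 1) ∧ F n y ≤ ((c + 1 / ((k : ℝ) + 1) : ℝ) : EReal) with hS
  set k : ℕ → ℕ := fun n => Nat.findGreatest (S n) n with hk
  set y : ℕ → X := fun n => if hn : S n (k n) then hn.choose else x with hy
  -- for each `k₀` the selected index is eventually at least `k₀`
  have key : ∀ ε : ℝ, 0 < ε → ∀ᶠ n in atTop, dist (y n) x ≤ ε ∧
      F n (y n) ≤ ((c + ε : ℝ) : EReal) := by
    intro ε hε
    obtain ⟨k₀, hk₀⟩ := exists_nat_one_div_lt hε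
    filter_upwards [h (1 / ((k₀ : ℝ) + 1)) (by positivity), eventually_ge_atTop k₀] with n hn hnk
    have h1 : S n (k n) := Nat.findGreatest_spec (P := S n) hnk hn
    have h2 : k₀ ≤ k n := Nat.le_findGreatest hnk hn
    have h3 : 1 / ((k n : ℝ) + 1) ≤ ε := by
      refine le_trans ?_ hk₀.le
      gcongr
    have h4 : y n = h1.choose := by simp only [hy, dif_pos h1]
    rw [h4]
    refine ⟨h1.choose_spec.1.trans h3, h1.choose_spec.2.trans ?_⟩
    exact EReal.coe_le_coe_iff.2 (by linarith)
  refine ⟨y, ?_, ?_⟩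
  · rw [Metric.tendsto_nhds]
    intro ε hε
    filter_upwards [key (ε / 2) (half_pos hε)] with n hn
    linarith [hn.1]
  · by_contra! hlt
    obtain ⟨r, hr1, hr2⟩ := EReal.lt_iff_exists_real_btwn.1 hlt
    have hr1' : c < r := EReal.coe_lt_coe_iff.1 hr1
    refine absurd hr2 (not_lt.2 ?_)
    refine limsup_le_of_le (by isBoundedDefault) ?_
    filter_upwards [key (r - c) (by linarith)] with n hn
    simpa using hn.2

lemma add_rpow_le {q s t : ℝ} (hq : 0 ≤ q) (hs : 0 ≤ s) (ht : 0 ≤ t) :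
    (s + t) ^ q ≤ 2 ^ q * (s ^ q + t ^ q) := by
  wlog h : s ≤ t generalizing s t
  · rw [add_comm s t, add_comm (s ^ q)]
    exact this ht hs (le_of_not_ge h)
  calc (s + t) ^ q ≤ (2 * t) ^ q := Real.rpow_le_rpow (by positivity) (by linarith) hq
    _ = 2 ^ q * t ^ q := Real.mul_rpow (by norm_num) ht
    _ ≤ _ := by
        gcongr
        have : 0 ≤ s ^ q := by positivity
        linarith

lemma rpow_le_of_le_two {q t : ℝ} (hq : 1 ≤ q) (ht : 0 ≤ t) (ht2 : t ≤ 2) :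
    t ^ q ≤ 2 ^ q * t := by
  rcases ht.eq_or_lt with rfl | ht0
  · rw [Real.zero_rpow (by linarith), mul_zero]
  calc t ^ q = t ^ (q - 1) * t := by
        rw [← Real.rpow_add_one ht0.ne']; ring_nf
    _ ≤ 2 ^ (q - 1) * t := by
        gcongr
    _ ≤ 2 ^ q * t := by
        gcongr
        · norm_num
        · linarith

lemma integrable_indicator_one {C : Set 𝔼} (hC : MeasurableSet C) (hCv : volume C < ⊤) :
    Integrable (C.indicator (1 : 𝔼 → ℝ)) :=
  (integrable_indicator_iff hC).2 (integrableOn_const hCv.ne)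

/-- Distance in `L^q` between the trial function and the limit. -/
lemma integral_abs_trialExcess_sub_rpow_le {q : ℝ} (hq : 1 ≤ q) {C : Set 𝔼}
    (hC : MeasurableSet C) (hCv : volume C < ⊤) {φ L : ℝ} (hφL : 0 ≤ φ * L) {w : 𝔼 → ℝ}
    (hw : Continuous w) (hw1 : ∀ x, |w x| ≤ 1) {R : ℝ} (hR : R < φ * L / 2)
    (hwR : ∀ x, R < ‖x‖ → w x = -1) (θ : ℝ) :
    Integrable (fun x => |trialExcess φ L θ w x - 2 * C.indicator 1 x| ^ q) ∧
    ∫ x, |trialExcess φ L θ w x - 2 * C.indicator 1 x| ^ q ≤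
      2 ^ q * (2 ^ q * (∫ x, |w x - (2 * C.indicator 1 x - 1)|) + |θ| ^ q * (φ * L) ^ d) := by
  set Q := cube d φ L with hQdef
  have hQm : MeasurableSet Q := (isClosed_cube φ L).measurableSet
  have hQfin : volume Q < ⊤ := volume_cube_lt_top hφL
  set B := Metric.closedBall (0 : 𝔼) R with hBdef
  have hBQ : B ⊆ Q := (closedBall_subset_interior_cube hR).trans interior_subset
  have hwB : ∀ x, x ∉ B → w x = -1 := fun x hx => hwR x (by simpa [hBdef] using hx)
  set i : 𝔼 → ℝ := C.indicator 1 with hi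
  have hii : Integrable i := integrable_indicator_one hC hCv
  have hi01 : ∀ x, i x = 0 ∨ i x = 1 := fun x => by
    by_cases hx : x ∈ C <;> simp [hi, hx]
  have hwi : Integrable fun x => w x + 1 := by
    refine (hw.add continuous_const).integrable_of_hasCompactSupport ?_
    exact HasCompactSupport.intro (isCompact_closedBall (0 : 𝔼) R) fun x hx => by simp [hwB x hx]
  have hDi : Integrable fun x => |w x - (2 * i x - 1)| := by
    refine (hwi.sub (hii.const_mul 2)).abs.congr (Eventually.of_forall fun x => ?_)
    simp only [Pi.sub_apply]
    congr 1; ring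
  have hθi : Integrable (Q.indicator fun _ : 𝔼 => |θ| ^ q) :=
    (integrable_indicator_iff hQm).2 (integrableOn_const hQfin.ne)
  have hrhs : Integrable fun x => 2 ^ q * (2 ^ q * |w x - (2 * i x - 1)|
      + Q.indicator (fun _ : 𝔼 => |θ| ^ q) x) := ((hDi.const_mul _).add hθi).const_mul _
  have hpt : ∀ x, |trialExcess φ L θ w x - 2 * i x| ^ q ≤ 2 ^ q * (2 ^ q * |w x - (2 * i x - 1)|
      + Q.indicator (fun _ : 𝔼 => |θ| ^ q) x) := by
    intro x
    have h2 : |w x - (2 * i x - 1)| ≤ 2 := by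
      have h1 := abs_le.1 (hw1 x)
      rw [abs_le]
      rcases hi01 x with h | h <;> rw [h] <;> constructor <;> linarith
    have h3 := rpow_le_of_le_two hq (abs_nonneg _) h2
    by_cases hx : x ∈ Q
    · have e : trialExcess φ L θ w x - 2 * i x = (w x - (2 * i x - 1)) + θ := by
        rw [trialExcess, indicator_of_mem hx]; ring
      rw [e, indicator_of_mem hx]
      calc |w x - (2 * i x - 1) + θ| ^ q ≤ (|w x - (2 * i x - 1)| + |θ|) ^ q :=
            Real.rpow_le_rpow (abs_nonneg _) (abs_add_le _ _) (by linarith)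
        _ ≤ 2 ^ q * (|w x - (2 * i x - 1)| ^ q + |θ| ^ q) :=
            add_rpow_le (by linarith) (abs_nonneg _) (abs_nonneg _)
        _ ≤ _ := by gcongr
    · have e : trialExcess φ L θ w x - 2 * i x = w x - (2 * i x - 1) := by
        rw [trialExcess, indicator_of_notMem hx, hwB x fun h => hx (hBQ h)]; ring
      rw [e, indicator_of_notMem hx, add_zero]
      refine h3.trans (le_mul_of_one_le_left (by positivity) ?_)
      exact Real.one_le_rpow (by norm_num) (by linarith)
  have hmeas : AEStronglyMeasurable (fun x => |trialExcess φ L θ w x - 2 * i x| ^ q) := by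
    have h1 : Measurable (trialExcess φ L θ w) :=
      ((hw.measurable.add_const 1).add_const θ).indicator hQm
    have h2 : Measurable i := measurable_one.indicator hC
    exact ((measurable_norm.comp (h1.sub (h2.const_mul 2))).pow_const q).aestronglyMeasurable
  have hint : Integrable (fun x => |trialExcess φ L θ w x - 2 * i x| ^ q) :=
    hrhs.mono' hmeas (Eventually.of_forall fun x => by
      rw [Real.norm_eq_abs, abs_of_nonneg (by positivity)]; exact hpt x)
  refine ⟨hint, (integral_mono hint hrhs hpt).trans_eq ?_⟩
  rw [integral_const_mul, integral_add (hDi.const_mul _) hθi, integral_const_mul,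
    integral_indicator hQm, setIntegral_const, volume_real_cube hφL, smul_eq_mul,
    mul_comm (|θ| ^ q)]

/-- Approximate recovery: the phase field of the limit set, corrected to the right mass, is within
any tolerance of the limit in distance and in energy, for large `n`. -/
lemma eventually_exists_energyGap_le {p : ℝ≥0∞} [Fact (1 ≤ p)] (hp : 1 < p) (hp' : p < ⊤)
    {ξ : ℝ} (hξ : 0 < ξ) {φ L : ℕ → ℝ}
    (hφ : ∀ n, 0 < φ n) (hL : ∀ n, 0 < L n) (hφ0 : Tendsto φ atTop (𝓝 0))
    (hφL : Tendsto (fun n => φ n * L n) atTop atTop)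
    (ha : Tendsto (fun n => φ n * (φ n * L n) ^ d) atTop (𝓝 (ξ ^ (d + 1))))
    {v : Lp ℝ p (volume : Measure 𝔼)}
    (hwells : ∀ᵐ x, -1 + v x = 1 ∨ -1 + v x = -1)
    (hP : perimeter {x | -1 + v x = 1} < ⊤) {ε : ℝ} (hε : 0 < ε) :
    ∀ᶠ n in atTop, ∃ y : Lp ℝ p (volume : Measure 𝔼), dist y v ≤ ε ∧
      energyGap (φ n) (L n) (fun x => -1 + y x) ≤
        ((c₀ * (perimeter {x | -1 + v x = 1}).toReal - 4 * volume.real {x | -1 + v x = 1}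
          + 4 * (ξ ^ (d + 1))⁻¹ * volume.real {x | -1 + v x = 1} ^ 2 + ε : ℝ) : EReal) := by
  have hp0 : p ≠ 0 := (zero_lt_one.trans hp).ne'
  set q := p.toReal with hqdef
  have hq : 1 < q := by
    have := (ENNReal.toReal_lt_toReal ENNReal.one_ne_top hp'.ne).2 hp
    simpa using this
  have hvm : Measurable v := (Lp.stronglyMeasurable v).measurable
  set C : Set 𝔼 := {x | -1 + v x = 1} with hCdef
  have hC : MeasurableSet C := measurableSet_eq_fun (hvm.const_add _) measurable_const
  have hCv : volume C < ⊤ := by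
    refine lt_of_le_of_lt (measure_mono ?_)
      ((Lp.memLp v).meas_ge_lt_top hp0 hp'.ne (ε := 1) one_ne_zero)
    intro x hx
    have h1 : -1 + v x = 1 := hx
    have h2 : v x = 2 := by linarith
    change (1 : NNReal) ≤ ‖v x‖₊
    rw [h2, ← NNReal.coe_le_coe]
    simp
  set i : 𝔼 → ℝ := C.indicator 1 with hi
  have hii : Integrable i := integrable_indicator_one hC hCv
  have hv2 : v =ᵐ[volume] fun x => 2 * i x := by
    filter_upwards [hwells] with x hx
    by_cases hxC : x ∈ C
    · have : -1 + v x = 1 := hxC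
      simp only [hi, indicator_of_mem hxC, Pi.one_apply]; linarith
    · rcases hx with hx | hx
      · exact absurd hx hxC
      · simp only [hi, indicator_of_notMem hxC]; linarith
  set P := (perimeter C).toReal with hPdef
  set V := volume.real C with hV
  have hV0 : 0 ≤ V := measureReal_nonneg
  have hint_i : ∫ x, i x = V := by
    rw [hi, integral_indicator_one hC]
  set a₀ := ξ ^ (d + 1) with ha₀
  have ha₀0 : 0 < a₀ := by positivity
  set a : ℕ → ℝ := fun n => φ n * (φ n * L n) ^ d with hadef
  have ha0 : ∀ n, 0 < a n := fun n => by
    have := hφ n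
    have := hL n
    simp only [hadef]; positivity
  set E₀ := c₀ * P - 4 * V + 4 * a₀⁻¹ * V ^ 2 with hE₀
  -- the tolerance `s` for the phase field
  obtain ⟨s, hs0, hsE, hsD⟩ : ∃ s : ℝ, 0 < s ∧
      (1 + s) * (c₀ * P + s) - 4 * V + 2 * s + (2 * V + s) ^ 2 / a₀ < E₀ + ε ∧
      2 ^ q * (2 ^ q * s) < ε ^ q := by
    have hc1 : Continuous fun s : ℝ =>
        (1 + s) * (c₀ * P + s) - 4 * V + 2 * s + (2 * V + s) ^ 2 / a₀ := by fun_prop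
    have hc2 : Continuous fun s : ℝ => (2 : ℝ) ^ q * (2 ^ q * s) := by fun_prop
    have hl1 := (hc1.tendsto 0).mono_left (nhdsWithin_le_nhds (s := Ioi (0 : ℝ)))
    have hl2 := (hc2.tendsto 0).mono_left (nhdsWithin_le_nhds (s := Ioi (0 : ℝ)))
    have e1 : (1 + 0) * (c₀ * P + 0) - 4 * V + 2 * 0 + (2 * V + 0) ^ 2 / a₀ < E₀ + ε := by
      have : (1 + 0) * (c₀ * P + 0) - 4 * V + 2 * 0 + (2 * V + 0) ^ 2 / a₀ = E₀ := by
        rw [hE₀]; field_simp; ring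
      linarith
    have e2 : (2 : ℝ) ^ q * (2 ^ q * 0) < ε ^ q := by
      simp only [mul_zero]; positivity
    obtain ⟨s, h1, h2, h3⟩ := ((hl1.eventually_lt_const e1).and
      ((hl2.eventually_lt_const e2).and self_mem_nhdsWithin)).exists
    exact ⟨s, h3, h1, h2⟩
  obtain ⟨R, hR, hfield⟩ := exists_phaseField hC hCv hP hs0
  set b := volume.real (Metric.closedBall (0 : 𝔼) R) with hb
  -- the explicit upper bounds for energy and distance
  set r : ℕ → ℝ := fun n => (a n + 2 * V + s) / a n with hr
  have hrlim : Tendsto r atTop (𝓝 ((a₀ + 2 * V + s) / a₀)) :=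
    ((ha.add_const _).add_const _).div ha ha₀0.ne'
  have hφr : Tendsto (fun n => φ n * r n) atTop (𝓝 0) := by simpa using hφ0.mul hrlim
  have hEn : Tendsto (fun n => (1 + s) * (c₀ * P + s)
      + (a n - 4 * V + 2 * s + (2 * V + s) ^ 2 / a n) * (1 + φ n * r n / 2) ^ 2
      - a n * (1 - φ n / 2) ^ 2
      + φ n * (9 / 4 * (1 + 1 / s) * r n ^ 2 * b)) atTop
      (𝓝 ((1 + s) * (c₀ * P + s) - 4 * V + 2 * s + (2 * V + s) ^ 2 / a₀)) := by
    have l1 : Tendsto (fun n => a n - 4 * V + 2 * s + (2 * V + s) ^ 2 / a n) atTop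
        (𝓝 (a₀ - 4 * V + 2 * s + (2 * V + s) ^ 2 / a₀)) :=
      ((ha.sub_const _).add_const _).add (tendsto_const_nhds.div ha ha₀0.ne')
    have l2 : Tendsto (fun n => (1 + φ n * r n / 2) ^ 2) atTop (𝓝 1) := by
      simpa using ((hφr.div_const 2).const_add 1).pow 2
    have l3 : Tendsto (fun n => a n * (1 - φ n / 2) ^ 2) atTop (𝓝 a₀) := by
      simpa using ha.mul (((hφ0.div_const 2).const_sub 1).pow 2)
    have l4 : Tendsto (fun n => φ n * (9 / 4 * (1 + 1 / s) * r n ^ 2 * b)) atTop (𝓝 0) := by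
      simpa using hφ0.mul (((hrlim.pow 2).const_mul (9 / 4 * (1 + 1 / s))).mul_const b)
    have := (((l1.mul l2).const_add ((1 + s) * (c₀ * P + s))).sub l3).add l4
    refine this.congr' (Eventually.of_forall fun n => rfl) |>.trans (le_of_eq ?_)
    congr 1; ring
  have hDn : Tendsto (fun n => 2 ^ q * (2 ^ q * s + φ n ^ (q - 1) * (r n ^ q * a n))) atTop
      (𝓝 (2 ^ q * (2 ^ q * s))) := by
    have l1 : Tendsto (fun n => φ n ^ (q - 1)) atTop (𝓝 0) := by
      have := hφ0.rpow_const (p := q - 1) (Or.inr (by linarith))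
      rwa [Real.zero_rpow (by linarith)] at this
    have l2 : Tendsto (fun n => r n ^ q) atTop (𝓝 (((a₀ + 2 * V + s) / a₀) ^ q)) :=
      hrlim.rpow_const (Or.inr (by linarith))
    have := ((l1.mul (l2.mul ha)).const_add (2 ^ q * s)).const_mul (2 ^ q)
    simpa using this
  have hφpos : Tendsto φ atTop (𝓝[>] 0) :=
    tendsto_nhdsWithin_iff.2 ⟨hφ0, Eventually.of_forall hφ⟩
  filter_upwards [hφpos.eventually hfield, hφL.eventually_gt_atTop (2 * R),
    hEn.eventually_lt_const hsE, hDn.eventually_lt_const hsD,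
    hφr.eventually_lt_const one_pos] with n ⟨w, hw, hw1, hwR, hwE, hwD⟩ hnR hnE hnD hnr
  have hφn := hφ n
  have hLn := hL n
  have han := ha0 n
  have hRn : R < φ n * L n / 2 := by linarith
  set A := ∫ x, (w x + 1) with hA
  set θ := φ n * (a n - A) / a n with hθ
  have hwi : Integrable fun x => w x + 1 := by
    refine (hw.continuous.add continuous_const).integrable_of_hasCompactSupport ?_
    exact HasCompactSupport.intro (isCompact_closedBall (0 : 𝔼) R) fun x hx => by
      simp [hwR x (by simpa using hx)]
  have hA0 : 0 ≤ A := integral_nonneg fun x => by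
    have := (abs_le.1 (hw1 x)).1
    simp only [Pi.zero_apply]; linarith
  have hAV : |A - 2 * V| ≤ s := by
    have e : A - 2 * V = ∫ x, (w x - (2 * i x - 1)) := by
      rw [hA, ← hint_i, ← integral_const_mul, ← integral_sub hwi (hii.const_mul 2)]
      congr 1; ext x; ring
    rw [e]
    exact abs_integral_le_integral_abs.trans hwD
  obtain ⟨hAV1, hAV2⟩ := abs_le.1 hAV
  have hr0 : 0 < r n := by simp only [hr]; positivity
  have hθr : |θ| ≤ φ n * r n := by
    rw [hθ, abs_div, abs_mul, abs_of_pos hφn, abs_of_pos han, mul_div_assoc]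
    simp only [hr]
    gcongr
    rw [abs_le]; constructor <;> linarith
  have hθ1 : |θ| ≤ 1 := hθr.trans hnr.le
  obtain ⟨hDi, hDle⟩ := integral_abs_trialExcess_sub_rpow_le hq.le hC hCv
    (mul_pos hφn hLn).le hw.continuous hw1 hRn hwR θ
  -- the trial function as an element of `L^p`
  have hmem : MemLp (trialExcess (φ n) (L n) θ w) p := by
    have hQm : MeasurableSet (cube d (φ n) (L n)) := (isClosed_cube _ _).measurableSet
    rw [trialExcess, memLp_indicator_iff_restrict hQm]
    have : IsFiniteMeasure (volume.restrict (cube d (φ n) (L n))) :=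
      ⟨by simpa using volume_cube_lt_top (mul_pos hφn hLn).le⟩
    refine MemLp.of_bound ((hw.continuous.add continuous_const).add
      continuous_const).aestronglyMeasurable 3 (Eventually.of_forall fun x => ?_)
    have h1 := abs_le.1 (hw1 x)
    have h2 := abs_le.1 hθ1
    rw [Real.norm_eq_abs, abs_le]
    constructor <;> linarith
  refine ⟨hmem.toLp _, ?_, ?_⟩
  · have h1 : ‖hmem.toLp _ - v‖ ^ q < ε ^ q := by
      rw [hqdef, ← (integral_abs_sub_rpow_eq hp' (hmem.toLp _) v).2, ← hqdef]
      have e : ∫ x, |hmem.toLp _ x - v x| ^ q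
          = ∫ x, |trialExcess (φ n) (L n) θ w x - 2 * i x| ^ q := by
        refine integral_congr_ae ?_
        filter_upwards [hmem.coeFn_toLp, hv2] with x h1 h2
        rw [h1, h2]
      rw [e]
      refine lt_of_le_of_lt (hDle.trans ?_) hnD
      have h2 : |θ| ^ q * (φ n * L n) ^ d ≤ φ n ^ (q - 1) * (r n ^ q * a n) := by
        calc |θ| ^ q * (φ n * L n) ^ d ≤ (φ n * r n) ^ q * (φ n * L n) ^ d := by gcongr
          _ = φ n ^ (q - 1) * (r n ^ q * a n) := by
            rw [Real.mul_rpow hφn.le hr0.le]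
            have : φ n ^ q = φ n ^ (q - 1) * φ n := by
              rw [← Real.rpow_add_one hφn.ne']; ring_nf
            rw [this]; simp only [hadef]; ring
      gcongr
    rw [dist_eq_norm]
    exact ((Real.rpow_lt_rpow_iff (norm_nonneg _) hε.le (by linarith)).1 h1).le
  · refine (energyGap_trial_le hφn hLn hw hw1 hRn hwR hA rfl hθ hθ1 hs0 hmem.coeFn_toLp).trans ?_
    rw [EReal.coe_le_coe_iff]
    refine le_trans ?_ hnE.le
    have h1 : (1 + s) * (∫ x, (φ n / 2 * ‖fderiv ℝ w x‖ ^ 2 + 1 / φ n * G (w x)))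
        ≤ (1 + s) * (c₀ * P + s) := by gcongr
    have h2 : (a n - A) ^ 2 / a n * (1 - θ / 2) ^ 2 ≤
        (a n - 4 * V + 2 * s + (2 * V + s) ^ 2 / a n) * (1 + φ n * r n / 2) ^ 2 := by
      have h3 : (a n - A) ^ 2 / a n ≤ a n - 4 * V + 2 * s + (2 * V + s) ^ 2 / a n := by
        have e : (a n - A) ^ 2 / a n = a n - 2 * A + A ^ 2 / a n := by field_simp; ring
        have h4 : A ^ 2 / a n ≤ (2 * V + s) ^ 2 / a n := by gcongr; linarith
        rw [e]; linarith
      have h5 : (1 - θ / 2) ^ 2 ≤ (1 + φ n * r n / 2) ^ 2 := by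
        obtain ⟨h6, h7⟩ := abs_le.1 hθr
        obtain ⟨h8, h9⟩ := abs_le.1 hθ1
        exact pow_le_pow_left₀ (by linarith) (by linarith) 2
      have h6 : 0 ≤ (a n - A) ^ 2 / a n := by positivity
      exact mul_le_mul h3 h5 (sq_nonneg _) (h6.trans h3)
    have h3 : 1 / φ n * (9 / 4 * (1 + 1 / s) * θ ^ 2 * b) ≤
        φ n * (9 / 4 * (1 + 1 / s) * r n ^ 2 * b) := by
      have h4 : θ ^ 2 ≤ (φ n * r n) ^ 2 := by
        rw [← sq_abs θ]; exact pow_le_pow_left₀ (abs_nonneg _) hθr 2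
      have hb0 : 0 ≤ b := measureReal_nonneg
      calc 1 / φ n * (9 / 4 * (1 + 1 / s) * θ ^ 2 * b)
          ≤ 1 / φ n * (9 / 4 * (1 + 1 / s) * (φ n * r n) ^ 2 * b) := by gcongr
        _ = _ := by field_simp
    linarith

lemma exists_recovery {p : ℝ≥0∞} [Fact (1 ≤ p)] (hp : 1 < p) (hp' : p < ⊤)
    {ξ : ℝ} (hξ : 0 < ξ) {φ L : ℕ → ℝ}
    (hφ : ∀ n, 0 < φ n) (hL : ∀ n, 0 < L n) (hφ0 : Tendsto φ atTop (𝓝 0))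
    (hφL : Tendsto (fun n => φ n * L n) atTop atTop)
    (ha : Tendsto (fun n => φ n * (φ n * L n) ^ d) atTop (𝓝 (ξ ^ (d + 1))))
    (v : Lp ℝ p (volume : Measure 𝔼)) :
    ∃ y : ℕ → Lp ℝ p (volume : Measure 𝔼), Tendsto y atTop (𝓝 v) ∧
      limsup (fun n => energyGap (φ n) (L n) (fun x => -1 + y n x)) atTop ≤
        limitEnergy ξ (fun x => -1 + v x) := by
  by_cases h : (∀ᵐ x, -1 + v x = 1 ∨ -1 + v x = -1) ∧ perimeter {x | -1 + v x = 1} < ⊤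
  · rw [limitEnergy, if_pos h]
    exact exists_recovery_of_forall_eventually fun ε hε =>
      eventually_exists_energyGap_le hp hp' hξ hφ hL hφ0 hφL ha h.1 h.2 hε
  · rw [limitEnergy, if_neg h]
    exact ⟨fun _ => v, tendsto_const_nhds, le_top⟩

/-! ### The scaling regime -/

lemma tendsto_width {ξ : ℝ} (hξ : 0 < ξ) {φ L : ℕ → ℝ} (hL : ∀ n, 0 < L n)
    (hLtop : Tendsto L atTop atTop)
    (hlim : Tendsto (fun n => φ n * L n ^ ((d : ℝ) / ((d : ℝ) + 1))) atTop (𝓝 ξ)) :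
    Tendsto (fun n => φ n * L n) atTop atTop := by
  have h1 : Tendsto (fun n => L n ^ (1 / ((d : ℝ) + 1))) atTop atTop :=
    (tendsto_rpow_atTop (by positivity)).comp hLtop
  refine (hlim.pos_mul_atTop hξ h1).congr fun n => ?_
  rw [mul_assoc, ← Real.rpow_add (hL n), ← add_div, div_self (by positivity), Real.rpow_one]

lemma tendsto_mass {ξ : ℝ} {φ L : ℕ → ℝ} (hL : ∀ n, 0 < L n)
    (hlim : Tendsto (fun n => φ n * L n ^ ((d : ℝ) / ((d : ℝ) + 1))) atTop (𝓝 ξ)) :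
    Tendsto (fun n => φ n * (φ n * L n) ^ d) atTop (𝓝 (ξ ^ (d + 1))) := by
  refine (hlim.pow (d + 1)).congr fun n => ?_
  have h : (L n ^ ((d : ℝ) / ((d : ℝ) + 1))) ^ (d + 1) = L n ^ d := by
    rw [← Real.rpow_natCast, ← Real.rpow_mul (hL n).le, ← Real.rpow_natCast (L n) d]
    congr 1
    push_cast
    field_simp
  rw [mul_pow, h, mul_pow, pow_succ]
  ring

end CahnHilliard

/-- A point of the affine space `-1 + L^p(ℝ^d)` is written `-1 + v` with `v` in `L^p(ℝ^d)`; the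
`L^p`-distance of `-1 + v` and `-1 + w` is that of `v` and `w`. -/
theorem theorem2 (d : ℕ) (hd : 2 ≤ d) (p : ℝ≥0∞) [Fact (1 ≤ p)] (hp : 1 < p) (hp' : p < ⊤)
    (ξ : ℝ) (hξ : 0 < ξ) (φ L : ℕ → ℝ) (hφ : ∀ n, 0 < φ n) (hL : ∀ n, 0 < L n)
    (hφ0 : Tendsto φ atTop (𝓝 0)) (hLtop : Tendsto L atTop atTop)
    (hlim : Tendsto (fun n => φ n * L n ^ ((d : ℝ) / ((d : ℝ) + 1))) atTop (𝓝 ξ)) :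
    CahnHilliard.GammaTendsto
      (fun n (v : Lp ℝ p (volume : Measure (EuclideanSpace ℝ (Fin d)))) =>
        CahnHilliard.energyGap (φ n) (L n) (fun x => -1 + v x))
      (fun v : Lp ℝ p (volume : Measure (EuclideanSpace ℝ (Fin d))) =>
        CahnHilliard.limitEnergy ξ (fun x => -1 + v x)) := by
  have hφL := CahnHilliard.tendsto_width hξ hL hLtop hlim
  have ha := CahnHilliard.tendsto_mass hL hlim
  exact ⟨fun v y hy => CahnHilliard.limitEnergy_le_liminf hp' hξ hφ hL hφ0 hφL ha hy,
    fun v => CahnHilliard.exists_recovery hp hp' hξ hφ hL hφ0 hφL ha v⟩
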